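/- Let $\Gamma$ be the dual graph of a good resolution of a normal surface singularity whose link is a rational homology sphere: a finite tree, here with at least two vertices, each vertex $x$ (a smooth rational curve $E_x$) weighted by $E_x\cdot E_x\in\mathbb Z$, whose intersection matrix $A=(E_x\cdot E_y)$ is negative definite ($E_x\cdot E_y$ is $1$ for adjacent and $0$ for distinct non-adjacent $x,y$). Let $\Delta$ be its splice diagram: the tree obtained from $\Gamma$ by replacing each maximal string by a single edge (so that its vertices are the vertices of $\Gamma$ of valence $\neq 2$), where at each node $v$ (vertex of valence $\delta_v\ge 3$) every incident edge $e$ carries the weight $d_{ve}=\det(-A(\Gamma_{ve}))$, with $\Gamma_{ve}$ the subgraph of $\Gamma$ cut off at $v$ in the direction of $e$. An end of $\Delta$ is a vertex of valence $1$; let $n$ be the number of ends. For a node $v$ put $d_v=\prod_e d_{ve}$; for a node $v$ and an end $w$ let $\ell_{vw}$ be the product of the edge weights adjacent to, but not on, the path from $v$ to $w$ in $\Delta$, and $\ell'_{vw}$ the same product without the weights adjacent to $v$. Let $\Delta_{ve}$ be the subtree of $\Delta$ cut off by $e$ at $v$. Assume the semigroup condition: for each node $v$ and each edge $e$ at $v$,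 $d_{ve}$ lies in $\mathbb N\langle \ell'_{vw} : w \text{ an end of } \Delta \text{ in } \Delta_{ve}\rangle$. Associate a variable $z_w$ to each end $w$. An admissible monomial for the edge $e$ at the node $v$ is a monomial $\prod_w z_w^{\alpha_w}$, over the ends $w$ of $\Delta$ in $\Delta_{ve}$, with $\alpha_w\in\mathbb N$ and $\sum_w\alpha_w\ell_{vw}=d_v$. Theorem. For every node $v$ and edge $e$ at $v$ there is an admissible monomial. Choose, for every node $v$ and edge $e$ at $v$, a nonempty finite set $S_{ve}$ of admissible monomials. For each node $v$ consider $\delta_v-2$ linear combinations, with complex coefficients, of the monomials in $\bigcup_e S_{ve}$, and equate them to zero. If the coefficients are sufficiently general, then this system consists of $n-2$ equations in the $n$ variables $z_w$ and defines an isolated complete intersection surface singularity at the origin: the origin is a solution, the zero scheme has dimension $2$ at the origin, and in a neighbourhood of the origin the differentials of the equations are linearly independent at every solution other than the origin (the origin itself may be a smooth point). Here "sufficiently general" means the following. There is a nonempty Zariski-open subset $U$ of the space of all coefficients of the system such that the conclusion holds for all coefficients in $U$. Moreover, at the nodes $v$ for which every $S_{ve}$ consists of just one monomial, no more is needed than that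 all maximal minors of the $(\delta_v-2)\times\delta_v$ matrix of coefficients are nonzero: $U$ can be chosen so that any choice of coefficients at all such nodes that satisfies this condition can be completed, by coefficients at the remaining nodes, to an element of $U$. In particular, if every $S_{ve}$ consists of just one monomial, then $U$ contains all systems of coefficients for which all these maximal minors are nonzero, at every node. -/

import Mathlib

open Topology

namespace SpliceSing

/-! ### Graphs -/

/-- The valency of a vertex of a graph (used for finite graphs only). -/
noncomputable def valency {V : Type*} (G : SimpleGraph V) (v : V) : ℕ :=
  (G.neighborSet v).ncard

/-- The part of `G` cut off by an edge at `v` leading towards `u` (`u ≠ v`), when `G` is a tree: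
the vertices of the connected component of `G - v` that contains `u`. -/
def cutOff {V : Type*} (G : SimpleGraph V) (v u : V) : Set V :=
  {x | ∃ p : G.Walk u x, v ∉ p.support}

/-- The vertices (endpoints included) on the path from `v` to `w`, when `G` is a tree. -/
def onPath {V : Type*} (G : SimpleGraph V) (v w : V) : Set V :=
  {x | ∃ p : G.Walk v w, p.IsPath ∧ x ∈ p.support}

open scoped Classical in
/-- The intersection matrix of a graph whose vertices are weighted by `e`. -/
noncomputable def intersectionMatrix {V : Type*} (G : SimpleGraph V) (e : V → ℤ) :
    Matrix V V ℤ :=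
  fun v w => if v = w then e v else if G.Adj v w then 1 else 0

/-! ### Resolution graphs and splice diagrams -/

/-- The dual graph of a good resolution of a normal surface singularity whose link is a rational
homology sphere: a finite tree (every vertex stands for a smooth rational curve), weighted by
self-intersection numbers, with negative definite intersection matrix. -/
structure ResolutionGraph (V : Type*) [Fintype V] where
  graph : SimpleGraph V
  selfInt : V → ℤ
  isTree : graph.IsTree
  negDef : (-(intersectionMatrix graph selfInt).map (Int.cast : ℤ → ℝ)).PosDef

/-- A splice diagram on the vertex set `W`. For a node `v` and a neighbour `u` of `v`, the number
`weight v u` is the weight `d_{ve}` at `v` on the edge `e = vu`; the other values of `weight`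
are never used. -/
structure SpliceDiagram (W : Type*) where
  graph : SimpleGraph W
  weight : W → W → ℤ

namespace ResolutionGraph

open scoped Classical in
/-- `det (-A)` for the full subgraph of the resolution graph on the vertex set `S`. -/
noncomputable def disc {V : Type*} [Fintype V] (Γ : ResolutionGraph V) (S : Set V) : ℤ :=
  ((-intersectionMatrix Γ.graph Γ.selfInt).submatrix
    (Subtype.val : S → V) (Subtype.val : S → V)).det

/-- The vertices of the splice diagram: the vertices of the resolution graph of valency not 2. -/
abbrev SpliceVertex {V : Type*} [Fintype V] (Γ : ResolutionGraph V) : Type _ :=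
  {v : V // valency Γ.graph v ≠ 2}

/-- The tree obtained by replacing each maximal string by a single edge: two vertices are joined
if they are joined in the resolution graph by a path whose interior vertices have valency 2. -/
def spliceGraph {V : Type*} [Fintype V] (Γ : ResolutionGraph V) :
    SimpleGraph Γ.SpliceVertex where
  Adj x y := x ≠ y ∧ ∃ p : Γ.graph.Walk x.1 y.1, p.IsPath ∧
    ∀ u ∈ p.support, u ≠ x.1 → u ≠ y.1 → valency Γ.graph u = 2
  symm := ⟨by
    rintro x y ⟨hne, p, hp, h⟩
    refine ⟨hne.symm, p.reverse, hp.reverse, fun u hu h1 h2 => h u ?_ h2 h1⟩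
    simpa using hu⟩
  loopless := ⟨fun x h => h.1 rfl⟩

/-- The splice diagram of a resolution graph. The weight at `v` on the edge to `u` is the
determinant `det (-A)` of the subgraph of the resolution graph cut off at `v` in the direction
of that edge. -/
noncomputable def spliceDiagram {V : Type*} [Fintype V] (Γ : ResolutionGraph V) :
    SpliceDiagram Γ.SpliceVertex where
  graph := Γ.spliceGraph
  weight v u := Γ.disc (cutOff Γ.graph v.1 u.1)

end ResolutionGraph

namespace SpliceDiagram

/-- Nodes: vertices of valency at least 3. -/
abbrev Node {W : Type*} (Δ : SpliceDiagram W) : Type _ := {v : W // 3 ≤ valency Δ.graph v}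

/-- Ends: vertices of valency 1. -/
abbrev End {W : Type*} (Δ : SpliceDiagram W) : Type _ := {w : W // valency Δ.graph w = 1}

/-- The edges at a vertex `v`, each given by its other endpoint. -/
abbrev EdgeAt {W : Type*} (Δ : SpliceDiagram W) (v : W) : Type _ := {u : W // Δ.graph.Adj v u}

open scoped Classical in
/-- `d_v`, the product of the edge weights adjacent to `v`. -/
noncomputable def nodeWeight {W : Type*} [Fintype W] (Δ : SpliceDiagram W) (v : W) : ℤ :=
  ∏ u : Δ.EdgeAt v, Δ.weight v u.1

open scoped Classical in
/-- `ℓ_{vw}`, the product of the edge weights adjacent to, but not on, the path from `v` to `w`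
(only nodes carry edge weights). -/
noncomputable def linking {W : Type*} [Fintype W] (Δ : SpliceDiagram W) (v w : W) : ℤ :=
  ∏ x : Δ.Node with x.1 ∈ onPath Δ.graph v w,
    ∏ u : Δ.EdgeAt x.1 with u.1 ∉ onPath Δ.graph v w, Δ.weight x.1 u.1

open scoped Classical in
/-- `ℓ'_{vw}`, the same product, but excluding the weights adjacent to `v`. -/
noncomputable def linking' {W : Type*} [Fintype W] (Δ : SpliceDiagram W) (v w : W) : ℤ :=
  ∏ x : Δ.Node with x.1 ∈ onPath Δ.graph v w ∧ x.1 ≠ v,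
    ∏ u : Δ.EdgeAt x.1 with u.1 ∉ onPath Δ.graph v w, Δ.weight x.1 u.1

/-- The semigroup condition. -/
def SemigroupCondition {W : Type*} [Fintype W] (Δ : SpliceDiagram W) : Prop :=
  ∀ (v : Δ.Node) (u : Δ.EdgeAt v.1), Δ.weight v.1 u.1 ∈
    AddSubmonoid.closure {a : ℤ | ∃ w : Δ.End, w.1 ∈ cutOff Δ.graph v.1 u.1 ∧
      a = Δ.linking' v.1 w.1}

/-- The exponent vector `α` is that of an admissible monomial for the edge `u` at the node `v`:
it involves only ends in the subtree cut off by the edge, and its `v`-weight is `d_v`. -/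
def IsAdmissible {W : Type*} [Fintype W] (Δ : SpliceDiagram W) (v : Δ.Node) (u : Δ.EdgeAt v.1)
    (α : Δ.End →₀ ℕ) : Prop :=
  (∀ w ∈ α.support, w.1 ∈ cutOff Δ.graph v.1 u.1) ∧
    α.sum (fun w a => (a : ℤ) * Δ.linking v.1 w.1) = Δ.nodeWeight v.1

/-- A choice of finitely many exponent vectors for every edge at every node. -/
abbrev MonomialChoice {W : Type*} (Δ : SpliceDiagram W) : Type _ :=
  ∀ v : Δ.Node, Δ.EdgeAt v.1 → Finset (Δ.End →₀ ℕ)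

/-- At least one monomial is chosen for every edge at every node, and all of them are
admissible. -/
def MonomialChoice.IsValid {W : Type*} [Fintype W] {Δ : SpliceDiagram W}
    (S : Δ.MonomialChoice) : Prop :=
  ∀ (v : Δ.Node) (u : Δ.EdgeAt v.1), (S v u).Nonempty ∧ ∀ α ∈ S v u, Δ.IsAdmissible v u α

/-- Just one monomial is chosen for each edge at the node `v`. -/
def MonomialChoice.IsSingleAt {W : Type*} {Δ : SpliceDiagram W} (S : Δ.MonomialChoice)
    (v : Δ.Node) : Prop :=
  ∀ u : Δ.EdgeAt v.1, (S v u).card = 1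

/-- The monomials chosen at the node `v`. -/
abbrev MonomialChoice.Mon {W : Type*} {Δ : SpliceDiagram W} (S : Δ.MonomialChoice)
    (v : Δ.Node) : Type _ :=
  Σ u : Δ.EdgeAt v.1, {α : Δ.End →₀ ℕ // α ∈ S v u}

/-- The equations: there are `δ_v - 2` of them for every node `v`. -/
abbrev EqIndex {W : Type*} (Δ : SpliceDiagram W) : Type _ :=
  Σ v : Δ.Node, Fin (valency Δ.graph v.1 - 2)

/-- The coefficients of the whole system: one for every equation of a node and every monomial
chosen at that node. -/
abbrev MonomialChoice.CoeffIndex {W : Type*} {Δ : SpliceDiagram W} (S : Δ.MonomialChoice) :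
    Type _ :=
  Σ v : Δ.Node, Fin (valency Δ.graph v.1 - 2) × S.Mon v

/-- The matrix of coefficients of the equations at the node `v`. -/
def MonomialChoice.coeffMatrix {W : Type*} {Δ : SpliceDiagram W} (S : Δ.MonomialChoice)
    (c : S.CoeffIndex → ℂ) (v : Δ.Node) :
    Matrix (Fin (valency Δ.graph v.1 - 2)) (S.Mon v) ℂ :=
  fun i m => c ⟨v, (i, m)⟩

/-- All maximal minors of the matrix of coefficients at the node `v` are nonzero. -/
def MonomialChoice.MaximalMinorsNonzero {W : Type*} {Δ : SpliceDiagram W} (S : Δ.MonomialChoice)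
    (c : S.CoeffIndex → ℂ) (v : Δ.Node) : Prop :=
  ∀ g : Fin (valency Δ.graph v.1 - 2) ↪ S.Mon v,
    ((S.coeffMatrix c v).submatrix id g).det ≠ 0

open scoped Classical in
/-- The left-hand sides of the system of equations with coefficients `c`, as polynomials in the
variables `z_w`, `w` an end. -/
noncomputable def MonomialChoice.system {W : Type*} [Fintype W] {Δ : SpliceDiagram W}
    (S : Δ.MonomialChoice) (c : S.CoeffIndex → ℂ) (j : Δ.EqIndex) : MvPolynomial Δ.End ℂ :=
  ∑ m : S.Mon j.1, MvPolynomial.monomial m.2.1 (S.coeffMatrix c j.1 j.2 m)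

end SpliceDiagram

/-! ### Algebraic geometry -/

/-- Zariski-open subsets of affine space `ℂ^ι`. -/
def IsZariskiOpen {ι : Type*} (U : Set (ι → ℂ)) : Prop :=
  ∃ P : Set (MvPolynomial ι ℂ), U = {c | ∃ p ∈ P, MvPolynomial.eval c p ≠ 0}

instance isPrime_ker_eval_zero (σ : Type*) :
    (RingHom.ker (MvPolynomial.eval (0 : σ → ℂ))).IsPrime :=
  RingHom.ker_isPrime _

/-- The local ring at the origin of the affine space with coordinates indexed by `σ`. -/
abbrev LocalRingAtZero (σ : Type*) : Type _ :=
  Localization.AtPrime (RingHom.ker (MvPolynomial.eval (0 : σ → ℂ)))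

/-- The equations `f i = 0` in the variables `z_w` (`w : σ`) define an isolated complete
intersection surface singularity at the origin: the origin is a solution, the local ring at the
origin of the zero scheme has dimension 2, which is the number of variables minus the number of
equations, and at all points other than the origin of the zero set in a neighbourhood of the
origin the differentials of the equations are linearly independent (so that the zero scheme is
smooth there). The origin itself is allowed to be a smooth point. -/
def IsIsolatedCISurfaceSingularity {ι σ : Type*} (f : ι → MvPolynomial σ ℂ) : Prop :=
  (∀ i, MvPolynomial.eval 0 (f i) = 0) ∧
  Nat.card ι + 2 = Nat.card σ ∧
  ringKrullDim (LocalRingAtZero σ ⧸ (Ideal.span (Set.range f)).map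
    (algebraMap (MvPolynomial σ ℂ) (LocalRingAtZero σ))) = 2 ∧
  ∀ᶠ z : σ → ℂ in 𝓝[≠] 0, (∀ i, MvPolynomial.eval z (f i) = 0) →
    LinearIndependent ℂ (fun (i : ι) (w : σ) =>
      MvPolynomial.eval z (MvPolynomial.pderiv w (f i)))

end SpliceSing

/-! Solutions close to the origin are studied tropically. Suppose that, for generic coefficients
`c₀`, no polynomial in coefficients and variables is nonzero at `(c₀, 0)` and vanishes at every pair
(coefficients, nonzero solution) with dependent differentials. Then `(c₀, 0)` lies in the Zariski
closure of these bad pairs, and an ultraproduct (`exists_valuation_of_mem_closure`) turns them into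
one bad pair `(c, z)` over a valued field that specializes to `(c₀, 0)`. The contradiction comes
from leading terms.

Seen from a node `x`, give each variable `z_w` the weight `ℓ_{xw}`. At any other node `y`, the
monomials pointing away from `x` all have weight `ℓ_{xy}`, and those pointing back to `x` are
heavier. Look at the ends where the order of `z_w` divided by `ℓ_{xw}` is minimal. A node with `δ -
2` equations cannot have only `δ - 2` or fewer leading directions, because the minors are nonzero.
Hence, if one end of a branch attains the minimum, all of its ends do, and the ratios of leading
terms are algebraic over the coefficients in that branch (`IsMinEnd.branchGood`). This algebraicity
is what makes genericity at the next node applicable, even with several monomials per edge.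

For the Jacobian, take a relation among the logarithmic gradients, choose a node `x` where its
coefficients are largest after scaling by the size of the equations, and pair the relation with the
linking numbers from `x` to the ends in one leading direction. The rows of the other nodes
contribute less, by a form of Euler's identity; what remains is a linear system at `x` with an
invertible minor, so the largest coefficients are smaller than themselves
(`eq_zero_of_logJacobian`).

The polynomial so obtained yields the Zariski-open set. The dimension is bounded above by a Jacobian
estimate of heights of primes and below by counting equations (`ringKrullDim_quotient_eq_two`).
Generic coefficients are produced from algebraically independent numbers (`exists_isGeneric`).

The weight properties come from the resolution graph. Linking numbers are entries of the adjugate of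
`-A` (`linking_spliceDiagram`), and a maximum principle for this matrix compares `lk x w * lk y y`
with `lk x y * lk y w`: they are equal if `y` separates `x` from `w`, and the former is larger
otherwise. -/

namespace SpliceSing

/-! ### Residues in valued extensions of `ℂ` -/

section Residue

variable {K : Type*} [Field K] [Algebra ℂ K] {Γ₀ : Type*} [LinearOrderedCommGroupWithZero Γ₀]

/-- The element `u` of a valued extension of `ℂ` has a nonzero residue that lies in the
subfield `A` of `ℂ`. -/
def HasResidue (v : Valuation K Γ₀) (A : Subfield ℂ) (u : K) : Prop :=
  ∃ t ∈ A, t ≠ 0 ∧ v (u - algebraMap ℂ K t) < 1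

/-- The valuation is trivial on `ℂ`. -/
def TrivialOnC (v : Valuation K Γ₀) : Prop := ∀ t : ℂ, t ≠ 0 → v (algebraMap ℂ K t) = 1

variable {v : Valuation K Γ₀}

lemma TrivialOnC.le_one (hv : TrivialOnC v) (t : ℂ) : v (algebraMap ℂ K t) ≤ 1 := by
  by_cases ht : t = 0
  · simp [ht]
  · exact (hv t ht).le

lemma TrivialOnC.mul_le (hv : TrivialOnC v) (t : ℂ) (u : K) :
    v (algebraMap ℂ K t * u) ≤ v u := by
  rw [map_mul]
  exact mul_le_of_le_one_left' (hv.le_one t)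

lemma TrivialOnC.natCast (hv : TrivialOnC v) {n : ℕ} (hn : n ≠ 0) : v (n : K) = 1 := by
  have := hv (n : ℂ) (by exact_mod_cast hn)
  simpa using this

lemma TrivialOnC.natCast_le (hv : TrivialOnC v) (n : ℕ) : v (n : K) ≤ 1 := by
  have := hv.le_one (n : ℂ)
  simpa using this

lemma val_eq_one_of_sub (hv : TrivialOnC v) {u : K} {t : ℂ} (ht : t ≠ 0)
    (h : v (u - algebraMap ℂ K t) < 1) : v u = 1 := by
  have h1 := hv t ht
  have : u = (u - algebraMap ℂ K t) + algebraMap ℂ K t := by ring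
  rw [this, Valuation.map_add_eq_of_lt_right v (by rwa [h1]), h1]

namespace HasResidue

variable {A : Subfield ℂ} {u u' : K}

lemma val (hv : TrivialOnC v) (h : HasResidue v A u) : v u = 1 := by
  obtain ⟨t, -, ht, h⟩ := h
  exact val_eq_one_of_sub hv ht h

lemma mono {A' : Subfield ℂ} (hA : A ≤ A') (h : HasResidue v A u) : HasResidue v A' u := by
  obtain ⟨t, h1, h2⟩ := h
  exact ⟨t, hA h1, h2⟩

lemma one : HasResidue v A (1 : K) := ⟨1, A.one_mem, one_ne_zero, by simp⟩

lemma mul (hv : TrivialOnC v) (h : HasResidue v A u) (h' : HasResidue v A u') :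
    HasResidue v A (u * u') := by
  have hu := h.val hv
  obtain ⟨t, h1, h2, h3⟩ := h
  obtain ⟨t', h1', h2', h3'⟩ := h'
  refine ⟨t * t', A.mul_mem h1 h1', mul_ne_zero h2 h2', ?_⟩
  have : u * u' - algebraMap ℂ K (t * t') =
      u * (u' - algebraMap ℂ K t') + algebraMap ℂ K t' * (u - algebraMap ℂ K t) := by
    rw [map_mul]; ring
  rw [this]
  refine v.map_add_lt ?_ ?_
  · rwa [map_mul, hu, one_mul]
  · exact (hv.mul_le _ _).trans_lt h3

lemma inv (hv : TrivialOnC v) (h : HasResidue v A u) : HasResidue v A u⁻¹ := by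
  have hu := h.val hv
  obtain ⟨t, h1, h2, h3⟩ := h
  have hu0 : u ≠ 0 := by rintro rfl; simp at hu
  have ht0 : algebraMap ℂ K t ≠ 0 := by simpa using h2
  refine ⟨t⁻¹, A.inv_mem h1, inv_ne_zero h2, ?_⟩
  have : u⁻¹ - algebraMap ℂ K t⁻¹ = -(u⁻¹ * (algebraMap ℂ K t)⁻¹ * (u - algebraMap ℂ K t)) := by
    rw [map_inv₀]; field_simp; ring
  rw [this, Valuation.map_neg, map_mul, map_mul, map_inv₀, map_inv₀, hu, hv t h2]
  simpa using h3

lemma div (hv : TrivialOnC v) (h : HasResidue v A u) (h' : HasResidue v A u') :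
    HasResidue v A (u / u') := by
  rw [div_eq_mul_inv]; exact h.mul hv (h'.inv hv)

lemma pow (hv : TrivialOnC v) (h : HasResidue v A u) (n : ℕ) : HasResidue v A (u ^ n) := by
  induction n with
  | zero => simpa using one
  | succ n ih => rw [pow_succ]; exact ih.mul hv h

lemma prod (hv : TrivialOnC v) {ι : Type*} (s : Finset ι) (f : ι → K)
    (h : ∀ i ∈ s, HasResidue v A (f i)) : HasResidue v A (∏ i ∈ s, f i) := by
  classical
  induction s using Finset.induction_on with
  | empty => simpa using one
  | insert a s ha ih =>
    rw [Finset.prod_insert ha]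
    exact (h a (by simp)).mul hv (ih fun i hi => h i (by simp [hi]))

/-- Elements with a residue in a root-closed subfield form a root-closed set. -/
lemma of_pow (hA : ∀ (t : ℂ) (n : ℕ), 0 < n → t ^ n ∈ A → t ∈ A) {n : ℕ}
    (hn : 0 < n) (h : HasResidue v A (u ^ n)) : HasResidue v A u := by
  obtain ⟨t, h1, h2, h3⟩ := h
  set p : Polynomial ℂ := Polynomial.X ^ n - Polynomial.C t with hp
  have hmon : p.Monic := Polynomial.monic_X_pow_sub_C t hn.ne'
  have hprod : (p.roots.map fun a => Polynomial.X - Polynomial.C a).prod = p :=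
    Polynomial.prod_multiset_X_sub_C_of_monic_of_roots_card_eq hmon
      IsAlgClosed.card_roots_eq_natDegree
  have heval : (p.roots.map fun a => u - algebraMap ℂ K a).prod = u ^ n - algebraMap ℂ K t := by
    have := congrArg (Polynomial.aeval u) hprod
    rw [map_multiset_prod, Multiset.map_map] at this
    simpa [hp, Function.comp_def] using this
  -- The product of `u - a` over the `n`-th roots `a` of `t` is `u ^ n - t`, of valuation less than
  -- 1, so some factor has valuation less than 1.
  have key : ∃ a ∈ p.roots, v (u - algebraMap ℂ K a) < 1 := by
    by_contra! hcon
    have : ∀ s : Multiset ℂ, (∀ a ∈ s, 1 ≤ v (u - algebraMap ℂ K a)) →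
        1 ≤ v (s.map fun a => u - algebraMap ℂ K a).prod := by
      intro s
      induction s using Multiset.induction_on with
      | empty => simp
      | cons a s ih =>
        intro hs
        rw [Multiset.map_cons, Multiset.prod_cons, map_mul]
        exact one_le_mul (hs a (by simp)) (ih fun b hb => hs b (by simp [hb]))
    have h4 := this _ hcon
    rw [heval] at h4
    exact absurd h3 h4.not_gt
  obtain ⟨a, ha, hva⟩ := key
  have hroot : a ^ n = t := by
    have := (Polynomial.mem_roots hmon.ne_zero).1 ha
    simpa [hp, sub_eq_zero] using this
  refine ⟨a, hA a n hn (hroot ▸ h1), ?_, hva⟩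
  rintro rfl
  rw [zero_pow hn.ne'] at hroot
  exact h2 hroot.symm

end HasResidue

/-- A complex matrix with nonzero determinant is an isometry for the maximum of valuations. -/
lemma val_lt_of_mulVec_lt (hv : TrivialOnC v) {r : ℕ} (P : Matrix (Fin r) (Fin r) ℂ)
    (hdet : P.det ≠ 0) (u : Fin r → K) {M : Γ₀} (hM : M ≠ 0)
    (h : ∀ i, v (∑ j, algebraMap ℂ K (P i j) * u j) < M) (j : Fin r) : v (u j) < M := by
  have hu : u j = ∑ i, algebraMap ℂ K (P⁻¹ j i) * ∑ k, algebraMap ℂ K (P i k) * u k := by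
    have h1 : (P⁻¹.map (algebraMap ℂ K)) * P.map (algebraMap ℂ K) = 1 := by
      rw [← Matrix.map_mul, Matrix.nonsing_inv_mul _ (Ne.isUnit hdet)]
      simp
    have h2 := congrArg (fun Q : Matrix (Fin r) (Fin r) K => (Q.mulVec u) j) h1
    simp only [← Matrix.mulVec_mulVec, Matrix.one_mulVec] at h2
    rw [← h2]
    simp [Matrix.mulVec, dotProduct]
  rw [hu]
  exact v.map_sum_lt hM fun i _ => (hv.mul_le _ _).trans_lt (h i)

end Residue

/-! ### Abstract splice type systems -/

/-- The combinatorial data of a system of splice type: nodes `N`, ends `L`, the directions `D x`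
at each node, linking numbers of nodes with ends and of nodes with nodes, and the chosen
monomials. -/
structure SpliceSystem (N L : Type*) (D : N → Type*) where
  /-- the number of equations at a node -/
  r : N → ℕ
  /-- the direction of an end -/
  dirL : ∀ x, L → D x
  /-- the direction of another node -/
  dirN : ∀ x, N → D x
  /-- linking number of a node and an end -/
  linkL : N → L → ℕ
  /-- linking number of two nodes -/
  linkN : N → N → ℕ
  /-- the chosen exponent vectors -/
  S : ∀ x, D x → Finset (L →₀ ℕ)
  one_le_r : ∀ x, 1 ≤ r x
  card_dir : ∀ x, Nat.card (D x) = r x + 2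
  linkL_pos : ∀ x w, 0 < linkL x w
  linkN_pos : ∀ x y, 0 < linkN x y
  nonempty : ∀ x e, (S x e).Nonempty
  dirL_of_mem : ∀ x e, ∀ α ∈ S x e, ∀ w ∈ α.support, dirL x w = e
  -- The weights seen from `x` do not distinguish the monomials at `y` that point away from `x`, and
  -- they penalize those that point back; all comparisons of valuations rest on this field and the
  -- next.
  weight_outward : ∀ x y e, ∀ α ∈ S y e, (y = x ∨ e ≠ dirN y x) →
    (α.sum fun w a => a * linkL x w) = linkN x y
  weight_inward : ∀ x y, y ≠ x → ∀ α ∈ S y (dirN y x),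
    linkN x y < α.sum fun w a => a * linkL x w
  dirL_eq : ∀ x y w, x ≠ y → dirL y w ≠ dirN y x → dirL x w = dirN x y
  dirN_eq : ∀ x y z, x ≠ y → z ≠ y → dirN y z ≠ dirN y x → dirN x z = dirN x y
  -- This field drives the induction along branches: a direction is a single end or begins with a
  -- next node `c`.
  edge : ∀ y e, (∃ w₀, ∀ w, dirL y w = e ↔ w = w₀) ∨
    ∃ c, c ≠ y ∧ dirN y c = e ∧ ∀ w, dirL y w = e ↔ dirL c w ≠ dirN c y

/-- The elements of `ℂ` that are algebraic over the field generated by a set of numbers. -/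
noncomputable def algClosureOf (s : Set ℂ) : Subfield ℂ :=
  (algebraicClosure (IntermediateField.adjoin ℚ s) ℂ).toSubfield

lemma mem_algClosureOf {s : Set ℂ} {t : ℂ} :
    t ∈ algClosureOf s ↔ IsAlgebraic (IntermediateField.adjoin ℚ s) t := by
  rw [algClosureOf, IntermediateField.mem_toSubfield, mem_algebraicClosure_iff]

lemma subset_algClosureOf {s : Set ℂ} {t : ℂ} (h : t ∈ s) : t ∈ algClosureOf s :=
  mem_algClosureOf.2 (isAlgebraic_algebraMap
    (⟨t, IntermediateField.subset_adjoin ℚ s h⟩ : IntermediateField.adjoin ℚ s))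

lemma algClosureOf_mono {s s' : Set ℂ} (h : s ⊆ s') : algClosureOf s ≤ algClosureOf s' := by
  intro t ht
  rw [mem_algClosureOf] at ht ⊢
  have hle := IntermediateField.adjoin.mono ℚ s s' h
  let : Algebra (IntermediateField.adjoin ℚ s) (IntermediateField.adjoin ℚ s') :=
    (IntermediateField.inclusion hle).toRingHom.toAlgebra
  have : IsScalarTower (IntermediateField.adjoin ℚ s) (IntermediateField.adjoin ℚ s') ℂ :=
    IsScalarTower.of_algebraMap_eq fun x => rfl
  exact ht.tower_top _

/-- Leading-term equations determine only powers of ratios of coordinates; closure under roots lets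
`HasResidue.of_pow` descend to the ratios themselves. -/
lemma mem_algClosureOf_of_pow {s : Set ℂ} (t : ℂ) (n : ℕ) (hn : 0 < n)
    (h : t ^ n ∈ algClosureOf s) : t ∈ algClosureOf s := by
  rw [mem_algClosureOf] at h ⊢
  exact h.of_pow hn

namespace SpliceSystem

variable {N L : Type*} {D : N → Type*} (T : SpliceSystem N L D)

/-- The chosen monomials at a node. -/
abbrev Mon (x : N) : Type _ := Σ e : D x, {α : L →₀ ℕ // α ∈ T.S x e}

/-- The index set of the coefficients. -/
abbrev Idx : Type _ := Σ x : N, Fin (T.r x) × T.Mon x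

/-- The numbers algebraic over the coefficients at the nodes of a set. -/
noncomputable def coeffField (c₀ : T.Idx → ℂ) (s : Set N) : Subfield ℂ :=
  algClosureOf {t | ∃ j : T.Idx, j.1 ∈ s ∧ c₀ j = t}

lemma coeffField_mono (c₀ : T.Idx → ℂ) {s s' : Set N} (h : s ⊆ s') :
    T.coeffField c₀ s ≤ T.coeffField c₀ s' :=
  algClosureOf_mono fun _ ⟨j, hj, e⟩ => ⟨j, h hj, e⟩

lemma coeff_mem (c₀ : T.Idx → ℂ) {s : Set N} (j : T.Idx) (hj : j.1 ∈ s) :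
    c₀ j ∈ T.coeffField c₀ s :=
  subset_algClosureOf ⟨j, hj, rfl⟩

/-- Genericity of a system of coefficients: the maximal minors of the coefficient matrix at a
node stay nonzero when in each direction the columns are combined with nonzero factors
that are algebraic over the coefficients at the other nodes. -/
def IsGeneric (c₀ : T.Idx → ℂ) : Prop :=
  ∀ (x : N) (θ : T.Mon x → ℂ), (∀ m, θ m ∈ T.coeffField c₀ {x}ᶜ ∧ θ m ≠ 0) →
    ∀ g : Fin (T.r x) → D x, Function.Injective g →
      (Matrix.of fun i j => ∑ α : {α // α ∈ T.S x (g j)}, c₀ ⟨x, (i, ⟨g j, α⟩)⟩ * θ ⟨g j, α⟩).det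
        ≠ 0

/-- The value of a monomial. -/
noncomputable def mono {K : Type*} [Field K] (z : L → K) (α : L →₀ ℕ) : K :=
  α.prod fun w a => z w ^ a

/-- The part of the `i`-th equation at the node `x` that comes from the direction `e`. -/
noncomputable def part {K : Type*} [Field K] (c : T.Idx → K) (z : L → K) (x : N)
    (i : Fin (T.r x)) (e : D x) : K :=
  ∑ α : {α // α ∈ T.S x e}, c ⟨x, (i, ⟨e, α⟩)⟩ * mono z α.1

/-- The nodes in a given direction. -/
def nodesIn (y : N) (e : D y) : Set N := {c | c ≠ y ∧ T.dirN y c = e}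

/-- Directions at `y` that do not lead to `x`. -/
def Outward (x y : N) (e : D y) : Prop := y = x ∨ e ≠ T.dirN y x

/-- Nested branches provide both the decreasing size for inductions and the inclusions between
coefficient fields. -/
lemma nodesIn_subset {y c : N} (hcy : c ≠ y) {e' : D c} (he' : e' ≠ T.dirN c y) :
    T.nodesIn c e' ⊆ T.nodesIn y (T.dirN y c) := by
  rintro z ⟨hz, rfl⟩
  have hzy : z ≠ y := by rintro rfl; exact he' rfl
  exact ⟨hzy, T.dirN_eq y c z hcy.symm hz he'⟩

/-- The weight of a chosen monomial is a positive linking number, so the monomial is not constant.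
-/
lemma exists_mem_support {x : N} {e : D x} {α : L →₀ ℕ} (hα : α ∈ T.S x e) :
    ∃ w, w ∈ α.support := by
  by_contra! h
  have h0 : α = 0 := by ext w; simpa using h w
  have := T.weight_outward x x e α hα (Or.inl rfl)
  rw [h0] at this
  simp at this
  exact (T.linkN_pos x x).ne this

lemma exists_dirL_eq (x : N) (e : D x) : ∃ w, T.dirL x w = e := by
  obtain ⟨α, hα⟩ := T.nonempty x e
  obtain ⟨w, hw⟩ := T.exists_mem_support hα
  exact ⟨w, T.dirL_of_mem x e α hα w hw⟩

/-! ### The tropical picture seen from a node -/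

section Root

variable {K : Type*} [Field K] {Γ₀ : Type*} [LinearOrderedCommGroupWithZero Γ₀]
  {v : Valuation K Γ₀} {z : L → K}

/-- The end `w₁` minimizes the order of vanishing divided by the linking number with `x`. -/
structure IsMinEnd (v : Valuation K Γ₀) (z : L → K) (x : N) (w₁ : L) : Prop where
  ne_zero : v (z w₁) ≠ 0
  le : ∀ w, v (z w) ^ T.linkL x w₁ ≤ v (z w₁) ^ T.linkL x w

/-- The end `w` attains the minimum. -/
def Attains (v : Valuation K Γ₀) (z : L → K) (x : N) (w₁ w : L) : Prop :=
  v (z w) ^ T.linkL x w₁ = v (z w₁) ^ T.linkL x w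

/-- Instead of comparing `ℓ_w`-th roots of valuations, maximize `v (z w) ^ (P / ℓ_w)`, where `P` is
the product of all linking numbers `ℓ_w`. In multiplicative notation a maximal valuation is a
minimal order. -/
lemma exists_isMinEnd [Fintype L] (x : N) (hz : z ≠ 0) : ∃ w₁, T.IsMinEnd v z x w₁ := by
  classical
  set P : ℕ := ∏ w, T.linkL x w with hP
  have hdvd : ∀ w, T.linkL x w ∣ P := fun w => Finset.dvd_prod_of_mem _ (Finset.mem_univ w)
  have hPpos : 0 < P := Finset.prod_pos fun w _ => T.linkL_pos x w
  obtain ⟨w₂, hw₂⟩ : ∃ w, z w ≠ 0 := by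
    by_contra! h
    exact hz (funext h)
  obtain ⟨w₁, -, hw₁⟩ := Finset.exists_max_image Finset.univ
    (fun w => v (z w) ^ (P / T.linkL x w)) ⟨w₂, Finset.mem_univ _⟩
  have hq : ∀ w, P / T.linkL x w ≠ 0 := fun w =>
    (Nat.div_pos (Nat.le_of_dvd hPpos (hdvd w)) (T.linkL_pos x w)).ne'
  refine ⟨w₁, ?_, ?_⟩
  · intro h0
    have h1 := hw₁ w₂ (Finset.mem_univ _)
    rw [h0, zero_pow (hq _), le_zero_iff] at h1
    have h2 : v (z w₂) = 0 := by simpa using eq_zero_of_pow_eq_zero h1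
    exact hw₂ (by simpa using h2)
  · intro w
    have h1 := hw₁ w (Finset.mem_univ _)
    have h2 := pow_le_pow_left₀ zero_le h1 (T.linkL x w * T.linkL x w₁)
    refine (pow_le_pow_iff_left₀ zero_le zero_le hPpos.ne').1 ?_
    rw [← pow_mul, ← pow_mul] at h2 ⊢
    have e1 : P / T.linkL x w * (T.linkL x w * T.linkL x w₁) = T.linkL x w₁ * P := by
      rw [← mul_assoc, Nat.div_mul_cancel (hdvd w), mul_comm]
    have e2 : P / T.linkL x w₁ * (T.linkL x w * T.linkL x w₁) = T.linkL x w * P := by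
      rw [mul_comm (T.linkL x w), ← mul_assoc, Nat.div_mul_cancel (hdvd w₁), mul_comm]
    rwa [e1, e2] at h2

variable {T} {x : N} {w₁ : L}

/-- Each variable is compared with the value it would have if its end attained the minimum. The
correction factors are at most 1, and equal to 1 exactly at attaining ends, which gives the three
estimates that follow. -/
lemma IsMinEnd.val_mono_pow (h : T.IsMinEnd v z x w₁) (α : L →₀ ℕ) :
    v (mono z α) ^ T.linkL x w₁ =
      v (z w₁) ^ (α.sum fun w a => a * T.linkL x w) *
        ∏ w ∈ α.support, (v (z w) ^ T.linkL x w₁ / v (z w₁) ^ T.linkL x w) ^ α w := by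
  rw [mono, Finsupp.prod, map_prod, Finsupp.sum, ← Finset.prod_pow_eq_pow_sum,
    ← Finset.prod_mul_distrib, ← Finset.prod_pow]
  refine Finset.prod_congr rfl fun w _ => ?_
  have h0 := pow_ne_zero (T.linkL x w) h.ne_zero
  rw [map_pow, div_pow, ← pow_mul, ← pow_mul, ← pow_mul, mul_comm (α w) (T.linkL x w),
    mul_div_cancel₀ _ (pow_ne_zero _ h.ne_zero), mul_comm]

lemma IsMinEnd.ratio_le (h : T.IsMinEnd v z x w₁) (w : L) :
    v (z w) ^ T.linkL x w₁ / v (z w₁) ^ T.linkL x w ≤ 1 := by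
  rw [div_le_one₀ (pow_pos (zero_lt_iff.2 h.ne_zero) _)]
  exact h.le w

lemma IsMinEnd.val_mono_pow_le (h : T.IsMinEnd v z x w₁) (α : L →₀ ℕ) :
    v (mono z α) ^ T.linkL x w₁ ≤ v (z w₁) ^ (α.sum fun w a => a * T.linkL x w) := by
  rw [h.val_mono_pow α]
  refine mul_le_of_le_one_right' (Finset.prod_le_one' fun w _ => ?_)
  exact pow_le_one' (h.ratio_le w) _

lemma IsMinEnd.val_mono_pow_lt (h : T.IsMinEnd v z x w₁) (α : L →₀ ℕ) {w : L}
    (hw : w ∈ α.support) (hne : ¬ T.Attains v z x w₁ w) :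
    v (mono z α) ^ T.linkL x w₁ < v (z w₁) ^ (α.sum fun w a => a * T.linkL x w) := by
  classical
  rw [h.val_mono_pow α]
  refine mul_lt_of_lt_one_right (pow_pos (zero_lt_iff.2 h.ne_zero) _) ?_
  rw [← Finset.mul_prod_erase _ _ hw]
  refine mul_lt_one_of_lt_of_le ?_ (Finset.prod_le_one' fun w _ => pow_le_one' (h.ratio_le w) _)
  refine pow_lt_one₀ zero_le (lt_of_le_of_ne (h.ratio_le w) ?_) (Finsupp.mem_support_iff.1 hw)
  intro heq
  rw [div_eq_one_iff_eq (pow_ne_zero _ h.ne_zero)] at heq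
  exact hne heq

lemma IsMinEnd.val_mono_pow_eq (h : T.IsMinEnd v z x w₁) (α : L →₀ ℕ)
    (hα : ∀ w ∈ α.support, T.Attains v z x w₁ w) :
    v (mono z α) ^ T.linkL x w₁ = v (z w₁) ^ (α.sum fun w a => a * T.linkL x w) := by
  rw [h.val_mono_pow α, Finset.prod_eq_one, mul_one]
  intro w hw
  have := hα w hw
  rw [Attains] at this
  rw [this, div_self (pow_ne_zero _ h.ne_zero), one_pow]

lemma IsMinEnd.attains_self (_ : T.IsMinEnd v z x w₁) : T.Attains v z x w₁ w₁ := rfl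

lemma IsMinEnd.val_mono_outward_lt (h : T.IsMinEnd v z x w₁) {y : N} {e : D y}
    (hout : T.Outward x y e) {α : L →₀ ℕ} (hα : α ∈ T.S y e)
    (hne : ∀ w, T.dirL y w = e → ¬ T.Attains v z x w₁ w) :
    v (mono z α) ^ T.linkL x w₁ < v (z w₁) ^ T.linkN x y := by
  obtain ⟨w, hw⟩ := T.exists_mem_support hα
  rw [← T.weight_outward x y e α hα hout]
  exact h.val_mono_pow_lt α hw (hne w (T.dirL_of_mem y e α hα w hw))

lemma IsMinEnd.val_mono_outward_eq (h : T.IsMinEnd v z x w₁) {y : N} {e : D y}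
    (hout : T.Outward x y e) {α : L →₀ ℕ} (hα : α ∈ T.S y e)
    (hall : ∀ w, T.dirL y w = e → T.Attains v z x w₁ w) :
    v (mono z α) ^ T.linkL x w₁ = v (z w₁) ^ T.linkN x y := by
  rw [← T.weight_outward x y e α hα hout]
  exact h.val_mono_pow_eq α fun w hw => hall w (T.dirL_of_mem y e α hα w hw)

lemma IsMinEnd.val_mono_inward_lt (h : T.IsMinEnd v z x w₁) (hz : v (z w₁) < 1) {y : N}
    (hyx : y ≠ x) {α : L →₀ ℕ} (hα : α ∈ T.S y (T.dirN y x)) :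
    v (mono z α) ^ T.linkL x w₁ < v (z w₁) ^ T.linkN x y :=
  (h.val_mono_pow_le α).trans_lt
    (pow_lt_pow_right_of_lt_one₀ (zero_lt_iff.2 h.ne_zero) hz (T.weight_inward x y hyx α hα))

end Root

end SpliceSystem

/-! ### Linear algebra of the leading terms at a node -/

lemma exists_mulVec_eq_mem {A : Subfield ℂ} {r : ℕ} (P : Matrix (Fin r) (Fin r) ℂ)
    (hdet : P.det ≠ 0) (hP : ∀ i j, P i j ∈ A) (b : Fin r → ℂ) (hb : ∀ i, b i ∈ A) :
    ∃ t : Fin r → ℂ, (∀ j, t j ∈ A) ∧ ∀ i, ∑ j, P i j * t j = b i := by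
  -- The system is solved over the subfield `A` itself, where the determinant is still nonzero.
  set P' : Matrix (Fin r) (Fin r) A := fun i j => ⟨P i j, hP i j⟩ with hP'
  set b' : Fin r → A := fun i => ⟨b i, hb i⟩
  have hmap : P'.map A.subtype = P := rfl
  have hdet' : P'.det ≠ 0 := by
    intro h
    apply hdet
    rw [← hmap, ← RingHom.mapMatrix_apply, ← RingHom.map_det, h, map_zero]
  refine ⟨fun j => (P'⁻¹.mulVec b') j, fun j => Subtype.property _, fun i => ?_⟩
  have h1 : P'.mulVec (P'⁻¹.mulVec b') = b' := by
    rw [Matrix.mulVec_mulVec, Matrix.mul_nonsing_inv _ (Ne.isUnit hdet'), Matrix.one_mulVec]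
  have h2 := congrArg (fun u : Fin r → A => (u i : ℂ)) h1
  simpa [Matrix.mulVec, dotProduct, P', b'] using h2

namespace SpliceSystem

variable {N L : Type*} {D : N → Type*} {T : SpliceSystem N L D} [∀ x, Fintype (D x)]
  {K : Type*} [Field K] [Algebra ℂ K] {Γ₀ : Type*} [LinearOrderedCommGroupWithZero Γ₀]
  {v : Valuation K Γ₀} {z : L → K} {c₀ : T.Idx → ℂ} {c : T.Idx → K}

/-- Leading terms of the equations at a node `x`: the monomials with directions in `E` have
valuation `M`, the others are smaller, and the parts of the equations with direction `e` in `E`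
have leading terms proportional to the columns of a matrix with nonzero maximal minors. -/
structure LeadingTerms (T : SpliceSystem N L D) (v : Valuation K Γ₀) (z : L → K) (c : T.Idx → K)
    (x : N) (E : Finset (D x)) (M : Γ₀) (X : D x → K) (B : Fin (T.r x) → D x → ℂ) : Prop where
  ne_zero : M ≠ 0
  val_X : ∀ e ∈ E, v (X e) = M
  val_mono : ∀ e ∈ E, ∀ α ∈ T.S x e, v (mono z α) = M
  val_mono_lt : ∀ e, e ∉ E → ∀ α ∈ T.S x e, v (mono z α) < M
  minors : ∀ g : Fin (T.r x) → D x, Function.Injective g →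
    (Matrix.of fun i j => B i (g j)).det ≠ 0
  sub_lt : ∀ i, ∀ e ∈ E, v (T.part c z x i e - algebraMap ℂ K (B i e) * X e) < M

section

variable (hv : TrivialOnC v) (hc : ∀ j, v (c j - algebraMap ℂ K (c₀ j)) < 1)

omit [∀ x, Fintype (D x)] in
include hv hc in
lemma val_coeff_le (j : T.Idx) : v (c j) ≤ 1 := by
  have : c j = (c j - algebraMap ℂ K (c₀ j)) + algebraMap ℂ K (c₀ j) := by ring
  rw [this]
  exact v.map_add_le (hc j).le (hv.le_one _)

omit [∀ x, Fintype (D x)] in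
include hv hc in
lemma val_part_lt {x : N} {i : Fin (T.r x)} {e : D x} {M : Γ₀} (hM : M ≠ 0)
    (h : ∀ α ∈ T.S x e, v (mono z α) < M) : v (T.part c z x i e) < M := by
  refine v.map_sum_lt hM fun α _ => ?_
  rw [map_mul]
  exact (mul_le_of_le_one_left' (val_coeff_le hv hc _)).trans_lt (h α.1 α.2)

end

namespace LeadingTerms

variable {x : N} {E : Finset (D x)} {M : Γ₀} {X : D x → K} {B : Fin (T.r x) → D x → ℂ}
  (h : LeadingTerms T v z c x E M X B) (hv : TrivialOnC v)
  (hc : ∀ j, v (c j - algebraMap ℂ K (c₀ j)) < 1)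
  (heq : ∀ i, ∑ e, T.part c z x i e = 0)

include h hv hc heq in
-- The equation makes the leading parts cancel up to terms of smaller valuation.
lemma sum_lt (i : Fin (T.r x)) : v (∑ e ∈ E, algebraMap ℂ K (B i e) * X e) < M := by
  classical
  have h1 : ∑ e ∈ E, algebraMap ℂ K (B i e) * X e =
      -(∑ e ∈ E, (T.part c z x i e - algebraMap ℂ K (B i e) * X e) +
        ∑ e ∈ Eᶜ, T.part c z x i e) := by
    have h2 := heq i
    rw [← Finset.sum_add_sum_compl E] at h2
    rw [Finset.sum_sub_distrib]
    linear_combination h2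
  rw [h1, Valuation.map_neg]
  refine v.map_add_lt (v.map_sum_lt h.ne_zero fun e he => h.sub_lt i e he)
    (v.map_sum_lt h.ne_zero fun e he => ?_)
  exact val_part_lt hv hc h.ne_zero (h.val_mono_lt e (Finset.mem_compl.1 he))

omit [∀ x, Fintype (D x)] in
variable (K) in
omit [Algebra ℂ K] in
lemma exists_enum (F : Finset (D x)) (hF : F.card = T.r x) :
    ∃ g : Fin (T.r x) → D x, Function.Injective g ∧ (∀ j, g j ∈ F) ∧ (∀ e ∈ F, ∃ j, g j = e) ∧
      ∀ f : D x → K, ∑ j, f (g j) = ∑ e ∈ F, f e := by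
  let ε := F.equivFinOfCardEq hF
  refine ⟨fun j => (ε.symm j).1, fun a b hab => ε.symm.injective (Subtype.ext hab),
    fun j => (ε.symm j).2, fun e he => ⟨ε ⟨e, he⟩, by simp⟩, ?_⟩
  intro f
  rw [Equiv.sum_comp ε.symm (fun e : F => f e.1), Finset.sum_coe_sort F f]

omit [∀ x, Fintype (D x)] in
include h hv in
lemma val_lt_of_sum_lt (F : Finset (D x)) (hF : F.card = T.r x) (u : D x → K) {M' : Γ₀}
    (hM' : M' ≠ 0) (hu : ∀ i, v (∑ e ∈ F, algebraMap ℂ K (B i e) * u e) < M') :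
    ∀ e ∈ F, v (u e) < M' := by
  obtain ⟨g, hg, -, hsurj, hsum⟩ := exists_enum K F hF
  intro e he
  obtain ⟨j, rfl⟩ := hsurj e he
  refine val_lt_of_mulVec_lt hv _ (h.minors g hg) (fun j => u (g j)) hM' (fun i => ?_) j
  have := hu i
  rw [← hsum] at this
  exact this

include h hv hc heq in
-- With at most `r` leading directions, pad them to `r` columns using zeros. The corresponding minor
-- is invertible, so cancellation would force each leading monomial to be smaller than its own
-- valuation `M`.
lemma lt_card (hne : E.Nonempty) : T.r x < E.card := by
  classical
  by_contra! hle
  obtain ⟨F, hEF, hF⟩ := Finset.exists_superset_card_eq hle (by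
    have := T.card_dir x
    rw [Nat.card_eq_fintype_card] at this
    omega)
  obtain ⟨e, he⟩ := hne
  have := h.val_lt_of_sum_lt hv F hF (fun e => if e ∈ E then X e else 0) h.ne_zero (fun i => by
    have h1 := h.sum_lt hv hc heq i
    rw [← Finset.sum_subset hEF (f := fun e => algebraMap ℂ K (B i e) * if e ∈ E then X e else 0)]
    · convert h1 using 2
      exact Finset.sum_congr rfl fun e he => by simp [he]
    · intro e _ he
      simp [he]) e (hEF he)
  rw [if_pos he, h.val_X e he] at this
  exact lt_irrefl _ this

include h hv hc heq in
-- With `r + 1` leading directions, the `r` limiting linear equations determine the ratios to one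
-- fixed term, by Cramer's rule inside `A`. The residue is nonzero because numerator and denominator
-- have the same valuation `M`.
lemma hasResidue_div {A : Subfield ℂ} (hA : ∀ i e, B i e ∈ A) (hcard : E.card = T.r x + 1)
    {e e' : D x} (he : e ∈ E) (he' : e' ∈ E) : HasResidue v A (X e / X e') := by
  classical
  by_cases hee : e = e'
  · subst hee
    have hX : X e ≠ 0 := by
      intro h0
      have := h.val_X e he
      rw [h0, map_zero] at this
      exact h.ne_zero this.symm
    rw [div_self hX]
    exact HasResidue.one
  set F := E.erase e' with hFdef
  have hF : F.card = T.r x := by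
    rw [Finset.card_erase_of_mem he', hcard]; rfl
  have heF : e ∈ F := Finset.mem_erase.2 ⟨hee, he⟩
  obtain ⟨g, hg, hgF, hsurj, hsum⟩ := exists_enum K F hF
  obtain ⟨t, htA, ht⟩ := exists_mulVec_eq_mem (Matrix.of fun i j => B i (g j)) (h.minors g hg)
    (fun i j => hA _ _) (fun i => -B i e') (fun i => A.neg_mem (hA _ _))
  obtain ⟨j, rfl⟩ := hsurj e heF
  have key := val_lt_of_mulVec_lt hv _ (h.minors g hg)
    (fun j => X (g j) - algebraMap ℂ K (t j) * X e') h.ne_zero (fun i => by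
      have h1 := h.sum_lt hv hc heq i
      rw [← Finset.sum_erase_add _ _ he'] at h1
      convert h1 using 2
      have h2 := congrArg (algebraMap ℂ K) (ht i)
      rw [map_sum, map_neg] at h2
      rw [← hsum fun e => algebraMap ℂ K (B i e) * X e]
      simp only [mul_sub, Finset.sum_sub_distrib, ← mul_assoc, Matrix.of_apply, ← map_mul,
        ← Finset.sum_mul] at h2 ⊢
      rw [h2]
      ring) j
  have hX' : X e' ≠ 0 := by
    intro h0
    have := h.val_X e' he'
    rw [h0, map_zero] at this
    exact h.ne_zero this.symm
  have hlt : v (X (g j) / X e' - algebraMap ℂ K (t j)) < 1 := by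
    have : X (g j) / X e' - algebraMap ℂ K (t j) =
      (X (g j) - algebraMap ℂ K (t j) * X e') / X e' := by field_simp
    rw [this, map_div₀, h.val_X e' he', div_lt_one₀ (zero_lt_iff.2 h.ne_zero)]
    exact key
  refine ⟨t j, htA j, ?_, hlt⟩
  intro h0
  rw [h0, map_zero, sub_zero, map_div₀, h.val_X _ he, h.val_X _ he', div_self h.ne_zero] at hlt
  exact lt_irrefl _ hlt

end LeadingTerms

end SpliceSystem

/-! ### Propagation of the minimum along branches -/

namespace SpliceSystem

variable {N L : Type*} {D : N → Type*} {T : SpliceSystem N L D}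
  {K : Type*} [Field K] [Algebra ℂ K] {Γ₀ : Type*} [LinearOrderedCommGroupWithZero Γ₀]
  {v : Valuation K Γ₀} {z : L → K} {c₀ : T.Idx → ℂ} {c : T.Idx → K}

/-- All ends in the direction `e` from `y` attain the minimum, and their coordinates are
proportional to powers given by linking numbers up to factors with algebraic residue. -/
structure BranchGood (T : SpliceSystem N L D) (v : Valuation K Γ₀) (z : L → K) (c₀ : T.Idx → ℂ)
    (x : N) (w₁ : L) (y : N) (e : D y) : Prop where
  attains : ∀ w, T.dirL y w = e → T.Attains v z x w₁ w
  ratio : ∀ w w', T.dirL y w = e → T.dirL y w' = e →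
    HasResidue v (T.coeffField c₀ (T.nodesIn y e)) (z w ^ T.linkL x w' / z w' ^ T.linkL x w)

variable {x : N} {w₁ : L}

omit [Algebra ℂ K] in
lemma IsMinEnd.ne_zero_of_attains (h : T.IsMinEnd v z x w₁) {w : L}
    (hw : T.Attains v z x w₁ w) : z w ≠ 0 := by
  rintro h0
  rw [Attains, h0, map_zero, zero_pow (T.linkL_pos _ _).ne'] at hw
  exact pow_ne_zero _ h.ne_zero hw.symm

section

variable (hv : TrivialOnC v) (h : T.IsMinEnd v z x w₁) {y : N} {e : D y}
  (hb : BranchGood T v z c₀ x w₁ y e) (hout : T.Outward x y e)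

include hv hb hout in
-- Since `linkN x y` is the weight of `α` seen from `x`, the quotient is a product of powers of the
-- ratios controlled by `BranchGood.ratio`.
lemma BranchGood.end_div_mono {w : L} (hw : T.dirL y w = e) {α : L →₀ ℕ} (hα : α ∈ T.S y e) :
    HasResidue v (T.coeffField c₀ (T.nodesIn y e))
      (z w ^ T.linkN x y / mono z α ^ T.linkL x w) := by
  have h1 : z w ^ T.linkN x y / mono z α ^ T.linkL x w =
      ∏ w' ∈ α.support, (z w ^ T.linkL x w' / z w' ^ T.linkL x w) ^ α w' := by
    rw [← T.weight_outward x y e α hα hout, mono, Finsupp.prod, Finsupp.sum,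
      ← Finset.prod_pow_eq_pow_sum, ← Finset.prod_pow, ← Finset.prod_div_distrib]
    refine Finset.prod_congr rfl fun w' _ => ?_
    rw [div_pow, ← pow_mul, ← pow_mul, ← pow_mul, mul_comm (α w'), mul_comm (α w')]
  rw [h1]
  exact HasResidue.prod hv _ _ fun w' hw' =>
    (hb.ratio w w' hw (T.dirL_of_mem y e α hα w' hw')).pow hv _

include hv h hb hout in
-- Compare both monomials with the same end `w`, then extract a root of order `linkL x w`.
lemma BranchGood.mono_div_mono {α β : L →₀ ℕ} (hα : α ∈ T.S y e) (hβ : β ∈ T.S y e) :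
    HasResidue v (T.coeffField c₀ (T.nodesIn y e)) (mono z α / mono z β) := by
  obtain ⟨w, hw⟩ := T.exists_dirL_eq y e
  refine HasResidue.of_pow mem_algClosureOf_of_pow (T.linkL_pos x w) ?_
  have hz := h.ne_zero_of_attains (hb.attains w hw)
  have h1 := (hb.end_div_mono hv hout hw hβ).div hv (hb.end_div_mono hv hout hw hα)
  convert h1 using 1
  rw [div_pow, div_div_div_cancel_left' _ _ (pow_ne_zero _ hz)]

end

/-- The node `c` and the nodes that it separates from `x`. -/
def beyond (T : SpliceSystem N L D) (x c : N) : Set N :=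
  {c' | c' = c ∨ T.Outward x c (T.dirN c c')}

variable [∀ x, Fintype (D x)] (hv : TrivialOnC v)
  (hc : ∀ j, v (c j - algebraMap ℂ K (c₀ j)) < 1) (hgen : T.IsGeneric c₀)
  (heq : ∀ x i, ∑ e, T.part c z x i e = 0)

open scoped Classical in
/-- The directions at `y` away from `x` with an end that attains the minimum. -/
noncomputable def attainingDirs (T : SpliceSystem N L D)
    (v : Valuation K Γ₀) (z : L → K) (x : N) (w₁ : L) (y : N) : Finset (D y) :=
  Finset.univ.filter fun e => T.Outward x y e ∧ ∃ w, T.dirL y w = e ∧ T.Attains v z x w₁ w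

omit [Algebra ℂ K] in
lemma mem_attainingDirs {y : N} {e : D y} : e ∈ T.attainingDirs v z x w₁ y ↔
    T.Outward x y e ∧ ∃ w, T.dirL y w = e ∧ T.Attains v z x w₁ w := by
  simp [attainingDirs]

include hv hc hgen in
-- In each attaining direction all monomials are, to leading order, constant multiples `θ` of a
-- single one, so every direction contributes one combined column. The factors `θ` are algebraic
-- over the coefficients beyond `y`, hence over those at nodes other than `y`, which is what
-- genericity at `y` requires.
lemma IsMinEnd.exists_leadingTerms (h : T.IsMinEnd v z x w₁) (hz : v (z w₁) < 1) (y : N)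
    (hb : ∀ e ∈ T.attainingDirs v z x w₁ y, BranchGood T v z c₀ x w₁ y e)
    (hne : (T.attainingDirs v z x w₁ y).Nonempty) :
    ∃ M X B, LeadingTerms T v z c y (T.attainingDirs v z x w₁ y) M X B ∧
      (∀ i e, B i e ∈ T.coeffField c₀ (T.beyond x y)) ∧
      ∀ e ∈ T.attainingDirs v z x w₁ y, ∃ α ∈ T.S y e, X e = mono z α := by
  classical
  set E := T.attainingDirs v z x w₁ y with hE
  choose α₀ hα₀ using T.nonempty y
  have hpow : ∀ e ∈ E, ∀ α ∈ T.S y e,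
      v (mono z α) ^ T.linkL x w₁ = v (z w₁) ^ T.linkN x y := fun e he α hα =>
    h.val_mono_outward_eq (mem_attainingDirs.1 he).1 hα (hb e he).attains
  obtain ⟨e₁, he₁⟩ := hne
  set M := v (mono z (α₀ e₁)) with hM
  have hMpow : M ^ T.linkL x w₁ = v (z w₁) ^ T.linkN x y := hpow e₁ he₁ _ (hα₀ e₁)
  have hq := (T.linkL_pos x w₁).ne'
  have hval : ∀ e ∈ E, ∀ α ∈ T.S y e, v (mono z α) = M := fun e he α hα =>
    (pow_left_inj₀ zero_le zero_le hq).1 ((hpow e he α hα).trans hMpow.symm)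
  have hM0 : M ≠ 0 := by
    intro h0
    rw [h0, zero_pow hq] at hMpow
    exact pow_ne_zero _ h.ne_zero hMpow.symm
  have hlt : ∀ e, e ∉ E → ∀ α ∈ T.S y e, v (mono z α) < M := by
    intro e he α hα
    refine (pow_lt_pow_iff_left₀ zero_le zero_le hq).1 ?_
    rw [hMpow]
    by_cases hout : T.Outward x y e
    · refine h.val_mono_outward_lt hout hα fun w hw hatt => he ?_
      exact mem_attainingDirs.2 ⟨hout, w, hw, hatt⟩
    · simp only [Outward, not_or, not_not] at hout
      obtain ⟨h1, rfl⟩ := hout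
      exact h.val_mono_inward_lt hz h1 hα
  have hθ : ∀ m : T.Mon y, ∃ t : ℂ, t ≠ 0 ∧
      t ∈ T.coeffField c₀ {c | c ≠ y ∧ T.Outward x y (T.dirN y c)} ∧
      (m.1 ∈ E → v (mono z m.2.1 / mono z (α₀ m.1) - algebraMap ℂ K t) < 1) := by
    rintro ⟨e, α, hα⟩
    by_cases he : e ∈ E
    · obtain ⟨t, h1, h2, h3⟩ :=
        (hb e he).mono_div_mono hv h (mem_attainingDirs.1 he).1 hα (hα₀ e)
      refine ⟨t, h2, T.coeffField_mono c₀ ?_ h1, fun _ => h3⟩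
      rintro c ⟨hcy, rfl⟩
      exact ⟨hcy, (mem_attainingDirs.1 he).1⟩
    -- Directions outside `E` receive the dummy factor 1, since genericity asks for nonzero factors
    -- in every direction.
    · exact ⟨1, one_ne_zero, Subfield.one_mem _, fun h' => absurd h' he⟩
  choose θ hθ0 hθA hθv using hθ
  refine ⟨M, fun e => mono z (α₀ e),
    fun i e => ∑ α : {α // α ∈ T.S y e}, c₀ ⟨y, (i, ⟨e, α⟩)⟩ * θ ⟨e, α⟩,
    ⟨hM0, fun e he => hval e he _ (hα₀ e), hval, hlt, ?_, ?_⟩, ?_, fun e _ => ⟨α₀ e, hα₀ e, rfl⟩⟩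
  · intro g hg
    refine hgen y θ (fun m => ⟨T.coeffField_mono c₀ ?_ (hθA m), hθ0 m⟩) g hg
    rintro c ⟨hcy, -⟩
    exact hcy
  · intro i e he
    have hX0 : mono z (α₀ e) ≠ 0 := by
      intro h0
      have := hval e he _ (hα₀ e)
      rw [h0, map_zero] at this
      exact hM0 this.symm
    have : T.part c z y i e - algebraMap ℂ K (∑ α : {α // α ∈ T.S y e},
        c₀ ⟨y, (i, ⟨e, α⟩)⟩ * θ ⟨e, α⟩) * mono z (α₀ e) =
        mono z (α₀ e) * ∑ α : {α // α ∈ T.S y e},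
          ((c ⟨y, (i, ⟨e, α⟩)⟩ - algebraMap ℂ K (c₀ ⟨y, (i, ⟨e, α⟩)⟩)) *
            (mono z α.1 / mono z (α₀ e)) + algebraMap ℂ K (c₀ ⟨y, (i, ⟨e, α⟩)⟩) *
            (mono z α.1 / mono z (α₀ e) - algebraMap ℂ K (θ ⟨e, α⟩))) := by
      rw [part, map_sum, Finset.sum_mul, ← Finset.sum_sub_distrib, Finset.mul_sum]
      refine Finset.sum_congr rfl fun α _ => ?_
      rw [map_mul]
      field_simp
      ring
    rw [this, map_mul, hval e he _ (hα₀ e)]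
    refine mul_lt_of_lt_one_right (zero_lt_iff.2 hM0) (v.map_sum_lt one_ne_zero fun α _ => ?_)
    refine v.map_add_lt ?_ ((hv.mul_le _ _).trans_lt (hθv ⟨e, α⟩ he))
    rw [map_mul, map_div₀, hval e he _ α.2, hval e he _ (hα₀ e), div_self hM0, mul_one]
    exact hc _
  · intro i e
    refine Subfield.sum_mem _ fun α _ => Subfield.mul_mem _ (T.coeff_mem c₀ _ (Or.inl rfl))
      (T.coeffField_mono c₀ ?_ (hθA _))
    rintro c ⟨-, h2⟩
    exact Or.inr h2

include hv hc hgen heq in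
-- Induction on the number of nodes in the branch. A branch that is not a single end begins with a
-- node `p`, whose attaining outward branches are good by induction. The count of leading directions
-- then forces every outward direction at `p` to attain, and the equations at `p` fix the ratios
-- between different outward branches.
lemma IsMinEnd.branchGood [Finite N] (h : T.IsMinEnd v z x w₁) (hz : v (z w₁) < 1) :
    ∀ (n : ℕ) (y : N) (e : D y), (T.nodesIn y e).ncard < n →
      e ∈ T.attainingDirs v z x w₁ y → BranchGood T v z c₀ x w₁ y e := by
  classical
  intro n
  induction n with
  | zero => intro y e hn; omega
  | succ n ih =>
  intro y e hn he
  obtain ⟨hout, w₂, hw₂, hatt₂⟩ := mem_attainingDirs.1 he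
  obtain ⟨w₀, hw₀⟩ | ⟨p, hpy, rfl, hp⟩ := T.edge y e
  · have : w₂ = w₀ := (hw₀ w₂).1 hw₂
    subst this
    refine ⟨fun w hw => (hw₀ w).1 hw ▸ hatt₂, fun w w' hw hw' => ?_⟩
    rw [(hw₀ w).1 hw, (hw₀ w').1 hw', div_self (pow_ne_zero _ (h.ne_zero_of_attains hatt₂))]
    exact HasResidue.one
  · have hpx : T.dirN p x = T.dirN p y := by
      rcases hout with rfl | hne
      · rfl
      · by_cases hxy : x = y
        · rw [hxy]
        exact T.dirN_eq p y x hpy hxy hne.symm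
    have hpx' : p ≠ x := by
      rintro rfl
      rcases hout with rfl | hne
      · exact hpy rfl
      · exact hne rfl
    have houtp : ∀ e', T.Outward x p e' ↔ e' ≠ T.dirN p y := by
      intro e'
      rw [Outward, hpx, or_iff_right hpx']
    have hmem : p ∈ T.nodesIn y (T.dirN y p) := ⟨hpy, rfl⟩
    have hIH : ∀ e' ∈ T.attainingDirs v z x w₁ p, BranchGood T v z c₀ x w₁ p e' := by
      intro e' he'
      refine ih p e' ?_ he'
      have hsub := T.nodesIn_subset hpy ((houtp e').1 (mem_attainingDirs.1 he').1)
      have := Set.ncard_lt_ncard (Set.ssubset_iff_subset_ne.2 ⟨hsub, fun heq' => by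
        rw [← heq'] at hmem
        exact hmem.1 rfl⟩) (Set.toFinite _)
      omega
    have hne : (T.attainingDirs v z x w₁ p).Nonempty :=
      ⟨T.dirL p w₂, mem_attainingDirs.2 ⟨(houtp _).2 ((hp w₂).1 hw₂), w₂, rfl, hatt₂⟩⟩
    obtain ⟨M, X, B, hlead, hBA, hX⟩ := h.exists_leadingTerms hv hc hgen hz p hIH hne
    have hcard := hlead.lt_card hv hc (heq p) hne
    have hD := T.card_dir p
    rw [Nat.card_eq_fintype_card] at hD
    have hsubE : T.attainingDirs v z x w₁ p ⊆ Finset.univ.erase (T.dirN p y) := by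
      intro e' he'
      exact Finset.mem_erase.2 ⟨(houtp e').1 (mem_attainingDirs.1 he').1, Finset.mem_univ _⟩
    have hcardE : (Finset.univ.erase (T.dirN p y)).card = T.r p + 1 := by
      rw [Finset.card_erase_of_mem (Finset.mem_univ _), Finset.card_univ, hD]; rfl
    -- There are exactly `r + 1` directions at `p` away from `y`, and more than `r` of them attain.
    have hEeq := Finset.eq_of_subset_of_card_le hsubE (by omega)
    have hmemE : ∀ w, T.dirL y w = T.dirN y p →
        T.dirL p w ∈ T.attainingDirs v z x w₁ p := by
      intro w hw
      rw [hEeq]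
      exact Finset.mem_erase.2 ⟨(hp w).1 hw, Finset.mem_univ _⟩
    have hbeyond : T.beyond x p ⊆ T.nodesIn y (T.dirN y p) := by
      rintro c' (rfl | hc')
      · exact hmem
      · rw [houtp] at hc'
        have hcy : c' ≠ y := by rintro rfl; exact hc' rfl
        by_cases hcp : c' = p
        · rw [hcp]; exact hmem
        exact ⟨hcy, T.dirN_eq y p c' hpy.symm hcp hc'⟩
    have hatt : ∀ w, T.dirL y w = T.dirN y p → T.Attains v z x w₁ w := fun w hw =>
      (hIH _ (hmemE w hw)).attains w rfl
    refine ⟨hatt, ?_⟩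
    intro w w' hw hw'
    have hE1 := hmemE w hw
    have hE2 := hmemE w' hw'
    obtain ⟨α, hα, hXα⟩ := hX _ hE1
    obtain ⟨β, hβ, hXβ⟩ := hX _ hE2
    have hsubn : ∀ e' ∈ T.attainingDirs v z x w₁ p,
        T.coeffField c₀ (T.nodesIn p e') ≤ T.coeffField c₀ (T.nodesIn y (T.dirN y p)) :=
      fun e' he' => T.coeffField_mono c₀
        (T.nodesIn_subset hpy ((houtp e').1 (mem_attainingDirs.1 he').1))
    have r1 := ((hIH _ hE1).end_div_mono hv (mem_attainingDirs.1 hE1).1 rfl hα).mono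
      (hsubn _ hE1)
    have r2 := ((hIH _ hE2).end_div_mono hv (mem_attainingDirs.1 hE2).1 rfl hβ).mono
      (hsubn _ hE2)
    have r3 := (hlead.hasResidue_div hv hc (heq p) hBA (by rw [hEeq, hcardE]) hE1 hE2).mono
      (T.coeffField_mono c₀ hbeyond)
    rw [hXα, hXβ] at r3
    -- With `N = linkN x p`, `ℓ = linkL x w` and `ℓ' = linkL x w'`, the `N`-th power of the ratio is
    -- the `ℓ'`-th power of `z_w^N / α^ℓ`, times `(α/β)^(ℓℓ')`, divided by the `ℓ`-th power of
    -- `z_w'^N / β^ℓ'`.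
    refine HasResidue.of_pow mem_algClosureOf_of_pow (T.linkN_pos x p) ?_
    have hα0 : mono z α ≠ 0 := by
      intro h0
      have := hlead.val_X _ hE1
      rw [hXα, h0, map_zero] at this
      exact hlead.ne_zero this.symm
    have hβ0 : mono z β ≠ 0 := by
      intro h0
      have := hlead.val_X _ hE2
      rw [hXβ, h0, map_zero] at this
      exact hlead.ne_zero this.symm
    have hzw' := h.ne_zero_of_attains (hatt w' hw')
    have := ((r1.pow hv (T.linkL x w')).mul hv (r3.pow hv (T.linkL x w * T.linkL x w'))).div hv
      (r2.pow hv (T.linkL x w))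
    convert this using 1
    simp only [div_pow, ← pow_mul]
    rw [mul_comm (T.linkL x w') (T.linkL x w), mul_comm (T.linkL x w') (T.linkN x p),
      mul_comm (T.linkL x w) (T.linkN x p)]
    field_simp

end SpliceSystem

/-! ### Dominant directions and the logarithmic Jacobian matrix -/

namespace SpliceSystem

variable {N L : Type*} {D : N → Type*} {T : SpliceSystem N L D} [∀ x, Fintype (D x)] [Finite N]
  {K : Type*} [Field K] [Algebra ℂ K] {Γ₀ : Type*} [LinearOrderedCommGroupWithZero Γ₀]
  {v : Valuation K Γ₀} {z : L → K} {c₀ : T.Idx → ℂ} {c : T.Idx → K}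
  (hv : TrivialOnC v)
  (hc : ∀ j, v (c j - algebraMap ℂ K (c₀ j)) < 1) (hgen : T.IsGeneric c₀)
  (heq : ∀ x i, ∑ e, T.part c z x i e = 0)

include hv hc hgen heq in
/-- At each node the monomials of all directions except at most one have a common valuation, and
all others are smaller; the nodes in the former directions have the direction of the given node as
their exceptional direction. -/
lemma exists_leadingTerms [Fintype L] (hz : ∀ w, v (z w) < 1) (hz0 : z ≠ 0) (x : N) :
    ∃ E M X B, LeadingTerms T v z c x E M X B ∧ T.r x < E.card ∧
      ∀ x', x' ≠ x → T.dirN x x' ∈ E →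
        ∃ M', (∀ e, e ≠ T.dirN x' x → ∀ α ∈ T.S x' e, v (mono z α) = M') ∧
          ∀ α ∈ T.S x' (T.dirN x' x), v (mono z α) < M' := by
  obtain ⟨w₁, h⟩ := T.exists_isMinEnd (v := v) x hz0
  have hne : (T.attainingDirs v z x w₁ x).Nonempty :=
    ⟨T.dirL x w₁, mem_attainingDirs.2 ⟨Or.inl rfl, w₁, rfl, h.attains_self⟩⟩
  have hb : ∀ e ∈ T.attainingDirs v z x w₁ x, BranchGood T v z c₀ x w₁ x e := fun e he =>
    h.branchGood hv hc hgen heq (hz w₁) _ x e (Nat.lt_succ_self _) he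
  obtain ⟨M, X, B, hlead, -, -⟩ := h.exists_leadingTerms hv hc hgen (hz w₁) x hb hne
  refine ⟨_, M, X, B, hlead, hlead.lt_card hv hc (heq x) hne, ?_⟩
  intro x' hx' hdir
  -- Every end that `x'` sees away from `x` lies in the attaining branch of `x` containing `x'`, so
  -- it attains the minimum.
  have hpow : ∀ e, e ≠ T.dirN x' x → ∀ α ∈ T.S x' e,
      v (mono z α) ^ T.linkL x w₁ = v (z w₁) ^ T.linkN x x' := by
    intro e he α hα
    refine h.val_mono_outward_eq (Or.inr he) hα fun w hw => ?_
    exact (hb _ hdir).attains w (T.dirL_eq x x' w hx'.symm (hw ▸ he))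
  have hq := (T.linkL_pos x w₁).ne'
  obtain ⟨e₁, he₁⟩ : ∃ e, e ≠ T.dirN x' x := by
    by_contra! hall
    have h1 := T.card_dir x'
    have : Subsingleton (D x') := ⟨fun a b => (hall a).trans (hall b).symm⟩
    have := Finite.card_le_one_iff_subsingleton.2 this
    omega
  obtain ⟨α₁, hα₁⟩ := T.nonempty x' e₁
  refine ⟨v (mono z α₁), fun e he α hα => ?_, fun α hα => ?_⟩
  · exact (pow_left_inj₀ zero_le zero_le hq).1
      ((hpow e he α hα).trans (hpow e₁ he₁ α₁ hα₁).symm)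
  · refine (pow_lt_pow_iff_left₀ zero_le zero_le hq).1 ?_
    rw [hpow e₁ he₁ α₁ hα₁]
    exact h.val_mono_inward_lt (hz w₁) hx' hα

omit [Finite N] [∀ x, Fintype (D x)] in
-- Because `E` has at least two elements, it contains a direction other than `e₀`; this identifies
-- the two dominant valuations `M` and `M'`.
lemma LeadingTerms.mem_iff {x : N} {E : Finset (D x)} {M : Γ₀} {X : D x → K}
    {B : Fin (T.r x) → D x → ℂ} (h : LeadingTerms T v z c x E M X B) (hE : T.r x < E.card)
    {M' : Γ₀} {e₀ : D x} (h1 : ∀ e, e ≠ e₀ → ∀ α ∈ T.S x e, v (mono z α) = M')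
    (h2 : ∀ α ∈ T.S x e₀, v (mono z α) < M') (e : D x) : e ∈ E ↔ e ≠ e₀ := by
  have h3 := T.one_le_r x
  obtain ⟨e₁, he₁, hne⟩ := Finset.exists_mem_ne (by omega : 1 < E.card) e₀
  obtain ⟨α₁, hα₁⟩ := T.nonempty x e₁
  obtain rfl : M = M' := (h.val_mono e₁ he₁ α₁ hα₁).symm.trans (h1 e₁ hne α₁ hα₁)
  obtain ⟨α, hα⟩ := T.nonempty x e
  constructor
  · rintro he rfl
    exact (h2 α hα).ne (h.val_mono e he α hα)
  · intro he
    by_contra hcon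
    exact (h.val_mono_lt e hcon α hα).ne (h1 e he α hα)

/-- The part of the weight of a monomial with respect to the node `x` that comes from the ends in
direction `e`. -/
noncomputable def partWeight (T : SpliceSystem N L D) (x : N) (e : D x) (α : L →₀ ℕ) : ℕ :=
  open scoped Classical in
  ∑ w ∈ α.support with T.dirL x w = e, α w * T.linkL x w

omit [Finite N] [∀ x, Fintype (D x)] in
lemma partWeight_eq_zero {x : N} {e : D x} {α : L →₀ ℕ}
    (h : ∀ w ∈ α.support, T.dirL x w ≠ e) : T.partWeight x e α = 0 := by
  classical
  rw [partWeight, Finset.filter_false_of_mem h, Finset.sum_empty]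

omit [Finite N] [∀ x, Fintype (D x)] in
lemma partWeight_eq_sum {x : N} {e : D x} {α : L →₀ ℕ}
    (h : ∀ w ∈ α.support, T.dirL x w = e) :
    T.partWeight x e α = α.sum fun w a => a * T.linkL x w := by
  classical
  rw [partWeight, Finset.filter_true_of_mem h, Finsupp.sum]

omit [Finite N] [∀ x, Fintype (D x)] in
-- All ends that `x'` sees away from `x` lie in one direction from `x`. The constant is therefore
-- `linkN x x'` if this direction is `e`, and 0 otherwise.
lemma exists_partWeight_eq {x x' : N} (hx : x' ≠ x) (e : D x) :
    ∃ n, ∀ e', e' ≠ T.dirN x' x → ∀ α ∈ T.S x' e', T.partWeight x e α = n := by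
  by_cases he : T.dirN x x' = e
  · refine ⟨T.linkN x x', fun e' he' α hα => ?_⟩
    rw [partWeight_eq_sum, T.weight_outward x x' e' α hα (Or.inr he')]
    intro w hw
    rw [← he]
    exact T.dirL_eq x x' w hx.symm (by rwa [T.dirL_of_mem x' e' α hα w hw])
  · refine ⟨0, fun e' he' α hα => partWeight_eq_zero fun w hw h => he ?_⟩
    rw [← h]
    exact (T.dirL_eq x x' w hx.symm (by rwa [T.dirL_of_mem x' e' α hα w hw])).symm

/-- The row of the `j`-th equation of the logarithmic Jacobian matrix, paired with the linking
numbers of the node `x` with the ends in the direction `e`. -/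
noncomputable def pairing (T : SpliceSystem N L D) (c : T.Idx → K) (z : L → K) (x : N) (e : D x)
    (x' : N) (i : Fin (T.r x')) : K :=
  ∑ m : T.Mon x', c ⟨x', (i, m)⟩ * (T.partWeight x e m.2.1 : K) * mono z m.2.1

section

variable {x x' : N} {E : Finset (D x')} {M : Γ₀} {X : D x' → K}
  {B : Fin (T.r x') → D x' → ℂ} (h : LeadingTerms T v z c x' E M X B)

omit [∀ x, Fintype (D x)] [Finite N] [Algebra ℂ K] in
lemma sum_mon_eq [∀ x, Fintype (D x)] {x : N} (f : T.Mon x → K) :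
    ∑ m : T.Mon x, f m = ∑ e, ∑ α : {α // α ∈ T.S x e}, f ⟨e, α⟩ :=
  Fintype.sum_sigma f

omit [Finite N] [∀ x, Fintype (D x)] in
include h in
lemma LeadingTerms.val_mono_le (e : D x') {α : L →₀ ℕ} (hα : α ∈ T.S x' e) :
    v (mono z α) ≤ M := by
  by_cases he : e ∈ E
  · exact (h.val_mono e he α hα).le
  · exact (h.val_mono_lt e he α hα).le

omit [Finite N] in
include h hv hc in
lemma LeadingTerms.val_pairing_le (e : D x) (i : Fin (T.r x')) :
    v (T.pairing c z x e x' i) ≤ M := by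
  refine v.map_sum_le fun m _ => ?_
  rw [map_mul, map_mul]
  exact mul_le_of_le_one_of_le
    (mul_le_one' (val_coeff_le hv hc _) (hv.natCast_le _)) (h.val_mono_le m.1 m.2.2)

omit [Finite N] in
include h hv hc heq in
-- On the leading monomials the partial weight is a constant `n`. Subtracting `n` times the
-- equation, which vanishes, leaves only the smaller monomials pointing back to `x`.
lemma LeadingTerms.val_pairing_lt (hx : x' ≠ x) (hE : ∀ e, e ∈ E ↔ e ≠ T.dirN x' x) (e : D x)
    (i : Fin (T.r x')) : v (T.pairing c z x e x' i) < M := by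
  obtain ⟨n, hn⟩ := T.exists_partWeight_eq hx e
  have h0 : ∑ m : T.Mon x', c ⟨x', (i, m)⟩ * mono z m.2.1 = 0 := by
    rw [sum_mon_eq]; exact heq x' i
  have h1 : T.pairing c z x e x' i = ∑ m : T.Mon x',
      c ⟨x', (i, m)⟩ * ((T.partWeight x e m.2.1 : K) - (n : K)) * mono z m.2.1 := by
    rw [pairing, ← sub_zero (∑ m : T.Mon x', _), ← mul_zero (n : K), ← h0, Finset.mul_sum,
      ← Finset.sum_sub_distrib]
    exact Finset.sum_congr rfl fun m _ => by ring
  rw [h1]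
  refine v.map_sum_lt h.ne_zero fun m _ => ?_
  by_cases hm : m.1 = T.dirN x' x
  · rw [map_mul, map_mul]
    have hlt := h.val_mono_lt m.1 (by rw [hE]; simpa using hm) _ m.2.2
    refine (mul_le_of_le_one_left' (mul_le_one' (val_coeff_le hv hc _) ?_)).trans_lt hlt
    exact v.map_sub_le (hv.natCast_le _) (hv.natCast_le _)
  · rw [hn m.1 hm _ m.2.2, sub_self, mul_zero, zero_mul, map_zero]
    exact zero_lt_iff.2 h.ne_zero

end

omit [Finite N] [Algebra ℂ K] in
-- Euler's identity for the part with direction `e`: its monomials carry their full weight in that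
-- direction, those of other directions none.
lemma pairing_self (x : N) (e : D x) (i : Fin (T.r x)) :
    T.pairing c z x e x i = (T.linkN x x : K) * T.part c z x i e := by
  classical
  rw [pairing, sum_mon_eq, Finset.sum_eq_single e, part, Finset.mul_sum]
  · refine Finset.sum_congr rfl fun α _ => ?_
    dsimp only
    rw [partWeight_eq_sum (T.dirL_of_mem x e _ α.2), T.weight_outward x x e _ α.2 (Or.inl rfl)]
    ring
  · intro e' _ he'
    refine Finset.sum_eq_zero fun α _ => ?_
    dsimp only
    rw [partWeight_eq_zero fun w hw h => he' ((T.dirL_of_mem x e' _ α.2 w hw).symm.trans h)]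
    simp
  · intro h; exact absurd (Finset.mem_univ e) h

end SpliceSystem

namespace SpliceSystem

variable {N L : Type*} {D : N → Type*} {T : SpliceSystem N L D} [∀ x, Fintype (D x)] [Fintype N]
  [Fintype L]
  {K : Type*} [Field K] [Algebra ℂ K] {Γ₀ : Type*} [LinearOrderedCommGroupWithZero Γ₀]
  {v : Valuation K Γ₀} {z : L → K} {c₀ : T.Idx → ℂ} {c : T.Idx → K}

omit [Algebra ℂ K] in
-- Combine the relations for the ends `w` in direction `e`, with the linking numbers `linkL x w` as
-- coefficients.
lemma sum_pairing_eq_zero (y : (Σ x, Fin (T.r x)) → K)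
    (hy : ∀ w, ∑ j, y j *
      ∑ m : T.Mon j.1, c ⟨j.1, (j.2, m)⟩ * (m.2.1 w : K) * mono z m.2.1 = 0)
    (x : N) (e : D x) : ∑ j, y j * T.pairing c z x e j.1 j.2 = 0 := by
  classical
  have h1 : ∑ w with T.dirL x w = e, (T.linkL x w : K) * (∑ j, y j *
      ∑ m : T.Mon j.1, c ⟨j.1, (j.2, m)⟩ * (m.2.1 w : K) * mono z m.2.1) = 0 :=
    Finset.sum_eq_zero fun w _ => by rw [hy w, mul_zero]
  rw [← h1]
  simp only [Finset.mul_sum, pairing]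
  rw [Finset.sum_comm]
  refine Finset.sum_congr rfl fun j _ => ?_
  rw [Finset.sum_comm]
  refine Finset.sum_congr rfl fun m _ => ?_
  have h2 : (T.partWeight x e m.2.1 : K) =
      ∑ w with T.dirL x w = e, (m.2.1 w : K) * (T.linkL x w : K) := by
    have h3 : T.partWeight x e m.2.1 = ∑ w with T.dirL x w = e, m.2.1 w * T.linkL x w := by
      rw [partWeight]
      refine Finset.sum_subset_zero_on_sdiff (fun w hw => ?_) (fun w hw => ?_) fun w _ => rfl
      · simp only [Finset.mem_filter, Finset.mem_univ, true_and] at hw ⊢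
        exact hw.2
      · simp only [Finset.mem_sdiff, Finset.mem_filter, Finset.mem_univ, true_and, not_and,
          Finsupp.mem_support_iff] at hw
        by_cases h0 : m.2.1 w = 0
        · rw [h0, zero_mul]
        · exact absurd hw.1 (hw.2 h0)
    rw [h3]
    push_cast
    rfl
  rw [h2, Finset.mul_sum, Finset.sum_mul, Finset.mul_sum]
  exact Finset.sum_congr rfl fun w _ => by ring

/-- The rows of the logarithmic Jacobian matrix are linearly independent at solutions that
specialize to the origin, for coefficients that specialize to generic ones. -/
theorem eq_zero_of_logJacobian (hv : TrivialOnC v)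
    (hc : ∀ j, v (c j - algebraMap ℂ K (c₀ j)) < 1) (hgen : T.IsGeneric c₀)
    (heq : ∀ x i, ∑ e, T.part c z x i e = 0) (hz : ∀ w, v (z w) < 1) (hz0 : z ≠ 0)
    (y : (Σ x, Fin (T.r x)) → K)
    (hy : ∀ w, ∑ j, y j *
      ∑ m : T.Mon j.1, c ⟨j.1, (j.2, m)⟩ * (m.2.1 w : K) * mono z m.2.1 = 0) : y = 0 := by
  classical
  choose E M X B hlead hcard hother using
    exists_leadingTerms (T := T) hv hc hgen heq hz hz0
  have hdir : ∀ x x', x' ≠ x → T.dirN x x' ∈ E x → ∀ e, e ∈ E x' ↔ e ≠ T.dirN x' x := by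
    intro x x' hx h
    obtain ⟨M', h1, h2⟩ := hother x x' hx h
    exact (hlead x').mem_iff (hcard x') h1 h2
  by_contra hy0
  obtain ⟨j₁, hj₁⟩ : ∃ j, y j ≠ 0 := by
    by_contra! h
    exact hy0 (funext h)
  obtain ⟨j₀, -, hj₀⟩ := Finset.exists_max_image Finset.univ (fun j => v (y j) * M j.1)
    ⟨j₁, Finset.mem_univ _⟩
  set R := v (y j₀) * M j₀.1 with hR
  have hle : ∀ j, v (y j) * M j.1 ≤ R := fun j => hj₀ j (Finset.mem_univ _)
  have hR0 : R ≠ 0 := by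
    have h1 : 0 < v (y j₁) * M j₁.1 :=
      mul_pos (zero_lt_iff.2 (by simpa using hj₁)) (zero_lt_iff.2 (hlead _).ne_zero)
    exact (h1.trans_le (hle j₁)).ne'
  -- Among the nodes that attain `R`, one with the fewest nodes in non-leading directions is chosen.
  -- This forces every other such node to have as its only non-leading direction the one towards
  -- `x`.
  let Q : N → ℕ := fun x => {x' | x' ≠ x ∧ T.dirN x x' ∉ E x}.ncard
  obtain ⟨x, hxR, hxmin⟩ := Finset.exists_min_image
    (Finset.univ.filter fun x => ∃ i, v (y ⟨x, i⟩) * M x = R) Q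
    ⟨j₀.1, by simpa using ⟨j₀.2, rfl⟩⟩
  simp only [Finset.mem_filter, Finset.mem_univ, true_and] at hxR hxmin
  obtain ⟨i₀, hi₀⟩ := hxR
  have hexc : ∀ x', x' ≠ x → (∃ i, v (y ⟨x', i⟩) * M x' = R) →
      ∀ e, e ∈ E x' ↔ e ≠ T.dirN x' x := by
    intro x' hx' hmax
    by_cases hmem : T.dirN x x' ∈ E x
    · exact hdir x x' hx' hmem
    -- If `x'` and `x` are joined by a direction that is leading at `x'` but not at `x`, the nodes
    -- in non-leading directions of `x'` form a proper subset of those of `x`, against the choice of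
    -- `x`.
    · have hnot : T.dirN x' x ∉ E x' := by
        intro h'
        refine (hxmin x' hmax).not_gt (Set.ncard_lt_ncard ?_ (Set.toFinite _))
        rw [Set.ssubset_iff_of_subset]
        · exact ⟨x', ⟨hx', hmem⟩, fun h => h.1 rfl⟩
        · rintro x'' ⟨h1, h2⟩
          have h3 : T.dirN x' x'' ≠ T.dirN x' x := fun h => h2 (h ▸ h')
          refine ⟨?_, ?_⟩
          · rintro rfl
            exact h3 rfl
          · rw [T.dirN_eq x x' x'' hx'.symm h1 h3]
            exact hmem
      have h1 := T.card_dir x'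
      rw [Nat.card_eq_fintype_card] at h1
      have h2 : E x' ⊆ Finset.univ.erase (T.dirN x' x) := fun e he =>
        Finset.mem_erase.2 ⟨fun h => hnot (h ▸ he), Finset.mem_univ _⟩
      have h3 : (Finset.univ.erase (T.dirN x' x)).card = T.r x' + 1 := by
        rw [Finset.card_erase_of_mem (Finset.mem_univ _), Finset.card_univ, h1]; rfl
      have h4 := hcard x'
      have h5 := Finset.eq_of_subset_of_card_le h2 (by omega)
      intro e
      rw [h5]
      simp
  -- In the relation paired with direction `e`, rows of other nodes fall below `R`: either their
  -- coefficient is not maximal, or their pairing is smaller than `M`.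
  have key : ∀ e ∈ E x, v (∑ i, y ⟨x, i⟩ * T.part c z x i e) < R := by
    intro e he
    have h1 := sum_pairing_eq_zero y hy x e
    rw [Fintype.sum_sigma, ← Finset.add_sum_erase _ _ (Finset.mem_univ x)] at h1
    have h2 : (T.linkN x x : K) * ∑ i, y ⟨x, i⟩ * T.part c z x i e =
        -∑ x' ∈ Finset.univ.erase x, ∑ i, y ⟨x', i⟩ * T.pairing c z x e x' i := by
      rw [← add_eq_zero_iff_eq_neg, ← h1]
      congr 1
      rw [Finset.mul_sum]
      refine Finset.sum_congr rfl fun i _ => ?_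
      rw [pairing_self]
      ring
    have h3 := congrArg v h2
    rw [map_mul, hv.natCast (T.linkN_pos x x).ne', one_mul, Valuation.map_neg] at h3
    rw [h3]
    refine v.map_sum_lt hR0 fun x' hx' => v.map_sum_lt hR0 fun i _ => ?_
    have hne := (Finset.mem_erase.1 hx').1
    rw [map_mul]
    rcases (hle ⟨x', i⟩).lt_or_eq with hlt | heq'
    · exact (mul_le_mul_right ((hlead x').val_pairing_le hv hc e i) _).trans_lt hlt
    · rw [← heq']
      have h0 : v (y ⟨x', i⟩) ≠ 0 := by
        intro h0
        rw [h0, zero_mul] at heq'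
        exact hR0 heq'.symm
      exact mul_lt_mul_of_pos_left
        ((hlead x').val_pairing_lt hv hc heq hne (hexc x' hne ⟨i, heq'⟩) e i) (zero_lt_iff.2 h0)
  have hM0 := (hlead x).ne_zero
  have key2 : ∀ e ∈ E x, v (∑ i, algebraMap ℂ K (B x i e) * y ⟨x, i⟩) < R / M x := by
    intro e he
    have h1 : (∑ i, algebraMap ℂ K (B x i e) * y ⟨x, i⟩) * X x e =
        ∑ i, y ⟨x, i⟩ * T.part c z x i e -
          ∑ i, y ⟨x, i⟩ * (T.part c z x i e - algebraMap ℂ K (B x i e) * X x e) := by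
      rw [← Finset.sum_sub_distrib, Finset.sum_mul]
      exact Finset.sum_congr rfl fun i _ => by ring
    have h2 := congrArg v h1
    rw [map_mul, (hlead x).val_X e he] at h2
    rw [lt_div_iff₀ (zero_lt_iff.2 hM0), h2]
    refine v.map_sub_lt (key e he) (v.map_sum_lt hR0 fun i _ => ?_)
    rw [map_mul]
    by_cases h0 : v (y ⟨x, i⟩) = 0
    · rw [h0, zero_mul]
      exact zero_lt_iff.2 hR0
    · exact (mul_lt_mul_of_pos_left ((hlead x).sub_lt i e he) (zero_lt_iff.2 h0)).trans_le
        (hle ⟨x, i⟩)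
  -- Any `r` leading directions give an invertible minor; its transpose bounds all coefficients at
  -- `x` strictly below `R / M x`, contrary to the choice of `i₀`.
  obtain ⟨F, hFE, hF⟩ := Finset.exists_subset_card_eq (hcard x).le
  obtain ⟨g, hg, hgF, -, -⟩ := LeadingTerms.exists_enum K F hF
  have hfin := val_lt_of_mulVec_lt hv (Matrix.of fun i j => B x i (g j)).transpose
    (by rw [Matrix.det_transpose]; exact (hlead x).minors g hg) (fun i => y ⟨x, i⟩)
    (div_ne_zero hR0 hM0) (fun j => key2 (g j) (hFE (hgF j))) i₀
  rw [lt_div_iff₀ (zero_lt_iff.2 hM0), hi₀] at hfin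
  exact lt_irrefl _ hfin

end SpliceSystem

/-! ### Dimension -/

section Dimension

open MvPolynomial

variable {σ ι : Type*}

/-- A prime ideal of a polynomial ring has height at least the number of its elements whose
differentials are linearly independent modulo the ideal. -/
lemma card_le_height [Finite σ] [Fintype ι] (P : Ideal (MvPolynomial σ ℂ)) [hP : P.IsPrime]
    (f : ι → MvPolynomial σ ℂ) (hf : ∀ i, f i ∈ P)
    (hind : ∀ g : ι → MvPolynomial σ ℂ, (∀ w, ∑ i, g i * pderiv w (f i) ∈ P) → ∀ i, g i ∈ P) :
    (Fintype.card ι : ℕ∞) ≤ P.height := by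
  classical
  set A := Localization.AtPrime P
  -- The local ring at `P` is regular, so its maximal ideal has as many generators as the height of
  -- `P`. Modulo `P` the differentials of the `f i` lie in the span of the differentials of these
  -- generators, with denominators cleared.
  have hreg : IsRegularLocalRing A := IsRegularRing.isRegularLocalRing_localization P
  have hfg := (IsLocalRing.maximalIdeal A).fg_of_isNoetherianRing
  have hfin := Submodule.FG.finite_generators hfg
  set t := hfin.toFinset with ht
  have hspan : Ideal.span (t : Set A) = IsLocalRing.maximalIdeal A := by
    rw [ht, Set.Finite.coe_toFinset]
    exact Submodule.span_generators _
  have hcard : (t.card : ℕ∞) = P.height := by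
    have h1 := hreg.spanFinrank_maximalIdeal
    rw [← Submodule.FG.generators_ncard hfg, Set.ncard_eq_toFinset_card _ hfin,
      IsLocalization.AtPrime.ringKrullDim_eq_height P A] at h1
    exact_mod_cast h1
  have hgen : ∀ a : t, ∃ g ∈ P, ∃ s : P.primeCompl,
      a.1 * algebraMap _ A (s : MvPolynomial σ ℂ) = algebraMap _ A g := by
    rintro ⟨a, ha⟩
    have ha' : a ∈ IsLocalRing.maximalIdeal A := hspan ▸ Ideal.subset_span ha
    rw [← Localization.AtPrime.map_eq_maximalIdeal,
      IsLocalization.mem_map_algebraMap_iff P.primeCompl] at ha'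
    obtain ⟨⟨g, s⟩, h⟩ := ha'
    exact ⟨g, g.2, s, h⟩
  choose g hgP s hgs using hgen
  have hfs : ∀ i, ∃ s' : P.primeCompl, ∃ b : t → MvPolynomial σ ℂ,
      ∑ a, b a * g a = (s' : MvPolynomial σ ℂ) * f i := by
    intro i
    have h1 : algebraMap _ A (f i) ∈ (Ideal.span (Set.range g)).map (algebraMap _ A) := by
      have h2 : IsLocalRing.maximalIdeal A ≤ (Ideal.span (Set.range g)).map (algebraMap _ A) := by
        rw [← hspan, Ideal.span_le]
        intro a ha
        have hu := IsLocalization.map_units A (s ⟨a, ha⟩)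
        refine (Ideal.mul_unit_mem_iff_mem _ hu).1 ?_
        rw [hgs ⟨a, ha⟩]
        exact Ideal.mem_map_of_mem _ (Ideal.subset_span ⟨_, rfl⟩)
      refine h2 ?_
      rw [← Localization.AtPrime.map_eq_maximalIdeal]
      exact Ideal.mem_map_of_mem _ (hf i)
    rw [IsLocalization.mem_map_algebraMap_iff P.primeCompl] at h1
    obtain ⟨⟨y, s'⟩, h⟩ := h1
    rw [← map_mul, IsLocalization.eq_iff_exists P.primeCompl A] at h
    obtain ⟨u, hu⟩ := h
    obtain ⟨b, hb⟩ := Ideal.mem_span_range_iff_exists_fun.1 y.2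
    refine ⟨u * s', fun a => u * b a, ?_⟩
    dsimp only at hu
    rw [Submonoid.coe_mul, mul_assoc, mul_comm (s' : MvPolynomial σ ℂ), hu, ← hb, Finset.mul_sum]
    exact Finset.sum_congr rfl fun a _ => by ring
  choose s' b hb using hfs
  let κ := FractionRing (MvPolynomial σ ℂ ⧸ P)
  let q : MvPolynomial σ ℂ →+* κ := (algebraMap _ κ).comp (Ideal.Quotient.mk P)
  have hq : ∀ p, q p = 0 ↔ p ∈ P := fun p => by
    rw [RingHom.comp_apply, map_eq_zero_iff _ (IsFractionRing.injective _ κ),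
      Ideal.Quotient.eq_zero_iff_mem]
  let ρ : t → σ → κ := fun a w => q (pderiv w (g a))
  let r : ι → σ → κ := fun i w => q (pderiv w (f i))
  have hr : LinearIndependent κ r := by
    rw [← LinearIndependent.iff_fractionRing (MvPolynomial σ ℂ ⧸ P) κ,
      Fintype.linearIndependent_iff]
    intro y hy
    choose y' hy' using fun i => Ideal.Quotient.mk_surjective (y i)
    have h1 : ∀ i, y' i ∈ P := hind y' fun w => by
      have h0 := congrFun hy w
      rw [Pi.zero_apply, Finset.sum_apply] at h0
      rw [← hq, map_sum, ← h0]
      refine Finset.sum_congr rfl fun i _ => ?_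
      rw [Pi.smul_apply, ← hy']
      exact (map_mul q _ _).trans (Algebra.smul_def (Ideal.Quotient.mk P (y' i)) (r i w)).symm
    intro i
    rw [← hy', Ideal.Quotient.eq_zero_iff_mem]
    exact h1 i
  have hmem : Set.range r ⊆ Submodule.span κ (Set.range ρ) := by
    rintro _ ⟨i, rfl⟩
    have hs0 : q (s' i) ≠ 0 := fun h => (s' i).2 ((hq _).1 h)
    have h1 : q (s' i) • r i = ∑ a, q (b i a) • ρ a := by
      ext w
      -- In the product rule, terms with an undifferentiated factor in `P` vanish in `κ`.
      have h2 := congrArg (fun p => q (pderiv w p)) (hb i)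
      simp only [map_sum, Derivation.leibniz, smul_eq_mul, map_add, map_mul] at h2
      simp only [(hq _).2 (hf i), (hq _).2 (hgP _), zero_mul, add_zero] at h2
      simp only [Pi.smul_apply, Finset.sum_apply, smul_eq_mul]
      exact h2.symm
    have h3 : r i = (q (s' i))⁻¹ • ∑ a, q (b i a) • ρ a := by
      rw [← h1, smul_smul, inv_mul_cancel₀ hs0, one_smul]
    rw [h3]
    exact Submodule.smul_mem _ _ (Submodule.sum_mem _ fun a _ =>
      Submodule.smul_mem _ _ (Submodule.subset_span ⟨a, rfl⟩))
  have h1 := linearIndependent_le_span' r hr (Set.range ρ) hmem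
  rw [Cardinal.mk_fintype, Nat.cast_le] at h1
  have h2 : Fintype.card (Set.range ρ) ≤ t.card := by
    rw [← Fintype.card_coe t]
    exact Fintype.card_range_le ρ
  rw [← hcard]
  exact_mod_cast h1.trans h2

lemma X_mem_ker_eval_zero (w : σ) :
    (X w : MvPolynomial σ ℂ) ∈ RingHom.ker (eval (0 : σ → ℂ)) := by
  simp [RingHom.mem_ker]

lemma ker_eval_zero_le {P : Ideal (MvPolynomial σ ℂ)} (hP : ∀ w, (X w : MvPolynomial σ ℂ) ∈ P) :
    RingHom.ker (eval (0 : σ → ℂ)) ≤ P := by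
  intro p hp
  rw [RingHom.mem_ker] at hp
  have h1 : p - C (eval 0 p) ∈ Ideal.span (Set.range (X : σ → MvPolynomial σ ℂ)) := by
    clear hp
    induction p using MvPolynomial.induction_on with
    | C a => simp
    | add p q hp hq =>
      have := Ideal.add_mem _ hp hq
      convert this using 1
      rw [map_add, C_add]; ring
    | mul_X p i _ =>
      have : p * X i - C (eval 0 (p * X i)) = p * X i := by simp
      rw [this]
      exact Ideal.mul_mem_left _ _ (Ideal.subset_span ⟨i, rfl⟩)
  rw [hp, C_0, sub_zero] at h1
  refine Ideal.span_le.2 ?_ h1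
  rintro _ ⟨w, rfl⟩
  exact hP w

lemma height_ker_eval_zero [Fintype σ] :
    (RingHom.ker (eval (0 : σ → ℂ))).height = Fintype.card σ := by
  classical
  apply le_antisymm
  · have h1 := Ideal.height_le_ringKrullDim_of_isPrime (I := RingHom.ker (eval (0 : σ → ℂ)))
    rw [MvPolynomial.ringKrullDim_of_isNoetherianRing, ringKrullDim_eq_zero_of_field, zero_add,
      Nat.card_eq_fintype_card] at h1
    exact_mod_cast h1
  · refine card_le_height _ (fun w => X w) X_mem_ker_eval_zero fun g hg i => ?_
    have := hg i
    simpa [pderiv_X, Pi.single_apply] using this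

/-- If the differentials of the equations `f i = 0` are linearly independent at all solutions
except the origin outside a hypersurface not through the origin, then the equations define
a complete intersection at the origin. -/
lemma ringKrullDim_quotient_eq_two [Fintype σ] [Fintype ι] (f : ι → MvPolynomial σ ℂ)
    (hf0 : ∀ i, eval 0 (f i) = 0) (hcard : Fintype.card ι + 2 = Fintype.card σ)
    (q : MvPolynomial σ ℂ) (hq0 : eval 0 q ≠ 0)
    (hq : ∀ z : σ → ℂ, z ≠ 0 → eval z q ≠ 0 → (∀ i, eval z (f i) = 0) →
      LinearIndependent ℂ fun (i : ι) (w : σ) => eval z (pderiv w (f i))) :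
    ringKrullDim (LocalRingAtZero σ ⧸ (Ideal.span (Set.range f)).map
      (algebraMap (MvPolynomial σ ℂ) (LocalRingAtZero σ))) = 2 := by
  classical
  set m := RingHom.ker (eval (0 : σ → ℂ)) with hm
  set A := LocalRingAtZero σ
  set J := (Ideal.span (Set.range f)).map (algebraMap (MvPolynomial σ ℂ) A) with hJ
  have hJspan : J = Ideal.span (Set.range fun i => algebraMap (MvPolynomial σ ℂ) A (f i)) := by
    rw [hJ, Ideal.map_span, ← Set.range_comp]; rfl
  have hfm : ∀ i, f i ∈ m := fun i => by rw [hm, RingHom.mem_ker]; exact hf0 i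
  have hdimA : ringKrullDim A = Fintype.card σ := by
    rw [IsLocalization.AtPrime.ringKrullDim_eq_height m A, height_ker_eval_zero]
    rfl
  apply le_antisymm
  -- Upper bound: pull a chain of primes back to the polynomial ring. Its first member has height at
  -- least the number of equations unless it is already `m`, each step raises the height, and `m`
  -- has height `Fintype.card σ`.
  · refine iSup_le fun p => ?_
    let π : PrimeSpectrum (A ⧸ J) → Ideal (MvPolynomial σ ℂ) := fun x =>
      (x.asIdeal.comap (Ideal.Quotient.mk J)).comap (algebraMap _ A)
    have hπprime : ∀ x, (π x).IsPrime := fun x => inferInstance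
    have hπmono : ∀ x y, x < y → π x < π y := by
      intro x y hxy
      refine lt_of_le_of_ne (Ideal.comap_mono (Ideal.comap_mono hxy.le)) fun h => hxy.ne ?_
      have h1 : x.asIdeal.comap (Ideal.Quotient.mk J) = y.asIdeal.comap (Ideal.Quotient.mk J) := by
        have := congrArg (Ideal.map (algebraMap (MvPolynomial σ ℂ) A)) h
        have h2 : ∀ I : Ideal A, (I.comap (algebraMap (MvPolynomial σ ℂ) A)).map
            (algebraMap (MvPolynomial σ ℂ) A) = I :=
          fun I => IsLocalization.map_under m.primeCompl A I
        simp only [π] at this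
        rwa [h2, h2] at this
      ext1
      exact Ideal.comap_injective_of_surjective _ Ideal.Quotient.mk_surjective h1
    have hπm : ∀ x, π x ≤ m := by
      intro x a ha
      by_contra hcon
      have hu : IsUnit (algebraMap (MvPolynomial σ ℂ) A a) :=
        IsLocalization.map_units A (⟨a, hcon⟩ : m.primeCompl)
      exact x.isPrime.ne_top (Ideal.eq_top_of_isUnit_mem _ ha (hu.map (Ideal.Quotient.mk J)))
    have hπf : ∀ x i, f i ∈ π x := by
      intro x i
      have : Ideal.Quotient.mk J (algebraMap _ A (f i)) = 0 :=
        Ideal.Quotient.eq_zero_iff_mem.2 (Ideal.mem_map_of_mem _ (Ideal.subset_span ⟨i, rfl⟩))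
      simp [π, this]
    have hheight : ∀ x, π x ≠ m → (Fintype.card ι : ℕ∞) ≤ (π x).height := by
      intro x hx
      refine card_le_height (π x) f (hπf x) fun g hg i => ?_
      by_contra hgi
      apply hx
      refine le_antisymm (hπm x) (ker_eval_zero_le fun w => ?_)
      -- At every zero of the prime the product vanishes, since a nonzero value of `q` at a point
      -- other than the origin makes the differentials independent. By the Nullstellensatz it lies
      -- in the prime; as neither `q` nor `g i` does, every coordinate does.
      have hmem : q * g i * X w ∈ π x := by
        rw [← MvPolynomial.IsPrime.vanishingIdeal_zeroLocus (K := ℂ) (π x),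
          mem_vanishingIdeal_iff]
        intro z hz
        rw [mem_zeroLocus_iff] at hz
        have hz' : ∀ p ∈ π x, eval z p = 0 := fun p hp => by simpa using hz p hp
        rw [aeval_eq_eval]
        simp only [map_mul, eval_X]
        by_contra hne
        have h1 : eval z q ≠ 0 := fun h => hne (by rw [h]; ring)
        have h2 : eval z (g i) ≠ 0 := fun h => hne (by rw [h]; ring)
        have h3 : z ≠ 0 := fun h => hne (by rw [h]; simp)
        have h4 := hq z h3 h1 fun i => hz' _ (hπf x i)
        rw [Fintype.linearIndependent_iff] at h4
        refine h2 (h4 (fun i => eval z (g i)) ?_ i)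
        ext w'
        have := hz' _ (hg w')
        simpa [map_sum] using this
      rcases (hπprime x).mem_or_mem hmem with h | h
      · rcases (hπprime x).mem_or_mem h with h | h
        · exact absurd (hπm x h) hq0
        · exact absurd h hgi
      · exact h
    by_cases hl : p.length = 0
    · rw [hl]; exact_mod_cast zero_le_two
    have h0 : π (p 0) ≠ m := by
      intro h
      have hlt := hπmono _ _ (p.strictMono (show (0 : Fin (p.length + 1)) < Fin.last _ from
        Fin.pos_iff_ne_zero.2 fun h => hl (by simpa using congrArg Fin.val h)))
      rw [h] at hlt
      exact absurd (hπm _) hlt.not_ge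
    have hind : ∀ (k : ℕ) (hk : k < p.length + 1),
        ((Fintype.card ι + k : ℕ) : ℕ∞) ≤ (π (p ⟨k, hk⟩)).height := by
      intro k
      induction k with
      | zero => intro hk; exact hheight _ h0
      | succ k ih =>
        intro hk
        have h1 := ih (by omega)
        have h2 := Ideal.height_add_one_le_of_lt_of_isPrime
          (hπmono _ _ (p.strictMono (show (⟨k, by omega⟩ : Fin (p.length + 1)) < ⟨k + 1, hk⟩ by
            simp [Fin.lt_def])))
        refine le_trans ?_ h2
        push_cast at h1 ⊢
        rw [← add_assoc]
        gcongr
    have h1 := (hind p.length (by omega)).trans (Ideal.height_mono (hπm _))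
    rw [hm, height_ker_eval_zero] at h1
    have h2 : Fintype.card ι + p.length ≤ Fintype.card σ := by exact_mod_cast h1
    have h3 : p.length ≤ 2 := by omega
    exact_mod_cast h3
  -- Lower bound: each equation lowers the dimension of the local ring by at most one.
  · have h1 := ringKrullDim_le_ringKrullDim_quotient_add_encard (R := A)
      (Set.range fun i => algebraMap (MvPolynomial σ ℂ) A (f i)) (by
        rintro _ ⟨i, rfl⟩
        rw [IsLocalRing.ringJacobson_eq_maximalIdeal, ← Localization.AtPrime.map_eq_maximalIdeal]
        exact Ideal.mem_map_of_mem _ (hfm i))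
    rw [← hJspan, hdimA, ← hcard] at h1
    have h2 : (Set.range fun i => algebraMap (MvPolynomial σ ℂ) A (f i)).encard ≤
        Fintype.card ι := by
      rw [← Set.image_univ]
      refine (Set.encard_image_le _ _).trans ?_
      rw [Set.encard_univ, ENat.card_eq_coe_fintype_card]
    have h3 : ((Fintype.card ι + 2 : ℕ) : WithBot ℕ∞) ≤
        ringKrullDim (A ⧸ J) + (Fintype.card ι : ℕ∞) :=
      h1.trans (by gcongr; exact_mod_cast h2)
    by_cases hbot : ringKrullDim (A ⧸ J) = ⊥
    · rw [hbot] at h3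
      simp at h3
    obtain ⟨d, hd⟩ := WithBot.ne_bot_iff_exists.1 hbot
    rw [← hd] at h3 ⊢
    have h4 : ((Fintype.card ι + 2 : ℕ) : ℕ∞) ≤ d + (Fintype.card ι : ℕ∞) := WithBot.coe_le_coe.1 h3
    have h5 : (2 : ℕ∞) ≤ d := by
      push_cast at h4
      rw [add_comm] at h4
      exact (ENat.add_le_add_iff_right (ENat.natCast_ne_top _)).1 h4
    exact WithBot.coe_le_coe.2 h5

/-- A criterion for isolated complete intersection surface singularities. -/
lemma isIsolatedCISurfaceSingularity_of_linearIndependent [Fintype σ] [Fintype ι]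
    (f : ι → MvPolynomial σ ℂ)
    (hf0 : ∀ i, eval 0 (f i) = 0) (hcard : Fintype.card ι + 2 = Fintype.card σ)
    (q : MvPolynomial σ ℂ) (hq0 : eval 0 q ≠ 0)
    (hq : ∀ z : σ → ℂ, z ≠ 0 → eval z q ≠ 0 → (∀ i, eval z (f i) = 0) →
      LinearIndependent ℂ fun (i : ι) (w : σ) => eval z (pderiv w (f i))) :
    IsIsolatedCISurfaceSingularity f := by
  refine ⟨hf0, by rwa [Nat.card_eq_fintype_card, Nat.card_eq_fintype_card],
    ringKrullDim_quotient_eq_two f hf0 hcard q hq0 hq, ?_⟩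
  have h1 : ∀ᶠ z : σ → ℂ in 𝓝 0, eval z q ≠ 0 :=
    (MvPolynomial.continuous_eval q).continuousAt.eventually_ne hq0
  rw [eventually_nhdsWithin_iff]
  filter_upwards [h1] with z hz hz0 hfz
  exact hq z hz0 hz hfz

end Dimension

/-! ### Specialization over valued fields -/

open MvPolynomial in
lemma coord_mul_eval_pderiv_monomial {σ : Type*} (z : σ → ℂ) (w : σ) (α : σ →₀ ℕ) (a : ℂ) :
    z w * eval z (pderiv w (monomial α a)) = a * (α w : ℂ) * α.prod fun w a => z w ^ a := by
  have h := congrArg (eval z) (X_mul_pderiv_monomial (i := w) (m := α) (r := a))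
  rw [map_mul, eval_X, nsmul_eq_mul, map_mul, eval_monomial] at h
  rw [h]
  simp
  ring

/-- If a point lies in the Zariski closure of a set of points of affine space, it is the
specialization of a point over a valued field, an ultraproduct of the points of the set. -/
lemma exists_valuation_of_mem_closure.{u} {κ : Type u} (a₀ : κ → ℂ) (Z : Set (κ → ℂ))
    (hZ : ∀ q : MvPolynomial κ ℂ, MvPolynomial.eval a₀ q ≠ 0 →
      ∃ a ∈ Z, MvPolynomial.eval a q ≠ 0) :
    ∃ (K : Type u) (_ : Field K) (_ : Algebra ℂ K) (A : ValuationSubring K)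
      (G : (Z → ℂ) →+* K), TrivialOnC A.valuation ∧
      (∀ t : ℂ, algebraMap ℂ K t = G fun _ => t) ∧
      (∀ i, A.valuation (G (fun a => a.1 i) - algebraMap ℂ K (a₀ i)) < 1) ∧
      ∀ s : Finset (Z → ℂ), (∀ f ∈ s, G f = 0) → ∃ a, ∀ f ∈ s, f a = 0 := by
  classical
  have : (RingHom.ker (MvPolynomial.eval a₀)).IsPrime := RingHom.ker_isPrime _
  -- The complements in `Z` of hypersurfaces missing `a₀` generate a proper filter. An ultrafilter
  -- finer than it gives a field of germs in which every polynomial nonzero at `a₀` becomes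
  -- invertible.
  let Q := {q : MvPolynomial κ ℂ // MvPolynomial.eval a₀ q ≠ 0}
  let F : Q → Filter Z := fun q => Filter.principal {a | MvPolynomial.eval a.1 q.1 ≠ 0}
  have : Nonempty Q := ⟨⟨1, by simp⟩⟩
  have hdir : Directed (fun x1 x2 => x1 ≥ x2) F := by
    intro q q'
    refine ⟨⟨q.1 * q'.1, by rw [map_mul]; exact mul_ne_zero q.2 q'.2⟩, ?_, ?_⟩
    · refine Filter.principal_mono.2 fun a ha => ?_
      simp only [Set.mem_ofPred_eq, map_mul] at ha ⊢
      exact left_ne_zero_of_mul ha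
    · refine Filter.principal_mono.2 fun a ha => ?_
      simp only [Set.mem_ofPred_eq, map_mul] at ha ⊢
      exact right_ne_zero_of_mul ha
  have hne : (iInf F).NeBot := Filter.iInf_neBot_of_directed' hdir fun q => by
    obtain ⟨a, ha, h⟩ := hZ q.1 q.2
    exact Filter.principal_neBot_iff.2 ⟨⟨a, ha⟩, h⟩
  let U : Ultrafilter Z := Ultrafilter.of (iInf F)
  have hU : ∀ q : Q, ∀ᶠ a in (U : Filter Z), MvPolynomial.eval a.1 q.1 ≠ 0 := fun q =>
    (Ultrafilter.of_le (iInf F)) (iInf_le F q (Filter.mem_principal_self _))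
  let K := Filter.Germ (U : Filter Z) ℂ
  let G : (Z → ℂ) →+* K := Filter.Germ.coeRingHom (U : Filter Z)
  have hG : ∀ f, G f = 0 ↔ ∀ᶠ a in (U : Filter Z), f a = 0 := fun f =>
    Filter.Germ.coe_eq (l := (U : Filter Z)) (f := f) (g := fun _ => 0)
  let φ : MvPolynomial κ ℂ →+* K := G.comp (RingHom.pi fun a => MvPolynomial.eval a.1)
  have hφ : ∀ q : (RingHom.ker (MvPolynomial.eval a₀)).primeCompl, IsUnit (φ q) := by
    intro q
    refine Ne.isUnit fun h => ?_
    have h1 := (hG _).1 h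
    obtain ⟨a, h2, h3⟩ := (h1.and (hU ⟨q.1, fun h => q.2 h⟩)).exists
    exact h3 h2
  let R := Localization.AtPrime (RingHom.ker (MvPolynomial.eval a₀))
  let ψ : R →+* K := IsLocalization.lift (S := R) hφ
  have hψ : ∀ q, ψ (algebraMap _ R q) = φ q := fun q => IsLocalization.lift_eq hφ q
  -- A valuation ring of `K` dominating the local ring at `a₀` turns vanishing at `a₀` into
  -- valuation less than 1.
  obtain ⟨A, hA, hloc⟩ := IsLocalRing.exists_factor_valuationRing ψ
  let : Algebra ℂ K := (φ.comp MvPolynomial.C).toAlgebra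
  have halg : ∀ t, algebraMap ℂ K t = φ (MvPolynomial.C t) := fun t => rfl
  have hle : ∀ q, A.valuation (φ q) ≤ 1 := fun q =>
    (A.valuation_le_one_iff _).2 (hψ q ▸ hA _)
  refine ⟨K, inferInstance, inferInstance, A, G, ?_, ?_, ?_, ?_⟩
  · intro t ht
    refine le_antisymm (hle _) ?_
    have h1 := hle (MvPolynomial.C t⁻¹)
    have h2 : φ (MvPolynomial.C t) * φ (MvPolynomial.C t⁻¹) = 1 := by
      rw [← map_mul, ← MvPolynomial.C_mul, mul_inv_cancel₀ ht, MvPolynomial.C_1, map_one]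
    have h3 := congrArg A.valuation h2
    rw [map_mul, map_one] at h3
    by_contra! hlt
    exact absurd h3 (mul_lt_one_of_lt_of_le hlt h1).ne
  · intro t
    rw [halg]
    change G _ = G _
    congr 1
    ext a
    simp
  · intro i
    have h1 : G (fun a => a.1 i) - algebraMap ℂ K (a₀ i) =
        φ (MvPolynomial.X i - MvPolynomial.C (a₀ i)) := by
      rw [map_sub, halg]
      congr 1
      change G _ = G _
      congr 1
      ext a
      simp
    have h2 : (MvPolynomial.X i - MvPolynomial.C (a₀ i) : MvPolynomial κ ℂ) ∈
        RingHom.ker (MvPolynomial.eval a₀) := by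
      rw [RingHom.mem_ker]; simp
    rw [h1, ← hψ]
    refine (A.valuation_lt_one_iff ⟨_, hA _⟩).1 ?_
    rw [IsLocalRing.mem_maximalIdeal, mem_nonunits_iff]
    intro hu
    have h3 : IsUnit (algebraMap _ R (MvPolynomial.X i - MvPolynomial.C (a₀ i))) :=
      hloc.map_nonunit _ hu
    rw [IsLocalization.AtPrime.isUnit_to_map_iff R (RingHom.ker (MvPolynomial.eval a₀))] at h3
    exact h3 h2
  · intro s hs
    have h1 : ∀ᶠ a in (U : Filter Z), ∀ f ∈ s, f a = 0 :=
      (Finset.eventually_all s).2 fun f hf => (hG _).1 (hs f hf)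
    exact h1.exists

namespace SpliceSystem

variable {N L : Type*} {D : N → Type*} (T : SpliceSystem N L D) [∀ x, Fintype (D x)]

/-- The equations with coefficients `b`. -/
noncomputable def eqn (b : T.Idx → ℂ) (j : Σ x, Fin (T.r x)) : MvPolynomial L ℂ :=
  ∑ m : T.Mon j.1, MvPolynomial.monomial m.2.1 (b ⟨j.1, (j.2, m)⟩)

lemma eval_eqn (b : T.Idx → ℂ) (z : L → ℂ) (j : Σ x, Fin (T.r x)) :
    MvPolynomial.eval z (T.eqn b j) = ∑ m : T.Mon j.1, b ⟨j.1, (j.2, m)⟩ * mono z m.2.1 := by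
  simp [eqn, MvPolynomial.eval_monomial, mono]

lemma coord_mul_eval_pderiv_eqn (b : T.Idx → ℂ) (z : L → ℂ) (w : L) (j : Σ x, Fin (T.r x)) :
    z w * MvPolynomial.eval z (MvPolynomial.pderiv w (T.eqn b j)) =
      ∑ m : T.Mon j.1, b ⟨j.1, (j.2, m)⟩ * (m.2.1 w : ℂ) * mono z m.2.1 := by
  rw [eqn, map_sum, map_sum, Finset.mul_sum]
  exact Finset.sum_congr rfl fun m _ => coord_mul_eval_pderiv_monomial z w _ _

variable {T}

/-- For coefficients near generic ones, in the Zariski topology, the equations have linearly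
independent differentials at all solutions near the origin except the origin. -/
theorem IsGeneric.exists_polynomial [Fintype N] [Fintype L] {c₀ : T.Idx → ℂ}
    (hgen : T.IsGeneric c₀) :
    ∃ q : MvPolynomial (T.Idx ⊕ L) ℂ, MvPolynomial.eval (Sum.elim c₀ 0) q ≠ 0 ∧
      ∀ (b : T.Idx → ℂ) (z : L → ℂ), MvPolynomial.eval (Sum.elim b z) q ≠ 0 → z ≠ 0 →
        (∀ j, MvPolynomial.eval z (T.eqn b j) = 0) →
        LinearIndependent ℂ fun (j : Σ x, Fin (T.r x)) (w : L) =>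
          MvPolynomial.eval z (MvPolynomial.pderiv w (T.eqn b j)) := by
  classical
  by_contra! hcon
  let Z : Set (T.Idx ⊕ L → ℂ) := {a | a ∘ Sum.inr ≠ 0 ∧
    (∀ j, MvPolynomial.eval (a ∘ Sum.inr) (T.eqn (a ∘ Sum.inl) j) = 0) ∧
    ¬ LinearIndependent ℂ fun (j : Σ x, Fin (T.r x)) (w : L) =>
      MvPolynomial.eval (a ∘ Sum.inr) (MvPolynomial.pderiv w (T.eqn (a ∘ Sum.inl) j))}
  obtain ⟨K, _, _, A, G, hv, halg, hlt, hfin⟩ :=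
    exists_valuation_of_mem_closure (Sum.elim c₀ 0) Z fun q hq => by
      obtain ⟨b, z, h1, h2, h3, h4⟩ := hcon q hq
      exact ⟨Sum.elim b z, ⟨h2, h3, h4⟩, h1⟩
  let c : T.Idx → K := fun j => G fun a => a.1 (Sum.inl j)
  let z : L → K := fun w => G fun a => a.1 (Sum.inr w)
  have hmono : ∀ α : L →₀ ℕ, mono z α = G fun a => mono (a.1 ∘ Sum.inr) α := by
    intro α
    have h1 : (fun a : Z => mono (a.1 ∘ Sum.inr) α) =
        ∏ w ∈ α.support, (fun a : Z => a.1 (Sum.inr w)) ^ α w := by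
      ext a
      simp [mono, Finsupp.prod]
    rw [h1, map_prod]
    simp [mono, Finsupp.prod, z]
  have hz0 : z ≠ 0 := by
    intro h
    obtain ⟨a, ha⟩ := hfin (Finset.univ.image fun w a => a.1 (Sum.inr w)) (by
      intro f hf
      obtain ⟨w, -, rfl⟩ := Finset.mem_image.1 hf
      exact congrFun h w)
    refine a.2.1 (funext fun w => ha _ (Finset.mem_image.2 ⟨w, Finset.mem_univ _, rfl⟩))
  have hy : ∀ a : Z, ∃ y : (Σ x, Fin (T.r x)) → ℂ, (∃ j, y j ≠ 0) ∧ ∀ w, ∑ j, y j *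
      ∑ m : T.Mon j.1, a.1 (Sum.inl ⟨j.1, (j.2, m)⟩) * (m.2.1 w : ℂ) *
        mono (a.1 ∘ Sum.inr) m.2.1 = 0 := by
    intro a
    obtain ⟨y, h1, h2⟩ := Fintype.not_linearIndependent_iff.1 a.2.2.2
    refine ⟨y, h2, fun w => ?_⟩
    -- Multiplying the column of `w` by the coordinate `z_w` turns the relation between gradients
    -- into one between logarithmic gradients; no coordinate has to be nonzero.
    have h3 := congrArg (fun t => a.1 (Sum.inr w) * t) (congrFun h1 w)
    simp only [Pi.zero_apply, mul_zero, Finset.sum_apply, Pi.smul_apply, smul_eq_mul,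
      Finset.mul_sum] at h3
    rw [← h3]
    refine Finset.sum_congr rfl fun j _ => ?_
    have h4 := T.coord_mul_eval_pderiv_eqn (a.1 ∘ Sum.inl) (a.1 ∘ Sum.inr) w j
    simp only [Function.comp_apply] at h4
    rw [← h4]
    ring
  choose y hy0 hy using hy
  have key := T.eq_zero_of_logJacobian (z := z) (c := c) (c₀ := c₀) hv
    (fun j => by simpa using hlt (Sum.inl j)) hgen
    (fun x i => by
      have h1 : ∑ e, T.part c z x i e =
          G (∑ m : T.Mon x, (fun a : Z => a.1 (Sum.inl ⟨x, (i, m)⟩)) *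
            fun a : Z => mono (a.1 ∘ Sum.inr) m.2.1) := by
        rw [map_sum, sum_mon_eq]
        refine Finset.sum_congr rfl fun e _ => Finset.sum_congr rfl fun α _ => ?_
        rw [map_mul, hmono]
      rw [h1, ← map_zero G]
      congr 1
      ext a
      have h2 := a.2.2.1 ⟨x, i⟩
      rw [eval_eqn] at h2
      simpa using h2)
    (fun w => by simpa using hlt (Sum.inr w)) hz0 (fun j => G fun a => y a j) (fun w => by
      have h1 : ∑ j : Σ x, Fin (T.r x), (G fun a => y a j) * ∑ m : T.Mon j.1,
          c ⟨j.1, (j.2, m)⟩ * (m.2.1 w : K) * mono z m.2.1 =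
          G (∑ j : Σ x, Fin (T.r x), (fun a => y a j) * ∑ m : T.Mon j.1,
            (fun a : Z => a.1 (Sum.inl ⟨j.1, (j.2, m)⟩)) * (m.2.1 w : Z → ℂ) *
              fun a : Z => mono (a.1 ∘ Sum.inr) m.2.1) := by
        rw [map_sum]
        refine Finset.sum_congr rfl fun j _ => ?_
        rw [map_mul, map_sum]
        congr 1
        refine Finset.sum_congr rfl fun m _ => ?_
        rw [map_mul, map_mul, map_natCast, hmono]
      rw [h1, ← map_zero G]
      congr 1
      ext a
      simpa using hy a w)
  obtain ⟨a, ha⟩ := hfin (Finset.univ.image fun j a => y a j) (by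
    intro f hf
    obtain ⟨j, -, rfl⟩ := Finset.mem_image.1 hf
    exact congrFun key j)
  obtain ⟨j, hj⟩ := hy0 a
  exact hj (ha _ (Finset.mem_image.2 ⟨j, Finset.mem_univ _, rfl⟩))

end SpliceSystem

/-! ### Generic coefficients -/

/-- There are arbitrarily large finite families of complex numbers that are algebraically
independent over a given countable subfield. -/
lemma exists_algebraicIndependent (s : Set ℂ) (hs : s.Countable) (J : Type*) [Finite J] :
    ∃ t : J → ℂ, AlgebraicIndependent (IntermediateField.adjoin ℚ s) t := by
  set F := IntermediateField.adjoin ℚ s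
  have hF : Cardinal.mk F ≤ Cardinal.aleph0 := by
    refine (IntermediateField.cardinalMk_adjoin_le ℚ s).trans ?_
    simp [hs]
  obtain ⟨B, hB⟩ := exists_isTranscendenceBasis F ℂ
  have hcard : Cardinal.aleph0 ≤ Cardinal.mk B := by
    by_contra! hlt
    have h0 : Cardinal.mk (Algebra.adjoin F B) ≤ Cardinal.aleph0 := by
      refine (Algebra.cardinalMk_adjoin_le F B).trans ?_
      simp [hF, hlt.le]
    have halg := hB.isAlgebraic
    rw [Subtype.range_coe] at halg
    have h1 := Algebra.IsAlgebraic.cardinalMk_le_max (Algebra.adjoin F B) ℂ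
    have h2 := h1.trans (max_le h0 le_rfl)
    rw [Cardinal.mk_complex] at h2
    exact absurd h2 Cardinal.aleph0_lt_continuum.not_ge
  have : Infinite B := Cardinal.infinite_iff.2 hcard
  obtain ⟨ι⟩ : Nonempty (J ↪ B) := by
    have : Nonempty (Fin (Nat.card J) ↪ B) := ⟨Fin.valEmbedding.trans (Infinite.natEmbedding B)⟩
    obtain ⟨f⟩ := this
    exact ⟨(Finite.equivFin J).toEmbedding.trans f⟩
  exact ⟨fun j => (ι j : ℂ), hB.1.comp ι ι.injective⟩

namespace SpliceSystem

variable {N L : Type*} {D : N → Type*} {T : SpliceSystem N L D}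

/-- A determinant of sums with algebraically independent coefficients does not vanish. -/
lemma det_ne_zero_of_algebraicIndependent {F : Type*} [Field F] [Algebra F ℂ] {x : N}
    {c : Fin (T.r x) × T.Mon x → ℂ} (hc : AlgebraicIndependent F c) (θ : T.Mon x → F)
    (hθ : ∀ m, θ m ≠ 0) (g : Fin (T.r x) → D x) (hg : Function.Injective g) :
    (Matrix.of fun i j => ∑ α : {α // α ∈ T.S x (g j)},
      c (i, ⟨g j, α⟩) * algebraMap F ℂ (θ ⟨g j, α⟩)).det ≠ 0 := by
  classical
  choose α₀ hα₀ using T.nonempty x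
  set P : Matrix (Fin (T.r x)) (Fin (T.r x)) (MvPolynomial (Fin (T.r x) × T.Mon x) F) :=
    Matrix.of fun i j => ∑ α : {α // α ∈ T.S x (g j)},
      MvPolynomial.X (i, ⟨g j, α⟩) * MvPolynomial.C (θ ⟨g j, α⟩) with hP
  have hdet : P.det ≠ 0 := by
    intro h
    -- This specialization turns the matrix into the identity: in column `j` only the monomial `α₀
    -- (g j)` survives, only in row `j`, and its factor `θ` is cancelled.
    have h1 := congrArg (MvPolynomial.eval fun p : Fin (T.r x) × T.Mon x =>
      if g p.1 = p.2.1 ∧ p.2.2.1 = α₀ p.2.1 then (θ p.2)⁻¹ else 0) h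
    rw [RingHom.map_det, map_zero] at h1
    refine one_ne_zero (α := F) ?_
    rw [← h1, ← Matrix.det_one (n := Fin (T.r x))]
    congr 1
    ext i j
    simp only [hP, RingHom.mapMatrix_apply, Matrix.map_apply, Matrix.of_apply, map_sum, map_mul,
      MvPolynomial.eval_X, MvPolynomial.eval_C]
    rw [Finset.sum_eq_single ⟨α₀ (g j), hα₀ (g j)⟩]
    · by_cases hij : i = j
      · subst hij
        simp [hθ]
      · simp [hij, hg.eq_iff]
    · intro α _ hα
      rw [if_neg fun h => hα (Subtype.ext h.2), zero_mul]
    · intro h; exact absurd (Finset.mem_univ _) h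
  intro h
  apply hdet
  apply hc
  rw [map_zero, ← h, AlgHom.map_det]
  congr 1
  ext i j
  simp [hP]

/-- Generic coefficients exist. They can be prescribed at nodes with just one monomial in each
direction, provided that the maximal minors do not vanish. -/
lemma exists_isGeneric [Finite T.Idx] (c : T.Idx → ℂ) (P : N → Prop)
    (hP : ∀ x, P x → (∀ e, (T.S x e).card = 1) ∧ ∀ g : Fin (T.r x) ↪ T.Mon x,
      (Matrix.of fun i j => c ⟨x, (i, g j)⟩).det ≠ 0) :
    ∃ c' : T.Idx → ℂ, T.IsGeneric c' ∧ ∀ x, P x → ∀ p, c' ⟨x, p⟩ = c ⟨x, p⟩ := by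
  classical
  set s : Set ℂ := Set.range c
  obtain ⟨t, ht⟩ := exists_algebraicIndependent s (Set.finite_range c).countable
    {j : T.Idx // ¬ P j.1}
  -- Prescribed coefficients are kept; all others are algebraically independent over the field
  -- generated by the range of `c`.
  set c' : T.Idx → ℂ := fun j => if h : P j.1 then c j else t ⟨j, h⟩ with hc'
  have hc'P : ∀ x, P x → ∀ p, c' ⟨x, p⟩ = c ⟨x, p⟩ := fun x hx p => dif_pos hx
  have hc'N : ∀ x (hx : ¬ P x) p, c' ⟨x, p⟩ = t ⟨⟨x, p⟩, hx⟩ := fun x hx p => dif_neg hx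
  refine ⟨c', ?_, hc'P⟩
  intro x θ hθ g hg
  by_cases hx : P x
  · obtain ⟨h1, h2⟩ := hP x hx
    choose α hα using fun e => Finset.card_eq_one.1 (h1 e)
    have hαmem : ∀ e, α e ∈ T.S x e := fun e => by rw [hα e]; exact Finset.mem_singleton_self _
    let m : Fin (T.r x) → T.Mon x := fun j => ⟨g j, α (g j), hαmem (g j)⟩
    have hm : Function.Injective m := fun i j hij => hg (congrArg Sigma.fst hij)
    -- With one monomial per direction the factors `θ` only rescale columns.
    have h3 : (Matrix.of fun i j => ∑ α : {α // α ∈ T.S x (g j)},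
        c' ⟨x, (i, ⟨g j, α⟩)⟩ * θ ⟨g j, α⟩) =
        Matrix.of fun i j => θ (m j) * Matrix.of (fun i j => c ⟨x, (i, m j)⟩) i j := by
      ext i j
      simp only [Matrix.of_apply]
      rw [Finset.sum_eq_single ⟨α (g j), hαmem (g j)⟩, hc'P x hx, mul_comm]
      · rintro ⟨β, hβ⟩ _ hne
        refine absurd (Subtype.ext ?_) hne
        rw [hα] at hβ
        exact Finset.mem_singleton.1 hβ
      · intro h; exact absurd (Finset.mem_univ _) h
    rw [h3, Matrix.det_mul_row]
    exact mul_ne_zero (Finset.prod_ne_zero_iff.2 fun j _ => (hθ _).2) (h2 ⟨m, hm⟩)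
  · set F := IntermediateField.adjoin ℚ s
    set A : Set {j : T.Idx // ¬ P j.1} := {j | j.1.1 ≠ x} with hA
    set B : Set {j : T.Idx // ¬ P j.1} := {j | j.1.1 = x} with hB
    set F₁ := IntermediateField.adjoin F (t '' A)
    -- The coefficients at `x` stay independent over the field generated by all other coefficients,
    -- and then over its algebraic closure in `ℂ`, which contains the factors `θ`.
    have h1 : AlgebraicIndependent F₁ fun i : B => t i :=
      IntermediateField.algebraicIndependent_adjoin_iff.2
        (ht.adjoin_of_disjoint (Set.disjoint_left.2 fun j hj hj' => hj hj'))
    have h2 := h1.algebraicClosure.comp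
      (fun p : Fin (T.r x) × T.Mon x => (⟨⟨⟨x, p⟩, hx⟩, rfl⟩ : B))
      (fun p p' h => by simpa using h)
    have hmem : ∀ u ∈ T.coeffField c' {x}ᶜ, u ∈ algebraicClosure F₁ ℂ := by
      intro u hu
      rw [mem_algebraicClosure_iff]
      rw [coeffField, mem_algClosureOf] at hu
      set s' := {t | ∃ j : T.Idx, j.1 ∈ ({x}ᶜ : Set N) ∧ c' j = t}
      have hle : IntermediateField.adjoin ℚ s' ≤ F₁.restrictScalars ℚ := by
        rw [IntermediateField.adjoin_le_iff]
        rintro _ ⟨⟨x', p⟩, hj, rfl⟩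
        by_cases hx' : P x'
        · rw [hc'P x' hx']
          have : c ⟨x', p⟩ ∈ F := IntermediateField.subset_adjoin _ _ ⟨_, rfl⟩
          exact F₁.algebraMap_mem (⟨_, this⟩ : F)
        · rw [hc'N x' hx']
          exact IntermediateField.subset_adjoin F _ ⟨⟨⟨x', p⟩, hx'⟩, hj, rfl⟩
      let : Algebra (IntermediateField.adjoin ℚ s') F₁ :=
        (IntermediateField.inclusion hle).toRingHom.toAlgebra
      have : IsScalarTower (IntermediateField.adjoin ℚ s') F₁ ℂ :=
        IsScalarTower.of_algebraMap_eq fun x => rfl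
      exact hu.tower_top _
    have h3 := det_ne_zero_of_algebraicIndependent h2
      (fun m => (⟨θ m, hmem _ (hθ m).1⟩ : algebraicClosure F₁ ℂ))
      (fun m h => (hθ m).2 (congrArg Subtype.val h)) g hg
    convert h3 using 7 with i j α
    · exact hc'N x hx _
    · rfl

end SpliceSystem

/-! ### Directions in trees -/

section Directions

variable {W : Type*} {H : SimpleGraph W}

lemma mem_cutOff_self {x v : W} (h : v ≠ x) : v ∈ cutOff H x v :=
  ⟨.nil, by simpa using h.symm⟩

lemma notMem_cutOff_left (x w : W) : w ∉ cutOff H x x := fun ⟨p, hp⟩ => hp p.start_mem_support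

lemma notMem_cutOff_right (x v : W) : x ∉ cutOff H x v := fun ⟨p, hp⟩ => hp p.end_mem_support

lemma mem_cutOff_symm {x v w : W} (h : w ∈ cutOff H x v) : v ∈ cutOff H x w := by
  obtain ⟨p, hp⟩ := h
  exact ⟨p.reverse, by simpa using hp⟩

lemma mem_cutOff_trans {x u v w : W} (h : v ∈ cutOff H x u) (h' : w ∈ cutOff H x v) :
    w ∈ cutOff H x u := by
  obtain ⟨p, hp⟩ := h
  obtain ⟨q, hq⟩ := h'
  exact ⟨p.append q, by simp [SimpleGraph.Walk.mem_support_append_iff, hp, hq]⟩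

lemma cutOff_congr {x u v : W} (h : v ∈ cutOff H x u) : cutOff H x v = cutOff H x u :=
  Set.ext fun _ => ⟨mem_cutOff_trans h, mem_cutOff_trans (mem_cutOff_symm h)⟩

lemma mem_cutOff_of_adj {x u v : W} (h : H.Adj u v) (hu : u ≠ x) (hv : v ≠ x) :
    v ∈ cutOff H x u :=
  ⟨h.toWalk, by simp [hu.symm, hv.symm]⟩

/-- Different neighbours of a vertex are in different parts of the graph cut off at that
vertex. -/
def IsSeparating (H : SimpleGraph W) : Prop :=
  ∀ ⦃x a b : W⦄, H.Adj x a → H.Adj x b → b ∈ cutOff H x a → a = b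

lemma _root_.SimpleGraph.IsAcyclic.isSeparating (hH : H.IsAcyclic) : IsSeparating H := by
  classical
  rintro x a b ha hb ⟨p, hp⟩
  by_contra hab
  have h1 : (SimpleGraph.Walk.cons ha.symm (.cons hb .nil)).IsPath := by
    simp [ha.ne', hb.ne, hab]
  have h2 := (hH.subsingleton_path a b).elim ⟨_, p.toPath.2⟩ ⟨_, h1⟩
  have h3 := congrArg (fun q : H.Path a b => q.1.support) h2
  have h4 : x ∈ (p.toPath : H.Walk a b).support := by
    simp only at h3
    rw [show (p.toPath : H.Walk a b).support = _ from h3]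
    simp
  exact hp (p.support_toPath_subset_support h4)

/-- Every vertex other than `x` lies in one of the parts cut off at `x`. -/
lemma exists_mem_cutOff (hc : H.Connected) {x z : W} (hz : z ≠ x) :
    ∃ u, H.Adj x u ∧ z ∈ cutOff H x u := by
  obtain ⟨p, hp⟩ := (hc x z).exists_isPath
  cases p with
  | nil => exact absurd rfl hz
  | cons h q =>
    rw [SimpleGraph.Walk.cons_isPath_iff] at hp
    exact ⟨_, h, q, hp.2⟩

lemma IsSeparating.eq_of_mem (hs : IsSeparating H) {x a b z : W} (ha : H.Adj x a)
    (hb : H.Adj x b) (hza : z ∈ cutOff H x a) (hzb : z ∈ cutOff H x b) : a = b :=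
  hs ha hb (mem_cutOff_trans hza (mem_cutOff_symm hzb))

/-- A path from `x` to `w` must pass through `y`, and its remainder after `y` does not return to
`x`. -/
lemma mem_cutOff_of_notMem (hc : H.Connected) {x y w : W} (hxy : x ≠ y)
    (hw : w ∉ cutOff H y x) : w ∈ cutOff H x y := by
  classical
  obtain ⟨p, hp⟩ := (hc x w).exists_isPath
  have hy : y ∈ p.support := by
    by_contra h
    exact hw ⟨p, h⟩
  refine ⟨p.dropUntil y hy, fun hx => ?_⟩
  have h1 := p.take_spec hy
  rw [← h1, SimpleGraph.Walk.isPath_def, SimpleGraph.Walk.support_append] at hp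
  have h2 := List.disjoint_of_nodup_append hp
  have h3 : x ∈ (p.dropUntil y hy).support.tail := by
    rw [← SimpleGraph.Walk.cons_tail_support] at hx
    exact (List.mem_cons.1 hx).resolve_left hxy
  exact h2 (p.takeUntil y hy).start_mem_support h3

lemma IsSeparating.notMem_of_adj (hs : IsSeparating H) {x y w : W} (h : H.Adj x y)
    (hw : w ∈ cutOff H x y) : w ∉ cutOff H y x := by
  classical
  rintro ⟨p, hp⟩
  obtain ⟨q, hq, hqp⟩ : ∃ q : H.Walk x w, q.IsPath ∧ y ∉ q.support :=
    ⟨p.toPath, p.toPath.2, fun h => hp (p.support_toPath_subset_support h)⟩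
  cases q with
  | nil => exact notMem_cutOff_right _ _ hw
  | @cons _ a _ h' q' =>
    rw [SimpleGraph.Walk.cons_isPath_iff] at hq
    have : a = y := hs.eq_of_mem h' h ⟨q', hq.2⟩ hw
    subst this
    simp at hqp

lemma IsSeparating.mem_iff_of_adj (hs : IsSeparating H) (hc : H.Connected) {x y w : W}
    (h : H.Adj x y) : w ∈ cutOff H x y ↔ w ∉ cutOff H y x :=
  ⟨hs.notMem_of_adj h, mem_cutOff_of_notMem hc h.ne⟩

/-- Paths are replaced by separation, which transfers easily between the resolution graph and the
splice diagram. -/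
lemma IsSeparating.mem_onPath_iff (hs : IsSeparating H) (hc : H.Connected) {v w x : W} :
    x ∈ onPath H v w ↔ w ∉ cutOff H x v := by
  constructor
  · rintro ⟨p, hp, hx⟩ hw
    induction p with
    | nil =>
      rw [SimpleGraph.Walk.support_nil, List.mem_singleton] at hx
      exact notMem_cutOff_left _ _ (hx ▸ hw)
    | @cons v u w h q ih =>
      rw [SimpleGraph.Walk.cons_isPath_iff] at hp
      rw [SimpleGraph.Walk.support_cons, List.mem_cons] at hx
      rcases hx with rfl | hx
      · exact notMem_cutOff_left _ _ hw
      have hvx : v ≠ x := by rintro rfl; exact hp.2 hx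
      by_cases hux : u = x
      · subst hux
        exact hs.notMem_of_adj h ⟨q, hp.2⟩ hw
      · exact ih hp.1 hx (mem_cutOff_trans (mem_cutOff_symm (mem_cutOff_of_adj h hvx hux)) hw)
  · intro hw
    obtain ⟨p, hp⟩ := (hc v w).exists_isPath
    refine ⟨p, hp, ?_⟩
    by_contra h
    exact hw ⟨p, h⟩

lemma IsSeparating.adj_mem_onPath_iff (hs : IsSeparating H) (hc : H.Connected) {v w x a : W}
    (hx : x ∈ onPath H v w) (ha : H.Adj x a) :
    a ∈ onPath H v w ↔ v ∈ cutOff H x a ∨ w ∈ cutOff H x a := by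
  rw [hs.mem_onPath_iff hc] at hx ⊢
  rw [hs.mem_iff_of_adj hc ha, hs.mem_iff_of_adj hc ha]
  constructor
  · contrapose!
    rintro ⟨h1, h2⟩
    exact mem_cutOff_trans (mem_cutOff_symm h1) h2
  · contrapose!
    rintro ⟨p, hp⟩
    classical
    have hxp : x ∈ p.support := by
      by_contra h
      exact hx ⟨p, h⟩
    exact ⟨mem_cutOff_symm ⟨p.takeUntil x hxp, fun h => hp (p.support_takeUntil_subset_support hxp h)⟩,
      p.dropUntil x hxp, fun h => hp (p.support_dropUntil_subset_support hxp h)⟩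

lemma IsSeparating.cutOff_subset (hs : IsSeparating H) (hc : H.Connected) {s t t' : W}
    (h : H.Adj s t) (h' : H.Adj t t') (hne : t' ≠ s) : cutOff H t t' ⊆ cutOff H s t := by
  intro x hx
  rw [hs.mem_iff_of_adj hc h]
  exact fun hxs => hne (hs.eq_of_mem h' h.symm hx hxs)

lemma mem_cutOff_eq_of_valency_one {y u w : W} (h : H.Adj y u) (hu : valency H u = 1)
    (hw : w ∈ cutOff H y u) : w = u := by
  obtain ⟨p, hp⟩ := hw
  cases p with
  | nil => rfl
  | cons h' q =>
    obtain ⟨a, ha⟩ := Set.ncard_eq_one.1 hu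
    have h1 : y ∈ H.neighborSet u := h.symm
    have h2 := (H.mem_neighborSet _ _).2 h'
    rw [ha, Set.mem_singleton_iff] at h1 h2
    subst h2
    subst h1
    simp at hp

/-- Every part cut off at a vertex contains a vertex of valency other than two. -/
lemma IsSeparating.exists_valency_ne_two [Finite W] (hs : IsSeparating H) (hc : H.Connected)
    {s t : W} (h : H.Adj s t) : ∃ x ∈ cutOff H s t, valency H x ≠ 2 := by
  induction hn : (cutOff H s t).ncard using Nat.strong_induction_on generalizing s t with
  | _ n ih =>
    by_cases ht : valency H t = 2
    · have hs' : s ∈ H.neighborSet t := h.symm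
      obtain ⟨t', ht', hne⟩ := Set.exists_ne_of_one_lt_ncard
        (show 1 < (H.neighborSet t).ncard by rw [valency] at ht; omega) s
      have hsub := hs.cutOff_subset hc h ht' hne
      have hlt : (cutOff H t t').ncard < n := by
        rw [← hn]
        exact Set.ncard_lt_ncard ((Set.ssubset_iff_of_subset hsub).2
          ⟨t, mem_cutOff_self h.ne', notMem_cutOff_right _ _⟩)
      obtain ⟨x, hx, hx2⟩ := ih _ hlt ht' rfl
      exact ⟨x, hsub hx, hx2⟩
    · exact ⟨t, mem_cutOff_self h.ne', ht⟩

end Directions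

/-! ### The adjugate of the intersection matrix of a tree -/

section PrincipalMinors

open scoped Classical

variable {V : Type*} [Fintype V]

/-- The principal minor on a set of indices. -/
noncomputable def principalMinor (M : Matrix V V ℤ) (S : Set V) : ℤ :=
  (M.submatrix (Subtype.val : S → V) (Subtype.val : S → V)).det

lemma principalMinor_eq_det {m : Type*} {_ : Fintype m} {_ : DecidableEq m} (M : Matrix V V ℤ) (S : Set V)
    (e : m ≃ S) (A : Matrix m m ℤ) (hA : ∀ i j, A i j = M (e i) (e j)) :
    A.det = principalMinor M S := by
  have h : A = (M.submatrix (Subtype.val : S → V) Subtype.val).submatrix e e := by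
    ext i j
    exact hA i j
  rw [h, Matrix.det_submatrix_equiv_self e, principalMinor]

lemma principalMinor_univ (M : Matrix V V ℤ) : principalMinor M Set.univ = M.det :=
  (principalMinor_eq_det M _ (Equiv.Set.univ V).symm M fun _ _ => rfl).symm

lemma principalMinor_empty (M : Matrix V V ℤ) : principalMinor M ∅ = 1 := by
  rw [← principalMinor_eq_det M ∅ (Equiv.equivOfIsEmpty Empty _) 1 fun i => i.elim]
  exact Matrix.det_one

lemma principalMinor_union (M : Matrix V V ℤ) {S T : Set V} (hd : Disjoint S T)
    (h : ∀ i ∈ T, ∀ j ∈ S, M i j = 0) :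
    principalMinor M (S ∪ T) = principalMinor M S * principalMinor M T := by
  have hT : ∀ x ∈ S ∪ T, x ∉ S ↔ x ∈ T := fun x hx =>
    ⟨fun hn => hx.resolve_left hn, fun hT hS => Set.disjoint_left.1 hd hS hT⟩
  set A := M.submatrix (Subtype.val : ↥(S ∪ T) → V) (Subtype.val : ↥(S ∪ T) → V)
  have key := Matrix.twoBlockTriangular_det A (fun i => i.1 ∈ S)
    (fun i hi j hj => h _ ((hT _ i.2).1 hi) _ hj)
  rw [principalMinor_eq_det M (S ∪ T) (Equiv.refl _) A fun _ _ => rfl,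
    principalMinor_eq_det M S ⟨fun i => ⟨i.1.1, i.2⟩, fun i => ⟨⟨i.1, Or.inl i.2⟩, i.2⟩,
      fun _ => rfl, fun _ => rfl⟩ (A.toSquareBlockProp fun i => i.1 ∈ S) fun _ _ => rfl,
    principalMinor_eq_det M T ⟨fun i => ⟨i.1.1, (hT _ i.1.2).1 i.2⟩,
      fun i => ⟨⟨i.1, Or.inr i.2⟩, (hT _ (Or.inr i.2)).2 i.2⟩, fun _ => rfl, fun _ => rfl⟩
      (A.toSquareBlockProp fun i => ¬ i.1 ∈ S) fun _ _ => rfl] at key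
  exact key

lemma principalMinor_biUnion {ι : Type*} (M : Matrix V V ℤ) (A : Finset ι) (S : ι → Set V)
    (hd : ∀ a ∈ A, ∀ b ∈ A, a ≠ b → Disjoint (S a) (S b) ∧ ∀ i ∈ S a, ∀ j ∈ S b, M i j = 0) :
    principalMinor M (⋃ a ∈ A, S a) = ∏ a ∈ A, principalMinor M (S a) := by
  induction A using Finset.induction_on with
  | empty => simp [principalMinor_empty]
  | insert a A ha ih =>
    have hne : ∀ b ∈ A, b ≠ a := by rintro b hb rfl; exact ha hb
    rw [Finset.set_biUnion_insert, principalMinor_union, Finset.prod_insert ha, ih]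
    · exact fun b hb c hc => hd b (Finset.mem_insert_of_mem hb) c (Finset.mem_insert_of_mem hc)
    · simp only [Set.disjoint_iUnion_right]
      exact fun b hb => (hd a (Finset.mem_insert_self _ _) b (Finset.mem_insert_of_mem hb)
        (hne b hb).symm).1
    · intro i hi j hj
      simp only [Set.mem_iUnion] at hi
      obtain ⟨b, hb, hi⟩ := hi
      exact (hd b (Finset.mem_insert_of_mem hb) a (Finset.mem_insert_self _ _) (hne b hb)).2
        i hi j hj

lemma det_updateCol_single_self {m : Type*} {_ : Fintype m} {_ : DecidableEq m}
    (A : Matrix m m ℤ) (v : m) :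
    (A.updateCol v (Pi.single v 1)).det = (A.toSquareBlockProp fun i => ¬ i = v).det := by
  set B := A.updateCol v (Pi.single v 1) with hB
  have key := Matrix.twoBlockTriangular_det B (fun i => i = v) (by
    rintro i hi j rfl
    rw [hB, Matrix.updateCol_self, Pi.single_eq_of_ne hi])
  have h3 : (B.toSquareBlockProp fun i => i = v).det = 1 := by
    have : B.toSquareBlockProp (fun i => i = v) = 1 := by
      ext ⟨i, rfl⟩ ⟨j, rfl⟩
      simp [Matrix.toSquareBlockProp, hB, Matrix.toBlock]
    rw [this, Matrix.det_one]
  have h4 : B.toSquareBlockProp (fun i => ¬ i = v) = A.toSquareBlockProp fun i => ¬ i = v := by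
    ext i j
    exact Matrix.updateCol_ne j.2
  rw [key, h4]
  refine Eq.trans ?_ (one_mul _)
  congr 1
  · convert h3

/-- Cramer's rule for a principal submatrix and a multiple of a unit vector. -/
lemma mul_principalMinor_eq (M : Matrix V V ℤ) {S : Set V} {v : V} (hv : v ∈ S) (f : V → ℤ)
    (c : ℤ) (hf : ∀ x : S, ∑ y : S, M x y * f y = if x.1 = v then c else 0) :
    f v * principalMinor M S = c * principalMinor M (S \ {v}) := by
  set A := M.submatrix (Subtype.val : S → V) (Subtype.val : S → V) with hA
  set v' : S := ⟨v, hv⟩ with hv'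
  have h1 : A.mulVec (fun y => f y) = c • Pi.single v' 1 := by
    ext x
    rw [Matrix.mulVec, dotProduct]
    refine (hf x).trans ?_
    simp [Pi.single_apply, hv', Subtype.ext_iff]
  have h2 := congrFun (Matrix.cramer_eq_adjugate_mulVec A (A.mulVec fun y => f y)) v'
  rw [Matrix.mulVec_mulVec, Matrix.adjugate_mul, Matrix.smul_mulVec, Matrix.one_mulVec, h1,
    map_smul, Pi.smul_apply, Pi.smul_apply, Matrix.cramer_apply, det_updateCol_single_self,
    principalMinor_eq_det M (S \ {v}) ⟨fun i => ⟨i.1.1, i.1.2, fun h => i.2 (Subtype.ext h)⟩,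
        fun i => ⟨⟨i.1, i.2.1⟩, fun h => i.2.2 (congrArg Subtype.val h)⟩,
        fun _ => rfl, fun _ => rfl⟩ (A.toSquareBlockProp fun i => ¬ i = v') fun _ _ => rfl, smul_eq_mul, smul_eq_mul] at h2
  rw [principalMinor, mul_comm]
  exact h2.symm

end PrincipalMinors

namespace ResolutionGraph

open scoped Classical

variable {V : Type*} [Fintype V] (Γ : ResolutionGraph V)

/-- The matrix `-A`. -/
noncomputable def negMatrix : Matrix V V ℤ := -intersectionMatrix Γ.graph Γ.selfInt

/-- The linking numbers, as the entries of the adjugate of `-A`. -/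
noncomputable def lk (v w : V) : ℤ := Γ.negMatrix.adjugate v w

lemma disc_eq (S : Set V) : Γ.disc S = principalMinor Γ.negMatrix S := rfl

lemma isSeparating : IsSeparating Γ.graph := Γ.isTree.isAcyclic.isSeparating

lemma connected : Γ.graph.Connected := Γ.isTree.connected

lemma negMatrix_of_adj {v w : V} (h : Γ.graph.Adj v w) : Γ.negMatrix v w = -1 := by
  simp [negMatrix, intersectionMatrix, h.ne, h]

lemma negMatrix_of_not_adj {v w : V} (hne : v ≠ w) (h : ¬ Γ.graph.Adj v w) :
    Γ.negMatrix v w = 0 := by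
  simp [negMatrix, intersectionMatrix, hne, h]

lemma negMatrix_nonpos {v w : V} (hne : v ≠ w) : Γ.negMatrix v w ≤ 0 := by
  by_cases h : Γ.graph.Adj v w
  · rw [Γ.negMatrix_of_adj h]; norm_num
  · rw [Γ.negMatrix_of_not_adj hne h]

lemma posDef : (Γ.negMatrix.map (Int.cast : ℤ → ℝ)).PosDef := by
  have := Γ.negDef
  convert this using 1
  ext i j
  simp [negMatrix]

lemma disc_pos (S : Set V) : 0 < Γ.disc S := by
  have h := (Γ.posDef.submatrix (Subtype.val_injective (p := (· ∈ S)))).det_pos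
  have h2 : ((Γ.disc S : ℤ) : ℝ) = _ := Int.cast_det _
  rw [← Int.cast_pos (R := ℝ), h2]
  exact h

lemma sum_negMatrix_mul_lk (x w : V) :
    ∑ y, Γ.negMatrix x y * Γ.lk y w = if x = w then Γ.negMatrix.det else 0 := by
  have := congrFun (congrFun (Matrix.mul_adjugate Γ.negMatrix) x) w
  rw [Matrix.mul_apply] at this
  rw [Matrix.smul_apply, Matrix.one_apply, smul_eq_mul, mul_ite, mul_one, mul_zero] at this
  exact this

lemma det_pos : 0 < Γ.negMatrix.det := by
  rw [← principalMinor_univ, ← disc_eq]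
  exact Γ.disc_pos _

lemma disc_iUnion_cutOff (v : V) (A : Finset V) (hA : ∀ a ∈ A, Γ.graph.Adj v a) :
    Γ.disc (⋃ a ∈ A, cutOff Γ.graph v a) = ∏ a ∈ A, Γ.disc (cutOff Γ.graph v a) := by
  refine principalMinor_biUnion _ A _ fun a ha b hb hab => ⟨?_, ?_⟩
  · exact Set.disjoint_left.2 fun x hx hx' =>
      hab (Γ.isSeparating.eq_of_mem (hA a ha) (hA b hb) hx hx')
  · intro i hi j hj
    refine Γ.negMatrix_of_not_adj ?_ ?_
    · rintro rfl
      exact hab (Γ.isSeparating.eq_of_mem (hA a ha) (hA b hb) hi hj)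
    · intro hij
      refine hab (Γ.isSeparating.eq_of_mem (hA a ha) (hA b hb) (mem_cutOff_trans hi ?_) hj)
      refine mem_cutOff_of_adj hij ?_ ?_
      · rintro rfl; exact notMem_cutOff_right _ _ hi
      · rintro rfl; exact notMem_cutOff_right _ _ hj

/-- By Cramer's rule a diagonal entry of the adjugate is the principal minor on the complement of
`w`, and the parts cut off at `w` make this minor block diagonal. -/
lemma lk_self (w : V) :
    Γ.lk w w = ∏ a with Γ.graph.Adj w a, Γ.disc (cutOff Γ.graph w a) := by
  have h := mul_principalMinor_eq Γ.negMatrix (Set.mem_univ w) (fun y => Γ.lk y w)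
    Γ.negMatrix.det (fun x => by
      rw [← Γ.sum_negMatrix_mul_lk x.1 w]
      exact (Finset.sum_subtype Finset.univ (by simp) fun y => Γ.negMatrix x.1 y * Γ.lk y w).symm)
  rw [principalMinor_univ, mul_comm] at h
  rw [← Γ.disc_iUnion_cutOff _ _ (by simp), disc_eq]
  convert mul_left_cancel₀ Γ.det_pos.ne' h using 2
  ext x
  simp only [Finset.mem_filter, Finset.mem_univ, true_and, Set.mem_iUnion, exists_prop,
    Set.mem_sdiff, Set.mem_univ, Set.mem_singleton_iff]
  constructor
  · rintro ⟨a, -, hx⟩ rfl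
    exact notMem_cutOff_right _ _ hx
  · exact fun hx => exists_mem_cutOff Γ.connected hx

/-- The linking numbers of adjacent vertices with a third one. -/
lemma lk_mul_disc {v u w : V} (h : Γ.graph.Adj v u) (hw : w ∈ cutOff Γ.graph v u) :
    Γ.lk v w * Γ.disc (cutOff Γ.graph u v) =
      Γ.lk u w * ∏ a with Γ.graph.Adj v a ∧ a ≠ u, Γ.disc (cutOff Γ.graph v a) := by
  rw [← Γ.disc_iUnion_cutOff _ _ (by simp +contextual), disc_eq, disc_eq]
  have hwu : w ∉ cutOff Γ.graph u v := Γ.isSeparating.notMem_of_adj h hw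
  convert mul_principalMinor_eq Γ.negMatrix (mem_cutOff_self h.ne) (fun y => Γ.lk y w)
    (Γ.lk u w) (fun x => ?_) using 3
  · ext x
    simp only [Finset.mem_filter, Finset.mem_univ, true_and, Set.mem_iUnion, exists_prop,
      Set.mem_sdiff, Set.mem_singleton_iff, and_assoc]
    constructor
    · rintro ⟨a, ha, hau, hx⟩
      refine ⟨?_, ?_⟩
      · rw [Γ.isSeparating.mem_iff_of_adj Γ.connected h.symm]
        exact fun hx' => hau (Γ.isSeparating.eq_of_mem ha h hx hx')
      · rintro rfl
        exact notMem_cutOff_right _ _ hx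
    · rintro ⟨hx, hxv⟩
      obtain ⟨a, ha, hxa⟩ := exists_mem_cutOff Γ.connected hxv
      refine ⟨a, ha, ?_, hxa⟩
      rintro rfl
      exact Γ.isSeparating.notMem_of_adj h hxa hx
  -- Restricted to the part containing `v`, the column `lk · w` satisfies a linear system whose only
  -- source is at `v`: the term of the edge from `v` to `u`.
  · have h0 := Γ.sum_negMatrix_mul_lk x.1 w
    rw [if_neg (by rintro rfl; exact hwu x.2),
      ← Finset.sum_filter_add_sum_filter_not _ (· ∈ cutOff Γ.graph u v)] at h0
    have h1 : ∑ y with y ∈ cutOff Γ.graph u v, Γ.negMatrix x.1 y * Γ.lk y w =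
        ∑ y : cutOff Γ.graph u v, Γ.negMatrix x y * Γ.lk y w :=
      Finset.sum_subtype _ (by simp) _
    have h2 : ∑ y with y ∉ cutOff Γ.graph u v, Γ.negMatrix x.1 y * Γ.lk y w =
        Γ.negMatrix x u * Γ.lk u w := by
      refine Finset.sum_eq_single u (fun y hy hyu => ?_) (fun hu => ?_)
      · rw [Γ.negMatrix_of_not_adj, zero_mul]
        · rintro rfl
          exact (Finset.mem_filter.1 hy).2 x.2
        · intro hxy
          exact (Finset.mem_filter.1 hy).2 (mem_cutOff_trans x.2 (mem_cutOff_of_adj hxy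
            (by intro hx; exact notMem_cutOff_right u v (hx ▸ x.2)) hyu))
      · simp [notMem_cutOff_right] at hu
    rw [h1, h2] at h0
    rw [eq_neg_of_add_eq_zero_left h0]
    split_ifs with hx
    · rw [hx, Γ.negMatrix_of_adj h]; ring
    · rw [Γ.negMatrix_of_not_adj, zero_mul, neg_zero]
      · intro hxu; exact notMem_cutOff_right u v (hxu ▸ x.2)
      · intro hxu
        exact hx (Γ.isSeparating.eq_of_mem hxu.symm h.symm
          (mem_cutOff_self (by rintro h'; exact notMem_cutOff_right u v (h' ▸ x.2)))
          x.2)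

end ResolutionGraph

namespace ResolutionGraph

open scoped Classical

variable {V : Type*} [Fintype V] (Γ : ResolutionGraph V)

/-! ### The product formula for linking numbers -/

/-- The product of the discriminants of the parts cut off at `x` that contain neither `v`
nor `w`. -/
noncomputable def offProd (v w x : V) : ℤ :=
  ∏ a with Γ.graph.Adj x a ∧ v ∉ cutOff Γ.graph x a ∧ w ∉ cutOff Γ.graph x a,
    Γ.disc (cutOff Γ.graph x a)

lemma offProd_self (v : V) :
    Γ.offProd v v v = ∏ a with Γ.graph.Adj v a, Γ.disc (cutOff Γ.graph v a) := by
  simp [offProd, notMem_cutOff_right]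

/-- Induction along the path from `v` to `w`. Prepending an edge `v u` changes only the factors at
`u` and `v`, in the ratio given by `lk_mul_disc`. -/
lemma lk_eq_prod (v w : V) :
    Γ.lk v w = ∏ x with w ∉ cutOff Γ.graph x v, Γ.offProd v w x := by
  obtain ⟨p, hp⟩ := (Γ.connected v w).exists_isPath
  induction p with
  | @nil w =>
    have : (Finset.univ.filter fun x => w ∉ cutOff Γ.graph x w) = {w} := by
      ext x
      simp only [Finset.mem_filter, Finset.mem_univ, true_and, Finset.mem_singleton]
      constructor
      · intro h
        by_contra hne
        exact h (mem_cutOff_self (Ne.symm hne))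
      · rintro rfl
        exact notMem_cutOff_left _ _
    rw [this, Finset.prod_singleton, offProd_self, lk_self]
  | @cons v u w h q ih =>
    rw [SimpleGraph.Walk.cons_isPath_iff] at hp
    have hw : w ∈ cutOff Γ.graph v u := ⟨q, hp.2⟩
    have hs := Γ.isSeparating
    have hwu : w ∉ cutOff Γ.graph u v := hs.notMem_of_adj h hw
    have h1 := Γ.lk_mul_disc h hw
    rw [ih hp.1] at h1
    refine mul_right_cancel₀ (Γ.disc_pos (cutOff Γ.graph u v)).ne' (h1.trans ?_)
    clear h1 ih
    have key : ∀ x, (if w ∉ cutOff Γ.graph x u then Γ.offProd u w x else 1) *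
        (if x = v then ∏ a with Γ.graph.Adj v a ∧ a ≠ u, Γ.disc (cutOff Γ.graph v a) else 1) =
        (if w ∉ cutOff Γ.graph x v then Γ.offProd v w x else 1) *
        (if x = u then Γ.disc (cutOff Γ.graph u v) else 1) := by
      intro x
      by_cases hxv : x = v
      · subst hxv
        rw [if_neg (not_not.2 hw), if_pos rfl, if_pos (notMem_cutOff_left _ _), if_neg h.ne,
          one_mul, mul_one, offProd]
        refine Finset.prod_congr (Finset.filter_congr fun a _ => ?_) fun _ _ => rfl
        refine and_congr_right fun ha => ?_
        simp only [notMem_cutOff_right, not_false_eq_true, true_and]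
        refine not_congr ⟨?_, fun hwa => hs.eq_of_mem ha h hwa hw⟩
        rintro rfl
        exact hw
      by_cases hxu : x = u
      · subst hxu
        rw [if_pos (notMem_cutOff_left _ _), if_neg hxv, if_pos hwu, if_pos rfl, mul_one,
          mul_comm, offProd, offProd]
        have : (Finset.univ.filter fun a => Γ.graph.Adj x a ∧ x ∉ cutOff Γ.graph x a ∧
            w ∉ cutOff Γ.graph x a) = insert v (Finset.univ.filter fun a =>
              Γ.graph.Adj x a ∧ v ∉ cutOff Γ.graph x a ∧ w ∉ cutOff Γ.graph x a) := by
          ext a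
          simp only [Finset.mem_filter, Finset.mem_univ, true_and, Finset.mem_insert,
            notMem_cutOff_right, not_false_eq_true]
          constructor
          · rintro ⟨ha, hwa⟩
            by_cases hav : a = v
            · exact Or.inl hav
            · exact Or.inr ⟨ha, fun hva => hav (hs.eq_of_mem ha h.symm hva
                (mem_cutOff_self h.ne)), hwa⟩
          · rintro (rfl | ⟨ha, -, hwa⟩)
            · exact ⟨h.symm, hwu⟩
            · exact ⟨ha, hwa⟩
        rw [this, Finset.prod_insert]
        simp [mem_cutOff_self h.ne]
      · have huv : u ∈ cutOff Γ.graph x v := mem_cutOff_of_adj h (Ne.symm hxv) (Ne.symm hxu)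
        have hiff : ∀ a, v ∈ cutOff Γ.graph x a ↔ u ∈ cutOff Γ.graph x a := fun a =>
          ⟨fun hv => mem_cutOff_trans hv huv, fun hu => mem_cutOff_trans hu (mem_cutOff_symm huv)⟩
        rw [if_neg hxv, if_neg hxu, mul_one, mul_one, cutOff_congr huv]
        simp only [offProd, hiff]
    have := Finset.prod_congr rfl fun x (_ : x ∈ Finset.univ) => key x
    rw [Finset.prod_mul_distrib, Finset.prod_mul_distrib, Finset.prod_ite_eq',
      Finset.prod_ite_eq', ← Finset.prod_filter, ← Finset.prod_filter] at this
    simpa using this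

lemma lk_pos (v w : V) : 0 < Γ.lk v w := by
  rw [lk_eq_prod]
  exact Finset.prod_pos fun x _ => Finset.prod_pos fun a _ => Γ.disc_pos _

/-! ### Inequalities between linking numbers -/

lemma quadratic_pos {g : V → ℤ} (hg : g ≠ 0) :
    0 < ∑ x, g x * ∑ y, Γ.negMatrix x y * g y := by
  have h0 : (fun x => (g x : ℝ)) ≠ 0 := by
    intro h
    refine hg (funext fun x => ?_)
    have := congrFun h x
    simpa using this
  have h := Γ.posDef.dotProduct_mulVec_pos h0
  rw [← Int.cast_pos (R := ℝ)]
  refine h.trans_eq ?_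
  simp [dotProduct, Matrix.mulVec]

/-- Maximum principle. Write `g = p - m` with positive and negative parts. Pairing `-A g` with `m`
gives a number that is at least 0, while `-A p` paired with `m` is at most 0 because off-diagonal
entries are nonpositive. Positive definiteness then excludes `m ≠ 0`. -/
lemma nonneg_of_sum_eq {S : Set V} {g : V → ℤ} (hg : ∀ x ∉ S, g x = 0)
    (h : ∀ x ∈ S, 0 ≤ ∑ y, Γ.negMatrix x y * g y) (x : V) : 0 ≤ g x := by
  set m : V → ℤ := fun x => max (-g x) 0 with hm
  set p : V → ℤ := fun x => max (g x) 0 with hp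
  have hgpm : ∀ x, g x = p x - m x := fun x => by simp only [hm, hp]; omega
  have hm0 : ∀ x, 0 ≤ m x := fun x => le_max_right _ _
  by_cases hmz : m = 0
  · have := congrFun hmz x
    simp only [hm, Pi.zero_apply] at this
    omega
  exfalso
  have h1 : 0 ≤ ∑ x, m x * ∑ y, Γ.negMatrix x y * g y := by
    refine Finset.sum_nonneg fun x _ => ?_
    by_cases hx : x ∈ S
    · exact mul_nonneg (hm0 x) (h x hx)
    · simp [hm, hg x hx]
  have h2 : ∑ x, m x * ∑ y, Γ.negMatrix x y * p y ≤ 0 := by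
    refine Finset.sum_nonpos fun x _ => ?_
    rw [Finset.mul_sum]
    refine Finset.sum_nonpos fun y _ => ?_
    by_cases hxy : x = y
    · subst hxy
      have : m x * p x = 0 := by
        rw [mul_eq_zero]
        simp only [hm, hp]
        omega
      rw [mul_left_comm, this, mul_zero]
    · exact mul_nonpos_of_nonneg_of_nonpos (hm0 x)
        (mul_nonpos_of_nonpos_of_nonneg (Γ.negMatrix_nonpos hxy) (le_max_right _ _))
  have h3 := Γ.quadratic_pos hmz
  have h4 : ∑ x, m x * ∑ y, Γ.negMatrix x y * g y =
      ∑ x, m x * ∑ y, Γ.negMatrix x y * p y - ∑ x, m x * ∑ y, Γ.negMatrix x y * m y := by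
    simp only [hgpm, mul_sub, Finset.sum_sub_distrib]
  omega

/-- Strong maximum principle: at a zero of `g` with a positive neighbour the sum would be negative,
so positivity spreads from the source `w` along the walk. -/
lemma pos_of_sum_pos {g : V → ℤ} (hg : ∀ x, 0 ≤ g x) {S : Set V}
    (h : ∀ x ∈ S, 0 ≤ ∑ y, Γ.negMatrix x y * g y) {x w : V}
    (hw : 0 < ∑ y, Γ.negMatrix w y * g y) (p : Γ.graph.Walk x w) (hp : ∀ z ∈ p.support, z ∈ S) :
    0 < g x := by
  have hterm : ∀ x, g x = 0 → ∀ y, Γ.negMatrix x y * g y ≤ 0 := by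
    intro x hx y
    by_cases hxy : x = y
    · simp [← hxy, hx]
    · exact mul_nonpos_of_nonpos_of_nonneg (Γ.negMatrix_nonpos hxy) (hg y)
  induction p with
  | nil =>
    refine lt_of_le_of_ne (hg _) fun h0 => ?_
    exact absurd hw (not_lt.2 (Finset.sum_nonpos fun y _ => hterm _ h0.symm y))
  | @cons x u w hxu q ih =>
    have hu := ih hw fun z hz => hp z (by simp [hz])
    refine lt_of_le_of_ne (hg _) fun h0 => ?_
    refine absurd (h x (hp x (by simp))) (not_le.2 ?_)
    refine Finset.sum_neg' (fun y _ => hterm _ h0.symm y) ⟨u, Finset.mem_univ _, ?_⟩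
    rw [Γ.negMatrix_of_adj hxu]
    omega

/-- The function `z ↦ lk z w * lk y y - lk z y * lk y w` on a part cut off at `y`. -/
noncomputable def greenDiff (y w : V) (S : Set V) (z : V) : ℤ :=
  if z ∈ S then Γ.lk z w * Γ.lk y y - Γ.lk z y * Γ.lk y w else 0

lemma sum_greenDiff {x y z : V} (w : V) (hz : z ∈ cutOff Γ.graph y x) :
    ∑ t, Γ.negMatrix z t * Γ.greenDiff y w (cutOff Γ.graph y x) t =
      if z = w then Γ.negMatrix.det * Γ.lk y y else 0 := by
  have hzy : z ≠ y := by
    rintro rfl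
    exact notMem_cutOff_right _ _ hz
  have h1 : ∀ t, Γ.negMatrix z t * Γ.greenDiff y w (cutOff Γ.graph y x) t =
      (Γ.negMatrix z t * Γ.lk t w) * Γ.lk y y - (Γ.negMatrix z t * Γ.lk t y) * Γ.lk y w := by
    intro t
    rw [greenDiff]
    split_ifs with ht
    · ring
    · by_cases hty : t = y
      · subst hty; ring
      · rw [Γ.negMatrix_of_not_adj]
        · ring
        · rintro rfl; exact ht hz
        · intro hzt
          exact ht (mem_cutOff_trans hz (mem_cutOff_of_adj hzt hzy hty))
  rw [Finset.sum_congr rfl fun t _ => h1 t, Finset.sum_sub_distrib, ← Finset.sum_mul,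
    ← Finset.sum_mul, sum_negMatrix_mul_lk, sum_negMatrix_mul_lk, if_neg hzy]
  split_ifs <;> ring

/-- On the part containing `x` and `w`, `greenDiff` has a positive source at `w` and no other, so it
is positive at `x`. -/
lemma lk_mul_lk_lt {x y w : V} (hw : w ∈ cutOff Γ.graph y x) :
    Γ.lk x y * Γ.lk y w < Γ.lk x w * Γ.lk y y := by
  have hx : x ∈ cutOff Γ.graph y x := by
    refine mem_cutOff_self ?_
    rintro rfl
    exact notMem_cutOff_left _ _ hw
  have h : ∀ z ∈ cutOff Γ.graph y x,
      0 ≤ ∑ t, Γ.negMatrix z t * Γ.greenDiff y w (cutOff Γ.graph y x) t := by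
    intro z hz
    rw [Γ.sum_greenDiff w hz]
    split_ifs
    · exact (mul_pos Γ.det_pos (Γ.lk_pos _ _)).le
    · exact le_rfl
  have h0 := Γ.nonneg_of_sum_eq (g := Γ.greenDiff y w (cutOff Γ.graph y x))
    (fun z hz => if_neg hz) h
  have hpos : 0 < Γ.greenDiff y w (cutOff Γ.graph y x) x := by
    obtain ⟨p, hp⟩ := hw
    refine Γ.pos_of_sum_pos h0 h (w := w) ?_ p fun z hz =>
      ⟨p.takeUntil z hz, fun hy => hp (p.support_takeUntil_subset_support hz hy)⟩
    rw [Γ.sum_greenDiff w ⟨p, hp⟩, if_pos rfl]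
    exact mul_pos Γ.det_pos (Γ.lk_pos _ _)
  rw [greenDiff, if_pos hx] at hpos
  linarith

/-- Here `greenDiff` has no source in the part containing `x`; the maximum principle for it and its
negative makes it vanish. -/
lemma lk_mul_lk_eq {x y w : V} (hw : w ∉ cutOff Γ.graph y x) :
    Γ.lk x w * Γ.lk y y = Γ.lk x y * Γ.lk y w := by
  by_cases hxy : x = y
  · subst hxy; ring
  have hx : x ∈ cutOff Γ.graph y x := mem_cutOff_self hxy
  have h : ∀ z ∈ cutOff Γ.graph y x,
      ∑ t, Γ.negMatrix z t * Γ.greenDiff y w (cutOff Γ.graph y x) t = 0 := by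
    intro z hz
    rw [Γ.sum_greenDiff w hz, if_neg]
    rintro rfl
    exact hw hz
  have h0 := Γ.nonneg_of_sum_eq (fun z hz => if_neg hz) (fun z hz => (h z hz).ge) x
  have h1 := Γ.nonneg_of_sum_eq (S := cutOff Γ.graph y x)
    (g := fun t => - Γ.greenDiff y w (cutOff Γ.graph y x) t)
    (fun z hz => neg_eq_zero.2 (if_neg hz)) (fun z hz => by simp [h z hz]) x
  simp only [greenDiff, if_pos hx] at h0 h1
  linarith

end ResolutionGraph

namespace ResolutionGraph

/-! ### Comparison of the splice diagram with the resolution graph -/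

section Comparison

variable {V : Type*} [Fintype V] (Γ : ResolutionGraph V)

lemma notMem_support_of_interior {x a b : Γ.SpliceVertex} {p : Γ.graph.Walk a.1 b.1}
    (hp : ∀ u ∈ p.support, u ≠ a.1 → u ≠ b.1 → valency Γ.graph u = 2) (ha : a ≠ x) (hb : b ≠ x) :
    x.1 ∉ p.support := fun hx =>
  x.2 (hp _ hx (fun h => ha (Subtype.ext h.symm)) fun h => hb (Subtype.ext h.symm))

/-- Cut the path at an interior vertex of valency other than 2 and recurse; without such a vertex it
is a single edge of the splice diagram. -/
lemma exists_spliceWalk (n : ℕ) : ∀ {v w : Γ.SpliceVertex} (p : Γ.graph.Walk v.1 w.1),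
    p.length = n → p.IsPath →
      ∃ q : Γ.spliceGraph.Walk v w, ∀ u ∈ q.support, u.1 ∈ p.support := by
  classical
  induction n using Nat.strong_induction_on with
  | _ n ih =>
    intro v w p hn hp
    by_cases hvw : v = w
    · subst hvw
      exact ⟨.nil, by simp⟩
    by_cases hint : ∀ u ∈ p.support, u ≠ v.1 → u ≠ w.1 → valency Γ.graph u = 2
    · refine ⟨SimpleGraph.Adj.toWalk (show Γ.spliceGraph.Adj v w from ⟨hvw, p, hp, hint⟩), ?_⟩
      simp only [SimpleGraph.Adj.toWalk, SimpleGraph.Walk.support_cons,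
        SimpleGraph.Walk.support_nil, List.mem_cons, List.not_mem_nil, or_false]
      rintro u (rfl | rfl)
      exacts [p.start_mem_support, p.end_mem_support]
    · push Not at hint
      obtain ⟨u, hu, huv, huw, hu2⟩ := hint
      have hlen : (p.takeUntil u hu).length + (p.dropUntil u hu).length = p.length := by
        rw [← SimpleGraph.Walk.length_append, p.take_spec]
      have h1 : (p.takeUntil u hu).length ≠ 0 := fun h =>
        huv (SimpleGraph.Walk.eq_of_length_eq_zero h).symm
      have h2 : (p.dropUntil u hu).length ≠ 0 := fun h =>
        huw (SimpleGraph.Walk.eq_of_length_eq_zero h)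
      obtain ⟨q₁, hq₁⟩ := ih (p.takeUntil u hu).length (by omega) (v := v) (w := ⟨u, hu2⟩)
        (p.takeUntil u hu) rfl (hp.takeUntil hu)
      obtain ⟨q₂, hq₂⟩ := ih (p.dropUntil u hu).length (by omega) (v := ⟨u, hu2⟩) (w := w)
        (p.dropUntil u hu) rfl (hp.dropUntil hu)
      refine ⟨q₁.append q₂, fun z hz => ?_⟩
      rcases (SimpleGraph.Walk.mem_support_append_iff _ _).1 hz with hz | hz
      exacts [p.support_takeUntil_subset_support hu (hq₁ z hz),
        p.support_dropUntil_subset_support hu (hq₂ z hz)]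

lemma mem_cutOff_spliceGraph {x v w : Γ.SpliceVertex} :
    w ∈ cutOff Γ.spliceGraph x v ↔ w.1 ∈ cutOff Γ.graph x.1 v.1 := by
  classical
  constructor
  · rintro ⟨p, hp⟩
    induction p with
    | @nil v =>
      refine mem_cutOff_self fun h => hp ?_
      rw [SimpleGraph.Walk.support_nil, List.mem_singleton]
      exact Subtype.ext h.symm
    | @cons v u w h q ih =>
      rw [SimpleGraph.Walk.support_cons, List.mem_cons, not_or] at hp
      obtain ⟨-, r, -, hr⟩ := h
      refine mem_cutOff_trans ⟨r, Γ.notMem_support_of_interior hr (Ne.symm hp.1) ?_⟩ (ih hp.2)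
      rintro rfl
      exact hp.2 q.start_mem_support
  · rintro ⟨p, hp⟩
    obtain ⟨q, hq⟩ := Γ.exists_spliceWalk _ (v := v) (w := w) p.toPath.1 rfl p.toPath.2
    exact ⟨q, fun h => hp (p.support_toPath_subset_support (hq x h))⟩

/-- A vertex of valency 2 entered from one neighbour leaves only one continuation, so both paths
follow the same string to its end. -/
lemma eq_of_common_start {x u a b : V} (hxu : Γ.graph.Adj x u) (p : Γ.graph.Walk u a)
    (hp : p.IsPath) (hxp : x ∉ p.support)
    (hpi : ∀ z ∈ p.support, z ≠ a → valency Γ.graph z = 2) (ha : valency Γ.graph a ≠ 2)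
    (q : Γ.graph.Walk u b) (hq : q.IsPath) (hxq : x ∉ q.support)
    (hqi : ∀ z ∈ q.support, z ≠ b → valency Γ.graph z = 2) (hb : valency Γ.graph b ≠ 2) :
    a = b := by
  induction p generalizing x with
  | @nil u =>
    by_contra hab
    exact ha (hqi u q.start_mem_support hab)
  | @cons u u₁ a h p ih =>
    rw [SimpleGraph.Walk.cons_isPath_iff] at hp
    have hu : valency Γ.graph u = 2 := hpi u (by simp) (by
      rintro rfl
      exact hp.2 p.end_mem_support)
    cases q with
    | nil => exact absurd hu hb
    | @cons _ u₂ _ h' q =>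
      rw [SimpleGraph.Walk.cons_isPath_iff] at hq
      simp only [SimpleGraph.Walk.support_cons, List.mem_cons, not_or] at hxp hxq
      have h12 : u₁ = u₂ := by
        by_contra hne
        have hx1 : x ≠ u₁ := by rintro rfl; exact hxp.2 p.start_mem_support
        have hx2 : x ≠ u₂ := by rintro rfl; exact hxq.2 q.start_mem_support
        have hsub : ({x, u₁, u₂} : Set V) ⊆ Γ.graph.neighborSet u := by
          rintro z (rfl | rfl | rfl)
          exacts [hxu.symm, h, h']
        have h3 := Set.ncard_le_ncard hsub
        rw [Set.ncard_eq_three.2 ⟨x, u₁, u₂, hx1, hx2, hne, rfl⟩] at h3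
        rw [valency] at hu
        omega
      subst h12
      exact ih h hp.1 hp.2 (fun z hz => hpi z (by simp [hz])) ha q hq.1 hq.2
        (fun z hz => hqi z (by simp [hz]))

lemma isSeparating_spliceGraph : IsSeparating Γ.spliceGraph := by
  intro x a b ha hb hab
  rw [mem_cutOff_spliceGraph] at hab
  obtain ⟨hxa, p, hp, hpi⟩ := ha
  obtain ⟨hxb, q, hq, hqi⟩ := hb
  refine Subtype.ext ?_
  have hxa' : x.1 ≠ a.1 := fun h => hxa (Subtype.ext h)
  have hxb' : x.1 ≠ b.1 := fun h => hxb (Subtype.ext h)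
  generalize hα : a.1 = α at *
  generalize hβ : b.1 = β at *
  cases p with
  | nil => exact absurd rfl hxa'
  | @cons _ u _ h p =>
    cases q with
    | nil => exact absurd rfl hxb'
    | @cons _ u' _ h' q =>
      rw [SimpleGraph.Walk.cons_isPath_iff] at hp hq
      have huu : u = u' := Γ.isSeparating h h'
        (mem_cutOff_trans (mem_cutOff_trans ⟨p, hp.2⟩ hab) (mem_cutOff_symm ⟨q, hq.2⟩))
      subst huu
      refine Γ.eq_of_common_start h p hp.1 hp.2 (fun z hz hzα => ?_) (hα ▸ a.2) q hq.1 hq.2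
        (fun z hz hzβ => ?_) (hβ ▸ b.2)
      · exact hpi z (by simp [hz]) (by rintro rfl; exact hp.2 hz) hzα
      · exact hqi z (by simp [hz]) (by rintro rfl; exact hq.2 hz) hzβ

lemma connected_spliceGraph [Nontrivial V] : Γ.spliceGraph.Connected := by
  have hc := Γ.connected
  rw [SimpleGraph.connected_iff]
  constructor
  · intro v w
    obtain ⟨p, hp⟩ := (hc v.1 w.1).exists_isPath
    obtain ⟨q, -⟩ := Γ.exists_spliceWalk _ p rfl hp
    exact ⟨q⟩
  · obtain ⟨s, t, hst⟩ := exists_pair_ne V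
    obtain ⟨u, hu, -⟩ := exists_mem_cutOff hc hst.symm
    obtain ⟨x, -, hx⟩ := Γ.isSeparating.exists_valency_ne_two hc hu
    exact ⟨⟨x, hx⟩⟩

/-- The edges of the splice diagram at a vertex correspond to the neighbours of that vertex in
the resolution graph. -/
lemma exists_firstStep {x u : Γ.SpliceVertex} (h : Γ.spliceGraph.Adj x u) :
    ∃ a, Γ.graph.Adj x.1 a ∧ u.1 ∈ cutOff Γ.graph x.1 a :=
  exists_mem_cutOff Γ.connected fun h' => h.1 (Subtype.ext h'.symm)

/-- The first vertex of the string that an edge of the splice diagram replaces. -/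
noncomputable def firstStep (x : Γ.SpliceVertex) (u : {u // Γ.spliceGraph.Adj x u}) :
    {a // Γ.graph.Adj x.1 a} :=
  ⟨(Γ.exists_firstStep u.2).choose, (Γ.exists_firstStep u.2).choose_spec.1⟩

lemma mem_cutOff_firstStep (x : Γ.SpliceVertex) (u : {u // Γ.spliceGraph.Adj x u}) :
    u.1.1 ∈ cutOff Γ.graph x.1 (Γ.firstStep x u) :=
  (Γ.exists_firstStep u.2).choose_spec.2

lemma cutOff_firstStep (x : Γ.SpliceVertex) (u : {u // Γ.spliceGraph.Adj x u}) :
    cutOff Γ.graph x.1 u.1.1 = cutOff Γ.graph x.1 (Γ.firstStep x u) :=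
  cutOff_congr (Γ.mem_cutOff_firstStep x u)

lemma bijective_firstStep [Nontrivial V] (x : Γ.SpliceVertex) :
    Function.Bijective (Γ.firstStep x) := by
  constructor
  · intro u u' h
    refine Subtype.ext (Γ.isSeparating_spliceGraph u.2 u'.2 ?_)
    rw [mem_cutOff_spliceGraph, cutOff_firstStep, h]
    exact Γ.mem_cutOff_firstStep x u'
  · intro a
    obtain ⟨s, hs, hs2⟩ := Γ.isSeparating.exists_valency_ne_two Γ.connected a.2
    have hsx : (⟨s, hs2⟩ : Γ.SpliceVertex) ≠ x := by
      rintro rfl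
      exact notMem_cutOff_right _ _ hs
    obtain ⟨u, hu, hsu⟩ := exists_mem_cutOff Γ.connected_spliceGraph hsx
    rw [mem_cutOff_spliceGraph] at hsu
    refine ⟨⟨u, hu⟩, Subtype.ext (Γ.isSeparating.eq_of_mem (Γ.firstStep x ⟨u, hu⟩).2 a.2
      (Γ.mem_cutOff_firstStep x ⟨u, hu⟩) ?_)⟩
    exact mem_cutOff_trans hs (mem_cutOff_symm hsu)

/-- The bijection between edges of the splice diagram and of the resolution graph. -/
noncomputable def edgeEquiv [Nontrivial V] (x : Γ.SpliceVertex) :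
    {u // Γ.spliceGraph.Adj x u} ≃ {a // Γ.graph.Adj x.1 a} :=
  Equiv.ofBijective _ (Γ.bijective_firstStep x)

lemma valency_spliceGraph [Nontrivial V] (x : Γ.SpliceVertex) :
    valency Γ.spliceGraph x = valency Γ.graph x.1 :=
  Nat.card_congr (Γ.edgeEquiv x)

lemma valency_pos [Nontrivial V] (v : V) : 0 < valency Γ.graph v := by
  obtain ⟨w, hw⟩ := exists_ne v
  obtain ⟨u, hu, -⟩ := exists_mem_cutOff Γ.connected hw
  exact (Set.ncard_pos).2 ⟨u, hu⟩

open scoped Classical in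
lemma sum_valency_add_two [Nontrivial V] :
    ∑ v, valency Γ.graph v + 2 = 2 * Fintype.card V := by
  have h1 := Γ.isTree.card_edgeFinset
  have h2 := Γ.graph.sum_degrees_eq_twice_card_edges
  have h3 : ∀ v, valency Γ.graph v = Γ.graph.degree v := fun v => by
    rw [valency, ← SimpleGraph.card_neighborSet_eq_degree, ← Nat.card_eq_fintype_card]
    rfl
  simp only [h3, h2]
  omega

/-- In a tree the numbers `valency - 2` add up to `-2`: each end contributes `-1`, strings
contribute nothing, and each node contributes its number of equations. -/
lemma card_eqIndex_add_two [Nontrivial V] :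
    Nat.card Γ.spliceDiagram.EqIndex + 2 = Nat.card Γ.spliceDiagram.End := by
  classical
  have h1 : Nat.card Γ.spliceDiagram.EqIndex =
      ∑ v : Γ.SpliceVertex, if 3 ≤ valency Γ.graph v.1 then valency Γ.graph v.1 - 2 else 0 := by
    rw [← Finset.sum_filter, Nat.card_sigma]
    simp only [Nat.card_eq_fintype_card, Fintype.card_fin]
    rw [Finset.sum_subtype (p := fun v => 3 ≤ valency Γ.spliceDiagram.graph v)]
    · exact Finset.sum_congr rfl fun v _ => by
        rw [show valency Γ.spliceDiagram.graph v.1 = _ from Γ.valency_spliceGraph v.1]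
    · intro v
      rw [show valency Γ.spliceDiagram.graph v = _ from Γ.valency_spliceGraph v]
      simp
  have h2 : Nat.card Γ.spliceDiagram.End =
      ∑ v : Γ.SpliceVertex, if valency Γ.graph v.1 = 1 then 1 else 0 := by
    rw [Nat.card_eq_fintype_card, Fintype.card_subtype, Finset.card_filter]
    refine Finset.sum_congr rfl fun v _ => ?_
    rw [show valency Γ.spliceDiagram.graph v = _ from Γ.valency_spliceGraph v]
  have h3 : ∀ f : V → ℕ, (∀ v, valency Γ.graph v = 2 → f v = 0) →
      ∑ v : Γ.SpliceVertex, f v.1 = ∑ v, f v := by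
    intro f hf
    rw [← Finset.sum_filter_add_sum_filter_not Finset.univ (fun v => valency Γ.graph v ≠ 2),
      Finset.sum_eq_zero (s := Finset.univ.filter fun v => ¬ valency Γ.graph v ≠ 2), add_zero]
    · exact (Finset.sum_subtype _ (by simp) _).symm
    · intro v hv
      exact hf v (not_not.1 (Finset.mem_filter.1 hv).2)
  rw [h1, h2, h3 (fun v => if 3 ≤ valency Γ.graph v then valency Γ.graph v - 2 else 0)
    (fun v hv => by simp [hv]),
    h3 (fun v => if valency Γ.graph v = 1 then 1 else 0) (fun v hv => by simp [hv])]
  have h4 : ∑ v, (valency Γ.graph v + if valency Γ.graph v = 1 then 1 else 0) =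
      ∑ v, (2 + if 3 ≤ valency Γ.graph v then valency Γ.graph v - 2 else 0) := by
    refine Finset.sum_congr rfl fun v _ => ?_
    have := Γ.valency_pos v
    split_ifs <;> omega
  have h5 := Γ.sum_valency_add_two
  rw [Finset.sum_add_distrib, Finset.sum_add_distrib] at h4
  simp only [Finset.sum_const, Finset.card_univ, smul_eq_mul] at h4
  omega

open scoped Classical in
lemma prod_edgeAt [Nontrivial V] (x : Γ.SpliceVertex) (P : Set V → Prop) :
    ∏ u : {u // Γ.spliceGraph.Adj x u} with P (cutOff Γ.graph x.1 u.1.1),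
        Γ.disc (cutOff Γ.graph x.1 u.1.1) =
      ∏ a with Γ.graph.Adj x.1 a ∧ P (cutOff Γ.graph x.1 a), Γ.disc (cutOff Γ.graph x.1 a) := by
  rw [Finset.prod_filter, ← Finset.filter_filter, Finset.prod_filter,
    Finset.prod_subtype (p := fun a => Γ.graph.Adj x.1 a) _ (by simp)]
  refine Fintype.prod_equiv (Γ.edgeEquiv x) _ _ fun u => ?_
  rw [cutOff_firstStep]
  rfl

lemma nodeWeight_spliceDiagram [Nontrivial V] (v : Γ.SpliceVertex) :
    Γ.spliceDiagram.nodeWeight v = Γ.lk v.1 v.1 := by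
  classical
  have := Γ.prod_edgeAt v fun _ => True
  simp only [and_true, Finset.filter_true] at this
  rw [lk_self, ← this, SpliceDiagram.nodeWeight]
  exact Finset.prod_congr (Finset.ext fun u => ⟨fun _ => Finset.mem_univ u,
    fun _ => Finset.mem_univ u⟩) fun _ _ => rfl

lemma mem_onPath_spliceGraph [Nontrivial V] {v w x : Γ.SpliceVertex} :
    x ∈ onPath Γ.spliceGraph v w ↔ w.1 ∉ cutOff Γ.graph x.1 v.1 := by
  rw [Γ.isSeparating_spliceGraph.mem_onPath_iff Γ.connected_spliceGraph, mem_cutOff_spliceGraph]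

open scoped Classical in
lemma prod_edgeAt_notMem_onPath [Nontrivial V] {v w x : Γ.SpliceVertex}
    (hx : x ∈ onPath Γ.spliceGraph v w) :
    ∏ u : {u // Γ.spliceGraph.Adj x u} with u.1 ∉ onPath Γ.spliceGraph v w,
      Γ.disc (cutOff Γ.graph x.1 u.1.1) = Γ.offProd v.1 w.1 x.1 := by
  have h := Γ.prod_edgeAt x fun S => v.1 ∉ S ∧ w.1 ∉ S
  refine Eq.trans ?_ (h.trans (Finset.prod_congr (by congr!) fun _ _ => rfl))
  refine Finset.prod_congr ?_ fun _ _ => rfl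
  ext u
  simp only [Finset.mem_filter, Finset.mem_univ, true_and]
  rw [Γ.isSeparating_spliceGraph.adj_mem_onPath_iff Γ.connected_spliceGraph hx u.2,
    mem_cutOff_spliceGraph, mem_cutOff_spliceGraph, not_or]

lemma offProd_eq_one {v w x : V} (h : ∀ a, Γ.graph.Adj x a →
    v ∈ cutOff Γ.graph x a ∨ w ∈ cutOff Γ.graph x a) : Γ.offProd v w x = 1 := by
  classical
  rw [offProd]
  refine Finset.prod_eq_one fun a ha => ?_
  obtain ⟨ha, hv, hw⟩ := (Finset.mem_filter.1 ha).2
  rcases h a ha with h | h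
  exacts [absurd h hv, absurd h hw]

/-- A vertex of valency below 3 on the path from a node to an end has no edge leaving that path. -/
lemma offProd_eq_one_of_valency [Nontrivial V] {v w x : V} (hv : 3 ≤ valency Γ.graph v)
    (hw : valency Γ.graph w = 1)
    (hx : w ∉ cutOff Γ.graph x v) (hx3 : valency Γ.graph x < 3) : Γ.offProd v w x = 1 := by
  have hxv : v ≠ x := by rintro rfl; omega
  obtain ⟨b, hb, hvb⟩ := exists_mem_cutOff Γ.connected hxv
  refine Γ.offProd_eq_one fun a ha => ?_
  by_cases hab : a = b
  · exact Or.inl (hab ▸ hvb)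
  right
  have hsub : ({a, b} : Set V) ⊆ Γ.graph.neighborSet x := by
    rintro z (rfl | rfl)
    exacts [ha, hb]
  have hle := Set.ncard_le_ncard hsub
  rw [Set.ncard_pair hab] at hle
  have hxw : w ≠ x := by
    rintro rfl
    rw [valency] at hw
    omega
  obtain ⟨c, hc, hwc⟩ := exists_mem_cutOff Γ.connected hxw
  by_cases hca : c = a
  · exact hca ▸ hwc
  have hcb : c ≠ b := by
    rintro rfl
    exact hx (mem_cutOff_trans (mem_cutOff_symm hvb) hwc)
  have hsub3 : ({a, b, c} : Set V) ⊆ Γ.graph.neighborSet x := by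
    rintro z (rfl | rfl | rfl)
    exacts [ha, hb, hc]
  have hle3 := Set.ncard_le_ncard hsub3
  rw [Set.ncard_eq_three.2 ⟨a, b, c, hab, Ne.symm hca, Ne.symm hcb, rfl⟩] at hle3
  rw [valency] at hx3
  omega

/-- Both sides are products over the path of the weights branching off it, and vertices of the
resolution graph that are not nodes contribute 1. -/
lemma linking_spliceDiagram [Nontrivial V] (v : Γ.spliceDiagram.Node)
    (w : Γ.spliceDiagram.End) : Γ.spliceDiagram.linking v.1 w.1 = Γ.lk v.1.1 w.1.1 := by
  classical
  have hv : 3 ≤ valency Γ.graph v.1.1 := (Γ.valency_spliceGraph v.1) ▸ v.2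
  have hw : valency Γ.graph w.1.1 = 1 := (Γ.valency_spliceGraph w.1) ▸ w.2
  rw [lk_eq_prod, SpliceDiagram.linking]
  have h1 : ∀ x : Γ.spliceDiagram.Node, x.1 ∈ onPath Γ.spliceDiagram.graph v.1 w.1 ↔
      w.1.1 ∉ cutOff Γ.graph x.1.1 v.1.1 := fun x => Γ.mem_onPath_spliceGraph
  rw [← Finset.prod_subset (s₁ := Finset.univ.filter fun x =>
    3 ≤ valency Γ.graph x ∧ w.1.1 ∉ cutOff Γ.graph x v.1.1)]
  · refine Finset.prod_bij (fun x _ => x.1.1) ?_ ?_ ?_ ?_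
    · intro x hx
      simp only [Finset.mem_filter, Finset.mem_univ, true_and] at hx ⊢
      exact ⟨(Γ.valency_spliceGraph x.1) ▸ x.2, (h1 x).1 hx⟩
    · intro x _ y _ h
      exact Subtype.ext (Subtype.ext h)
    · intro x hx
      simp only [Finset.mem_filter, Finset.mem_univ, true_and] at hx
      have hx3 : 3 ≤ valency Γ.spliceGraph ⟨x, by omega⟩ :=
        (Γ.valency_spliceGraph ⟨x, by omega⟩).symm ▸ hx.1
      refine ⟨⟨⟨x, by omega⟩, hx3⟩, ?_, rfl⟩
      simp only [Finset.mem_filter, Finset.mem_univ, true_and]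
      exact (h1 ⟨⟨x, by omega⟩, hx3⟩).2 hx.2
    · intro x hx
      have hx' := (Finset.mem_filter.1 hx).2
      have := Γ.prod_edgeAt_notMem_onPath hx'
      rw [← this]
      exact Finset.prod_congr (by congr!) fun _ _ => rfl
  · intro x hx
    simp only [Finset.mem_filter, Finset.mem_univ, true_and] at hx ⊢
    exact hx.2
  · intro x hx hx'
    simp only [Finset.mem_filter, Finset.mem_univ, true_and, not_and] at hx hx'
    exact Γ.offProd_eq_one_of_valency hv hw hx (by
      by_contra h
      exact hx' (by omega) hx)

end Comparison

end ResolutionGraph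

namespace ResolutionGraph

variable {V : Type*} [Fintype V] [Nontrivial V] (Γ : ResolutionGraph V)

/-! ### Existence of admissible monomials -/

lemma mem_onPath_spliceDiagram_of_adj {v w : Γ.SpliceVertex} (u : Γ.spliceDiagram.EdgeAt v)
    (hw : w ∈ cutOff Γ.spliceDiagram.graph v u.1) (u' : Γ.spliceDiagram.EdgeAt v) :
    u'.1 ∈ onPath Γ.spliceDiagram.graph v w ↔ u' = u := by
  have hs := Γ.isSeparating_spliceGraph
  have hv : v ∈ onPath Γ.spliceGraph v w :=
    (hs.mem_onPath_iff Γ.connected_spliceGraph).2 (notMem_cutOff_left _ _)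
  refine (hs.adj_mem_onPath_iff Γ.connected_spliceGraph hv u'.2).trans ?_
  constructor
  · rintro (h | h)
    · exact absurd h (notMem_cutOff_right _ _)
    · exact Subtype.ext (hs.eq_of_mem u'.2 u.2 h hw)
  · rintro rfl
    exact Or.inr hw

open scoped Classical in
lemma linking_eq_linking'_mul (v : Γ.spliceDiagram.Node) (u : Γ.spliceDiagram.EdgeAt v.1)
    {w : Γ.SpliceVertex} (hw : w ∈ cutOff Γ.spliceDiagram.graph v.1 u.1) :
    Γ.spliceDiagram.linking v.1 w = Γ.spliceDiagram.linking' v.1 w *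
      ∏ u' ∈ Finset.univ.erase u, Γ.spliceDiagram.weight v.1 u'.1 := by
  have hv : v.1 ∈ onPath Γ.spliceDiagram.graph v.1 w :=
    (Γ.isSeparating_spliceGraph.mem_onPath_iff Γ.connected_spliceGraph).2
      (notMem_cutOff_left _ _)
  have h1 : (Finset.univ.filter fun x : Γ.spliceDiagram.Node =>
      x.1 ∈ onPath Γ.spliceDiagram.graph v.1 w) = insert v (Finset.univ.filter fun x =>
        x.1 ∈ onPath Γ.spliceDiagram.graph v.1 w ∧ x.1 ≠ v.1) := by
    ext x
    simp only [Finset.mem_filter, Finset.mem_univ, true_and, Finset.mem_insert]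
    by_cases hxv : x = v
    · simp [hxv, hv]
    · have : x.1 ≠ v.1 := fun h => hxv (Subtype.ext h)
      simp [hxv, this]
  rw [SpliceDiagram.linking, SpliceDiagram.linking', h1, Finset.prod_insert (by simp), mul_comm]
  refine congrArg₂ (· * ·) (Finset.prod_congr (by congr!) fun _ _ => rfl) ?_
  refine Finset.prod_congr (Finset.ext fun u' => ?_) fun _ _ => rfl
  simp only [Finset.mem_filter, Finset.mem_univ, true_and, Finset.mem_erase, and_true]
  exact not_congr (Γ.mem_onPath_spliceDiagram_of_adj u hw u')

/-- Multiply the semigroup expression for the weight of the edge by the other weights at `v`: this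
turns `ℓ'` into `ℓ` and the edge weight into `d_v`. -/
theorem exists_isAdmissible (hsg : Γ.spliceDiagram.SemigroupCondition)
    (v : Γ.spliceDiagram.Node) (u : Γ.spliceDiagram.EdgeAt v.1) :
    ∃ α, Γ.spliceDiagram.IsAdmissible v u α := by
  classical
  have key : ∀ a ∈ AddSubmonoid.closure {a : ℤ | ∃ w : Γ.spliceDiagram.End,
      w.1 ∈ cutOff Γ.spliceDiagram.graph v.1 u.1 ∧ a = Γ.spliceDiagram.linking' v.1 w.1},
      ∃ α : Γ.spliceDiagram.End →₀ ℕ,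
        (∀ w ∈ α.support, w.1 ∈ cutOff Γ.spliceDiagram.graph v.1 u.1) ∧
        α.sum (fun w a => (a : ℤ) * Γ.spliceDiagram.linking' v.1 w.1) = a := by
    intro a ha
    induction ha using AddSubmonoid.closure_induction with
    | mem a h =>
      obtain ⟨w, hw, rfl⟩ := h
      refine ⟨Finsupp.single w 1, fun w' hw' => ?_, by simp⟩
      have := Finsupp.support_single_subset hw'
      rw [Finset.mem_singleton] at this
      exact this ▸ hw
    | zero => exact ⟨0, by simp, by simp⟩
    | add a b _ _ iha ihb =>
      obtain ⟨α, hα, rfl⟩ := iha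
      obtain ⟨β, hβ, rfl⟩ := ihb
      refine ⟨α + β, fun w hw => ?_, ?_⟩
      · rcases Finset.mem_union.1 (Finsupp.support_add hw) with h | h
        exacts [hα w h, hβ w h]
      · exact Finsupp.sum_add_index' (by simp) fun w a b => by push_cast; ring
  obtain ⟨α, hα, hsum⟩ := key _ (hsg v u)
  refine ⟨α, hα, ?_⟩
  have h2 : Γ.spliceDiagram.nodeWeight v.1 = Γ.spliceDiagram.weight v.1 u.1 *
      ∏ u' ∈ Finset.univ.erase u, Γ.spliceDiagram.weight v.1 u'.1 :=
    (Finset.mul_prod_erase _ _ (Finset.mem_univ u)).symm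
  rw [h2, ← hsum, Finsupp.sum, Finsupp.sum, Finset.sum_mul]
  refine Finset.sum_congr rfl fun w hw => ?_
  rw [Γ.linking_eq_linking'_mul v u (hα w hw), mul_assoc]

/-! ### The system attached to a choice of monomials -/

omit [Nontrivial V] in
lemma exists_edgeAt (v : Γ.spliceDiagram.Node) : Nonempty (Γ.spliceDiagram.EdgeAt v.1) := by
  have h : 0 < (Γ.spliceGraph.neighborSet v.1).ncard := lt_of_lt_of_le (by norm_num) v.2
  obtain ⟨u, hu⟩ := (Set.ncard_pos).1 h
  exact ⟨⟨u, hu⟩⟩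

open scoped Classical in
/-- The edge at `v` in the direction of `z`. -/
noncomputable def direction (v : Γ.spliceDiagram.Node) (z : Γ.SpliceVertex) :
    Γ.spliceDiagram.EdgeAt v.1 :=
  if h : ∃ u : Γ.spliceDiagram.EdgeAt v.1, z.1 ∈ cutOff Γ.graph v.1.1 u.1.1 then h.choose
  -- This default is reached only for `z = v`.
  else (Γ.exists_edgeAt v).some

lemma direction_eq_iff {v : Γ.spliceDiagram.Node} {z : Γ.SpliceVertex} (hz : z ≠ v.1)
    (u : Γ.spliceDiagram.EdgeAt v.1) :
    Γ.direction v z = u ↔ z.1 ∈ cutOff Γ.graph v.1.1 u.1.1 := by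
  have h : ∃ u : Γ.spliceDiagram.EdgeAt v.1, z.1 ∈ cutOff Γ.graph v.1.1 u.1.1 := by
    obtain ⟨u, hu, hzu⟩ := exists_mem_cutOff Γ.connected_spliceGraph hz
    exact ⟨⟨u, hu⟩, Γ.mem_cutOff_spliceGraph.1 hzu⟩
  rw [direction, dif_pos h]
  constructor
  · rintro rfl
    exact h.choose_spec
  · intro hu
    have h' := h.choose_spec
    rw [← mem_cutOff_spliceGraph] at h' hu
    exact Subtype.ext (Γ.isSeparating_spliceGraph.eq_of_mem h.choose.2 u.2 h' hu)

lemma direction_eq_direction_iff {v : Γ.spliceDiagram.Node} {z z' : Γ.SpliceVertex}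
    (hz : z ≠ v.1) (hz' : z' ≠ v.1) :
    Γ.direction v z = Γ.direction v z' ↔ z.1 ∈ cutOff Γ.graph v.1.1 z'.1 := by
  have h' := (Γ.direction_eq_iff hz' _).1 rfl
  rw [direction_eq_iff Γ hz, cutOff_congr h']

omit [Nontrivial V] in
lemma end_ne_node (v : Γ.spliceDiagram.Node) (w : Γ.spliceDiagram.End) : w.1 ≠ v.1 := by
  intro h
  have h1 := v.2
  have h2 := w.2
  rw [h] at h2
  omega

lemma direction_congr {x y : Γ.spliceDiagram.Node} {z : Γ.SpliceVertex} (hxy : x ≠ y)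
    (hzx : z ≠ x.1) (hzy : z ≠ y.1) (h : Γ.direction y z ≠ Γ.direction y x.1) :
    Γ.direction x z = Γ.direction x y.1 := by
  have hxy' : x.1 ≠ y.1 := fun h => hxy (Subtype.ext h)
  rw [Γ.direction_eq_direction_iff hzx hxy'.symm]
  rw [Ne, Γ.direction_eq_direction_iff hzy hxy'] at h
  exact mem_cutOff_of_notMem Γ.connected (fun h => hxy' (Subtype.ext h)) h

lemma node_adj_end_or_node (y : Γ.spliceDiagram.Node) (e : Γ.spliceDiagram.EdgeAt y.1) :
    (∃ w₀ : Γ.spliceDiagram.End, ∀ w : Γ.spliceDiagram.End,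
        Γ.direction y w.1 = e ↔ w = w₀) ∨
      ∃ c : Γ.spliceDiagram.Node, c ≠ y ∧ Γ.direction y c.1 = e ∧
        ∀ w : Γ.spliceDiagram.End, Γ.direction y w.1 = e ↔
          Γ.direction c w.1 ≠ Γ.direction c y.1 := by
  have hadj : Γ.spliceGraph.Adj y.1 e.1 := e.2
  have hmem : e.1.1 ∈ cutOff Γ.graph y.1.1 e.1.1 :=
    mem_cutOff_self fun h => hadj.ne (Subtype.ext h.symm)
  by_cases h1 : valency Γ.spliceGraph e.1 = 1
  · refine Or.inl ⟨⟨e.1, h1⟩, fun w => ?_⟩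
    rw [Γ.direction_eq_iff (Γ.end_ne_node y w)]
    constructor
    · intro hw
      exact Subtype.ext (mem_cutOff_eq_of_valency_one hadj h1 (Γ.mem_cutOff_spliceGraph.2 hw))
    · rintro rfl
      exact hmem
  · right
    have h3 : 3 ≤ valency Γ.spliceGraph e.1 := by
      have h2 := Γ.valency_spliceGraph e.1
      have := Γ.valency_pos e.1.1
      have := e.1.2
      omega
    refine ⟨⟨e.1, h3⟩, fun h => hadj.ne (congrArg Subtype.val h).symm,
      (Γ.direction_eq_iff hadj.ne' e).2 hmem, fun w => ?_⟩
    rw [Γ.direction_eq_iff (Γ.end_ne_node y w), Ne,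
      Γ.direction_eq_direction_iff (Γ.end_ne_node ⟨e.1, h3⟩ w) hadj.ne,
      ← mem_cutOff_spliceGraph, ← mem_cutOff_spliceGraph]
    exact Γ.isSeparating_spliceGraph.mem_iff_of_adj Γ.connected_spliceGraph hadj

variable {Γ}

omit [Nontrivial V] in
lemma toNat_lk (v w : V) : ((Γ.lk v w).toNat : ℤ) = Γ.lk v w :=
  Int.toNat_of_nonneg (Γ.lk_pos v w).le

omit [Nontrivial V] in
lemma IsAdmissible.mem_cutOff {v : Γ.spliceDiagram.Node} {u : Γ.spliceDiagram.EdgeAt v.1}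
    {α : Γ.spliceDiagram.End →₀ ℕ} (h : Γ.spliceDiagram.IsAdmissible v u α)
    {w : Γ.spliceDiagram.End} (hw : w ∈ α.support) : w.1.1 ∈ cutOff Γ.graph v.1.1 u.1.1 :=
  Γ.mem_cutOff_spliceGraph.1 (h.1 w hw)

lemma IsAdmissible.sum_eq {v : Γ.spliceDiagram.Node} {u : Γ.spliceDiagram.EdgeAt v.1}
    {α : Γ.spliceDiagram.End →₀ ℕ} (h : Γ.spliceDiagram.IsAdmissible v u α) :
    ∑ w ∈ α.support, (α w : ℤ) * Γ.lk v.1.1 w.1.1 = Γ.lk v.1.1 v.1.1 := by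
  have h2 := h.2
  rw [nodeWeight_spliceDiagram, Finsupp.sum] at h2
  rw [← h2]
  exact Finset.sum_congr rfl fun w _ => by rw [linking_spliceDiagram]

/-- For `y ≠ x`, the node `y` separates `x` from every end in the monomial. Hence `lk_mul_lk_eq`,
applied termwise, carries the weight `lk y y` seen from `y` over to `lk x y` seen from `x`. -/
lemma IsAdmissible.sum_outward {x y : Γ.spliceDiagram.Node} {e : Γ.spliceDiagram.EdgeAt y.1}
    {α : Γ.spliceDiagram.End →₀ ℕ} (h : Γ.spliceDiagram.IsAdmissible y e α)
    (hxe : y = x ∨ e ≠ Γ.direction y x.1) :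
    ∑ w ∈ α.support, (α w : ℤ) * Γ.lk x.1.1 w.1.1 = Γ.lk x.1.1 y.1.1 := by
  rcases eq_or_ne y x with rfl | hyx
  · exact IsAdmissible.sum_eq h
  have hxy : x.1 ≠ y.1 := fun h => hyx (Subtype.ext h.symm)
  have he := hxe.resolve_left hyx
  refine mul_right_cancel₀ (Γ.lk_pos y.1.1 y.1.1).ne' ?_
  nth_rewrite 2 [← IsAdmissible.sum_eq h]
  rw [Finset.sum_mul, Finset.mul_sum]
  refine Finset.sum_congr rfl fun w hw => ?_
  have hwx : w.1.1 ∉ cutOff Γ.graph y.1.1 x.1.1 := by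
    rw [← Γ.direction_eq_direction_iff (Γ.end_ne_node y w) hxy,
      (Γ.direction_eq_iff (Γ.end_ne_node y w) e).2 (IsAdmissible.mem_cutOff h hw)]
    exact he
  rw [mul_assoc, Γ.lk_mul_lk_eq hwx]
  ring

/-- The ends in the monomial lie on the same side of `y` as `x`, so the termwise comparison is
strict. -/
lemma IsAdmissible.lt_sum_inward {x y : Γ.spliceDiagram.Node} (hyx : y ≠ x)
    {α : Γ.spliceDiagram.End →₀ ℕ}
    (h : Γ.spliceDiagram.IsAdmissible y (Γ.direction y x.1) α) :
    Γ.lk x.1.1 y.1.1 < ∑ w ∈ α.support, (α w : ℤ) * Γ.lk x.1.1 w.1.1 := by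
  have hxy : x.1 ≠ y.1 := fun h => hyx (Subtype.ext h.symm)
  refine lt_of_mul_lt_mul_right ?_ (Γ.lk_pos y.1.1 y.1.1).le
  nth_rewrite 1 [← IsAdmissible.sum_eq h]
  rw [Finset.sum_mul, Finset.mul_sum]
  have hne : α.support.Nonempty := by
    rw [Finset.nonempty_iff_ne_empty]
    intro h0
    have := IsAdmissible.sum_eq h
    rw [h0, Finset.sum_empty] at this
    exact (Γ.lk_pos _ _).ne this
  refine Finset.sum_lt_sum_of_nonempty hne fun w hw => ?_
  have hwx : w.1.1 ∈ cutOff Γ.graph y.1.1 x.1.1 := by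
    rw [← Γ.direction_eq_direction_iff (Γ.end_ne_node y w) hxy,
      (Γ.direction_eq_iff (Γ.end_ne_node y w) _).2 (IsAdmissible.mem_cutOff h hw)]
  have h1 := Γ.lk_mul_lk_lt hwx
  have h2 : (0 : ℤ) < α w := by
    have := Finsupp.mem_support_iff.1 hw
    omega
  have := mul_lt_mul_of_pos_left h1 h2
  calc Γ.lk x.1.1 y.1.1 * ((α w : ℤ) * Γ.lk y.1.1 w.1.1)
      = α w * (Γ.lk x.1.1 y.1.1 * Γ.lk y.1.1 w.1.1) := by ring
    _ < _ := this
    _ = _ := by ring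

/-- The combinatorial data of the system of equations attached to a choice of monomials. -/
noncomputable def toSpliceSystem (S : Γ.spliceDiagram.MonomialChoice) (hS : S.IsValid) :
    SpliceSystem Γ.spliceDiagram.Node Γ.spliceDiagram.End
      (fun v => Γ.spliceDiagram.EdgeAt v.1) where
  r v := valency Γ.spliceDiagram.graph v.1 - 2
  dirL v w := Γ.direction v w.1
  dirN v x := Γ.direction v x.1
  linkL v w := (Γ.lk v.1.1 w.1.1).toNat
  linkN v x := (Γ.lk v.1.1 x.1.1).toNat
  S := S
  one_le_r v := by have := v.2; omega
  card_dir v := by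
    have h2 := v.2
    have : Nat.card (Γ.spliceDiagram.EdgeAt v.1) = valency Γ.spliceDiagram.graph v.1 := rfl
    omega
  linkL_pos v w := by have := Γ.lk_pos v.1.1 w.1.1; omega
  linkN_pos v w := by have := Γ.lk_pos v.1.1 w.1.1; omega
  nonempty v e := (hS v e).1
  dirL_of_mem v e α hα w hw :=
    (Γ.direction_eq_iff (Γ.end_ne_node v w) e).2 (IsAdmissible.mem_cutOff ((hS v e).2 α hα) hw)
  weight_outward x y e α hα h := by
    have := IsAdmissible.sum_outward ((hS y e).2 α hα) h
    zify
    simp only [Finsupp.sum, toNat_lk]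
    exact this
  weight_inward x y hyx α hα := by
    have := IsAdmissible.lt_sum_inward hyx ((hS y _).2 α hα)
    zify
    simp only [Finsupp.sum, toNat_lk]
    exact this
  dirL_eq x y w hxy h := Γ.direction_congr hxy (Γ.end_ne_node x w) (Γ.end_ne_node y w) h
  dirN_eq x y z hxy hzy h := by
    refine Γ.direction_congr hxy ?_ (fun h => hzy (Subtype.ext h)) h
    intro hzx
    exact h (by rw [hzx])
  edge := Γ.node_adj_end_or_node

end ResolutionGraph

/-! ### The Zariski-open set of coefficients -/

namespace SpliceSystem

variable {N L : Type*} {D : N → Type*} (T : SpliceSystem N L D) [∀ x, Fintype (D x)]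

lemma eval_zero_eqn (b : T.Idx → ℂ) (j : Σ x, Fin (T.r x)) :
    MvPolynomial.eval 0 (T.eqn b j) = 0 := by
  rw [eval_eqn]
  refine Finset.sum_eq_zero fun m _ => ?_
  obtain ⟨w, hw⟩ := T.exists_mem_support m.2.2
  rw [mono, Finsupp.prod, Finset.prod_eq_zero hw, mul_zero]
  exact zero_pow (Finsupp.mem_support_iff.1 hw)

/-- The part of a polynomial in coefficients and variables that does not depend on the
variables. -/
noncomputable def constPart (q : MvPolynomial (T.Idx ⊕ L) ℂ) : MvPolynomial T.Idx ℂ :=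
  MvPolynomial.aeval (Sum.elim MvPolynomial.X 0) q

omit [∀ x, Fintype (D x)] in
lemma eval_constPart (q : MvPolynomial (T.Idx ⊕ L) ℂ) (b : T.Idx → ℂ) :
    MvPolynomial.eval b (T.constPart q) = MvPolynomial.eval (Sum.elim b 0) q := by
  rw [constPart, MvPolynomial.aeval_def, MvPolynomial.eval_eval₂, MvPolynomial.eval,
    MvPolynomial.coe_eval₂Hom]
  congr 1
  · ext t
    simp
  · ext (j | w) <;> simp

/-- The Zariski-open set of coefficients for which the system defines an isolated complete
intersection singularity. -/
theorem exists_isZariskiOpen [Fintype N] [Fintype L]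
    (hcard : Nat.card (Σ x, Fin (T.r x)) + 2 = Nat.card L) :
    ∃ U : Set (T.Idx → ℂ), IsZariskiOpen U ∧ (∀ c, T.IsGeneric c → c ∈ U) ∧
      ∀ b ∈ U, IsIsolatedCISurfaceSingularity (T.eqn b) := by
  -- Each `q` that certifies independence of the differentials contributes the open set where its
  -- restriction to the origin of the variables is nonzero; `U` is the union of these sets.
  set P : Set (MvPolynomial T.Idx ℂ) := {p | ∃ q : MvPolynomial (T.Idx ⊕ L) ℂ,
    p = T.constPart q ∧ ∀ (b : T.Idx → ℂ) (z : L → ℂ),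
      MvPolynomial.eval (Sum.elim b z) q ≠ 0 → z ≠ 0 →
        (∀ j, MvPolynomial.eval z (T.eqn b j) = 0) →
        LinearIndependent ℂ fun (j : Σ x, Fin (T.r x)) (w : L) =>
          MvPolynomial.eval z (MvPolynomial.pderiv w (T.eqn b j))}
  refine ⟨{c | ∃ p ∈ P, MvPolynomial.eval c p ≠ 0}, ⟨P, rfl⟩, fun c hc => ?_, ?_⟩
  · obtain ⟨q, hq0, hq⟩ := hc.exists_polynomial
    exact ⟨_, ⟨q, rfl, hq⟩, by rwa [eval_constPart]⟩
  · rintro b ⟨_, ⟨q, rfl, hq⟩, hb⟩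
    rw [eval_constPart] at hb
    have heval : ∀ z : L → ℂ, MvPolynomial.eval z
        (MvPolynomial.aeval (Sum.elim (fun i => MvPolynomial.C (b i)) MvPolynomial.X) q) =
          MvPolynomial.eval (Sum.elim b z) q := by
      intro z
      rw [MvPolynomial.aeval_def, MvPolynomial.eval_eval₂, MvPolynomial.eval,
        MvPolynomial.coe_eval₂Hom]
      congr 1
      · ext t
        simp
      · ext (j | w) <;> simp
    refine isIsolatedCISurfaceSingularity_of_linearIndependent _ (T.eval_zero_eqn b)
      (by rwa [← Nat.card_eq_fintype_card, ← Nat.card_eq_fintype_card])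
      (MvPolynomial.aeval (Sum.elim (fun i => MvPolynomial.C (b i)) MvPolynomial.X) q)
      (by rwa [heval]) fun z hz hzq hf => hq b z (by rwa [heval] at hzq) hz hf

end SpliceSystem

end SpliceSing

theorem mainTheorem1 {V : Type*} [Fintype V] [Nontrivial V]
    (Γ : SpliceSing.ResolutionGraph V)
    (hsg : Γ.spliceDiagram.SemigroupCondition) :
    (∀ (v : Γ.spliceDiagram.Node) (u : Γ.spliceDiagram.EdgeAt v.1),
      ∃ α, Γ.spliceDiagram.IsAdmissible v u α) ∧
    ∀ S : Γ.spliceDiagram.MonomialChoice, S.IsValid →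
      ∃ U : Set (S.CoeffIndex → ℂ), SpliceSing.IsZariskiOpen U ∧ U.Nonempty ∧
        (∀ c ∈ U, SpliceSing.IsIsolatedCISurfaceSingularity (S.system c)) ∧
        ∀ c : S.CoeffIndex → ℂ, (∀ v, S.IsSingleAt v → S.MaximalMinorsNonzero c v) →
          ∃ c' ∈ U, ∀ v, S.IsSingleAt v → S.coeffMatrix c' v = S.coeffMatrix c v := by
  classical
  refine ⟨fun v u => Γ.exists_isAdmissible hsg v u, fun S hS => ?_⟩
  set T := SpliceSing.ResolutionGraph.toSpliceSystem S hS with hT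
  obtain ⟨U, hU, hgen, hsing⟩ := T.exists_isZariskiOpen Γ.card_eqIndex_add_two
  have hfin : Finite T.Idx := by
    have : ∀ x, Finite (T.Mon x) := fun x => inferInstance
    infer_instance
  refine ⟨U, hU, ?_, fun c hc => ?_, fun c hc => ?_⟩
  -- Nonemptiness needs no prescribed coefficients, so the predicate is empty and the initial
  -- coefficients are irrelevant.
  · obtain ⟨c, hc, -⟩ := T.exists_isGeneric 0 (fun _ => False) fun _ h => h.elim
    exact ⟨c, hgen c hc⟩
  · have h : S.system c = T.eqn c := by
      funext j
      exact Finset.sum_congr (by congr!) fun _ _ => rfl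
    rw [h]
    exact hsing c hc
  · obtain ⟨c', hc', h⟩ := T.exists_isGeneric c (fun v => S.IsSingleAt v)
      fun v hv => ⟨hv, fun g => hc v hv g⟩
    refine ⟨c', hgen c' hc', fun v hv => ?_⟩
    ext i m
    exact h v hv (i, m)
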